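/- Let $X$ be a finite regular CW complex (Hausdorff; each closed cell is a closed ball whose boundary sphere is a union of closed cells of lower dimension), with skeleta $X^{(n)}$, and let $\mathcal F(X)$ be its face poset, the closed cells ordered by inclusion. Let $X$ be oriented: for every $n$-cell $\sigma$ a generator $o_\sigma$ of $H_n(\sigma,\partial\sigma;\mathbb Z)\cong\mathbb Z$ is chosen, where $\sigma$ is the closed cell and $\partial\sigma$ its frontier. Let $C_n=H_n(X^{(n)},X^{(n-1)};\mathbb Z)$ be the cellular chain groups, with cellular boundary operator $\partial\colon C_{n+1}\to H_n(X^{(n)})\to C_n$, and write again $\sigma\in C_n$ for the image of $o_\sigma$. For an $(n+1)$-cell $\tau$ and an $n$-cell $\sigma$ with open cell $\mathring\sigma$, the incidence number $[\tau:\sigma]$ is the degree with which the oriented boundary of $\tau$ meets $\sigma$, that is, the integer $k$ such that the image of $o_\tau$ under $H_{n+1}(\tau,\partial\tau)\to H_n(\partial\tau)\to H_n(X^{(n)})\to H_n(X^{(n)},X^{(n)}\setminus\mathring\sigma)$ is $k$ times the image of $o_\sigma$. An interval $[\sigma,\tau]$ of $\mathcal F(X)$ has rank one if $\sigma<\tau$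 and $\dim\tau=\dim\sigma+1$. The incidence coalgebra of $\mathcal F(X)$ is the $\mathbb Q$-vector space with basis the intervals $[\sigma,\tau]$, $\sigma\le\tau$, with $\Delta[\sigma,\tau]=\sum_{\sigma\le\rho\le\tau}[\sigma,\rho]\otimes[\rho,\tau]$, $\varepsilon[\sigma,\sigma]=1$, and $\varepsilon[\sigma,\tau]=0$ for $\sigma<\tau$. Then: 1. Every incidence number $[\tau:\sigma]$ is well defined (the integer $k$ exists and is unique); it is $\pm1$ if $[\sigma,\tau]$ is a rank-one interval, and $0$ otherwise. 2. For every $n$ the oriented $n$-cells form a $\mathbb Z$-basis of $C_n$; for every $(n+1)$-cell $\tau$ $$\partial\tau=\sum_{\substack{\sigma<\tau\\ \dim\sigma=\dim\tau-1}}[\tau:\sigma]\,\sigma ;$$ and $\partial\circ\partial=0$. 3. The rank-one intervals together with their incidence numbers are equivalent to the cellular boundary operator: if $Y$ is another oriented finite regular CW complex and $e$ is a dimension-preserving bijection from the cells of $X$ to those of $Y$, then there are isomorphisms $\Phi_n\colon C_n(X)\to C_n(Y)$ with $\Phi_n(\sigma)=e(\sigma)$ for all $n$-cells $\sigma$, and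 they commute with the boundary operators if and only if $e$ preserves and reflects rank-one intervals and preserves their incidence numbers. 4. The incidence coalgebra supplies the unsigned flag structure. For $\sigma,\tau\in\mathcal F(X)$, $[\sigma,\tau]$ is a rank-one interval if and only if $\tau$ covers $\sigma$ in $\mathcal F(X)$; and for $\sigma\le\tau$ it is one if and only if $\Delta[\sigma,\tau]=[\sigma,\sigma]\otimes[\sigma,\tau]+[\sigma,\tau]\otimes[\tau,\tau]$. With $\Delta^{(0)}=\mathrm{id}$ and $\Delta^{(r)}=(\Delta^{(r-1)}\otimes\mathrm{id})\circ\Delta$, for all $r\ge0$ and $\sigma\le\tau$ $$\Delta^{(r)}[\sigma,\tau]=\sum_{\sigma=\rho_0\le\rho_1\le\dots\le\rho_{r+1}=\tau}[\rho_0,\rho_1]\otimes[\rho_1,\rho_2]\otimes\dots\otimes[\rho_r,\rho_{r+1}].$$ For each $r$ the tensors $[\rho_0,\rho_1]\otimes\dots\otimes[\rho_r,\rho_{r+1}]$ of all chains $\rho_0\le\dots\le\rho_{r+1}$ in $\mathcal F(X)$ are linearly independent, and such a chain is a flag $\rho_0<\dots<\rho_{r+1}$ if and only if $\varepsilon[\rho_i,\rho_{i+1}]=0$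 for $0\le i\le r$. -/

import Mathlib

open CategoryTheory AlgebraicTopology Topology Metric Set
open scoped TensorProduct

universe u v

noncomputable section

/-! ### Relative singular homology of pairs of subspaces, with integer coefficients -/

namespace PairHomology

variable {X : Type u} [TopologicalSpace X]

/-- The singular chain complex `S(A)` of a subspace `A`, with integer coefficients. -/
abbrev singularChains (A : Set X) : ChainComplex (ModuleCat.{u} ℤ) ℕ :=
  ((singularChainComplexFunctor (ModuleCat.{u} ℤ)).obj
    (ModuleCat.of ℤ (ULift.{u} ℤ))).obj (TopCat.of A)

/-- The inclusion of subspaces `A ⊆ B` as a continuous map. -/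
abbrev inclusionMap {A B : Set X} (h : A ⊆ B) : TopCat.of A ⟶ TopCat.of B :=
  TopCat.ofHom ⟨Set.inclusion h, continuous_inclusion h⟩

/-- The chain map `S(A) ⟶ S(B)` induced by an inclusion `A ⊆ B`. -/
abbrev singularChainsMap {A B : Set X} (h : A ⊆ B) : singularChains A ⟶ singularChains B :=
  ((singularChainComplexFunctor (ModuleCat.{u} ℤ)).obj
    (ModuleCat.of ℤ (ULift.{u} ℤ))).map (inclusionMap h)

theorem mono_inclusionMap {A B : Set X} (h : A ⊆ B) : Mono (inclusionMap h) :=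
  (TopCat.mono_iff_injective _).mpr (Set.inclusion_injective h)

theorem mono_singularChainsMap {A B : Set X} (h : A ⊆ B) : Mono (singularChainsMap h) := by
  have := mono_inclusionMap h
  infer_instance

theorem singularChainsMap_comp {A B A' B' : Set X} (hA : A ⊆ A') (hB : B ⊆ B') (h : A ⊆ B)
    (h' : A' ⊆ B') :
    singularChainsMap h ≫ singularChainsMap hB = singularChainsMap hA ≫ singularChainsMap h' := by
  rw [← Functor.map_comp, ← Functor.map_comp]
  rfl

/-- The short exact sequence of chain complexes `0 ⟶ S(A) ⟶ S(B) ⟶ S(B, A) ⟶ 0`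
of a pair `A ⊆ B`; here `S(B, A) = S(B) / S(A)`. -/
abbrev chainSequence {A B : Set X} (h : A ⊆ B) :
    ShortComplex (ChainComplex (ModuleCat.{u} ℤ) ℕ) :=
  ShortComplex.mk (singularChainsMap h) (Limits.cokernel.π (singularChainsMap h))
    (Limits.cokernel.condition _)

theorem chainSequence_shortExact {A B : Set X} (h : A ⊆ B) : (chainSequence h).ShortExact := by
  have := mono_singularChainsMap h
  exact
    { exact := ShortComplex.exact_cokernel _
      mono_f := this
      epi_g := inferInstance }

/-- Absolute singular homology `H_n(A; ℤ)`. -/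
abbrev absHomology (n : ℕ) (A : Set X) : ModuleCat.{u} ℤ :=
  (singularChains A).homology n

/-- Relative singular homology `H_n(B, A; ℤ)`, for `A ⊆ B`. -/
abbrev relHomology (n : ℕ) {A B : Set X} (h : A ⊆ B) : ModuleCat.{u} ℤ :=
  (Limits.cokernel (singularChainsMap h)).homology n

/-- The map `H_n(B, A) ⟶ H_n(B', A')` induced by inclusions `A ⊆ A'` and `B ⊆ B'`. -/
def relMap (n : ℕ) {A B A' B' : Set X} (h : A ⊆ B) (h' : A' ⊆ B') (hA : A ⊆ A') (hB : B ⊆ B') :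
    relHomology n h ⟶ relHomology n h' :=
  HomologicalComplex.homologyMap
    (Limits.cokernel.map (singularChainsMap h) (singularChainsMap h') (singularChainsMap hA)
      (singularChainsMap hB) (singularChainsMap_comp hA hB h h')) n

/-- The map `H_n(A) ⟶ H_n(B)` induced by an inclusion `A ⊆ B`. -/
def absMap (n : ℕ) {A B : Set X} (h : A ⊆ B) : absHomology n A ⟶ absHomology n B :=
  HomologicalComplex.homologyMap (singularChainsMap h) n

/-- The quotient map `H_n(B) ⟶ H_n(B, A)`. -/
def toRel (n : ℕ) {A B : Set X} (h : A ⊆ B) : absHomology n B ⟶ relHomology n h :=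
  HomologicalComplex.homologyMap (Limits.cokernel.π (singularChainsMap h)) n

/-- The connecting homomorphism `H_{n+1}(B, A) ⟶ H_n(A)` of the pair `A ⊆ B`. -/
def connecting (n : ℕ) {A B : Set X} (h : A ⊆ B) : relHomology (n + 1) h ⟶ absHomology n A :=
  (chainSequence_shortExact h).δ (n + 1) n rfl

end PairHomology

/-! ### The incidence coalgebra of a locally finite poset -/

/-- The rational vector space with basis the intervals `[a, b]`, `a ≤ b`, of a poset `P`. -/
def IncidenceCoalgebra (P : Type*) [PartialOrder P] : Type _ :=
  {p : P × P // p.1 ≤ p.2} →₀ ℚ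

namespace IncidenceCoalgebra

section Basic

variable {P : Type*} [PartialOrder P]

instance : AddCommGroup (IncidenceCoalgebra P) :=
  inferInstanceAs (AddCommGroup ({p : P × P // p.1 ≤ p.2} →₀ ℚ))

instance : Module ℚ (IncidenceCoalgebra P) :=
  inferInstanceAs (Module ℚ ({p : P × P // p.1 ≤ p.2} →₀ ℚ))

/-- The basis of intervals. -/
def basis (P : Type*) [PartialOrder P] :
    Module.Basis {p : P × P // p.1 ≤ p.2} ℚ (IncidenceCoalgebra P) :=
  Module.Basis.ofRepr (LinearEquiv.refl ℚ ({p : P × P // p.1 ≤ p.2} →₀ ℚ))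

/-- The basis element `[a, b]`. -/
def interval {a b : P} (h : a ≤ b) : IncidenceCoalgebra P := basis P ⟨(a, b), h⟩

theorem hom_ext {M : Type*} [AddCommMonoid M] [Module ℚ M] {f g : IncidenceCoalgebra P →ₗ[ℚ] M}
    (H : ∀ (a b : P) (h : a ≤ b), f (interval h) = g (interval h)) : f = g :=
  (basis P).ext fun p => H p.1.1 p.1.2 p.2

end Basic

section Coalgebra

variable {P : Type*} [PartialOrder P] [LocallyFiniteOrder P]

open Classical in
/-- `Δ[a, b] = ∑_{a ≤ c ≤ b} [a, c] ⊗ [c, b]`, and `ε[a, b]` is `1` if `a = b` and `0` if `a < b`. -/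
instance : CoalgebraStruct ℚ (IncidenceCoalgebra P) where
  comul := (basis P).constr ℚ fun p =>
    ∑ c : Set.Icc p.1.1 p.1.2, interval c.2.1 ⊗ₜ[ℚ] interval c.2.2
  counit := (basis P).constr ℚ fun p => if p.1.1 = p.1.2 then 1 else 0

theorem comul_interval {a b : P} (h : a ≤ b) :
    CoalgebraStruct.comul (R := ℚ) (interval h) =
      ∑ c : Set.Icc a b, interval c.2.1 ⊗ₜ[ℚ] interval c.2.2 :=
  (basis P).constr_basis ℚ _ _

open Classical in
theorem counit_interval {a b : P} (h : a ≤ b) :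
    CoalgebraStruct.counit (R := ℚ) (interval h) = if a = b then (1 : ℚ) else 0 :=
  (basis P).constr_basis ℚ _ _

instance : Coalgebra ℚ (IncidenceCoalgebra P) where
  coassoc := by
    refine hom_ext fun a b h => ?_
    simp only [LinearMap.comp_apply, comul_interval, map_sum, LinearMap.rTensor_tmul,
      LinearMap.lTensor_tmul, TensorProduct.sum_tmul, TensorProduct.tmul_sum,
      LinearEquiv.coe_coe, TensorProduct.assoc_tmul]
    rw [Finset.sum_sigma', Finset.sum_sigma']
    refine Finset.sum_bij'
      (fun x _ => ⟨⟨x.2.1, x.2.2.1, x.2.2.2.trans x.1.2.2⟩, ⟨x.1.1, x.2.2.2, x.1.2.2⟩⟩)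
      (fun x _ => ⟨⟨x.2.1, x.1.2.1.trans x.2.2.1, x.2.2.2⟩, ⟨x.1.1, x.1.2.1, x.2.2.1⟩⟩)
      ?_ ?_ ?_ ?_ ?_ <;> intros <;> first | rfl | simp
  rTensor_counit_comp_comul := by
    classical
    refine hom_ext fun a b h => ?_
    simp only [LinearMap.comp_apply, comul_interval, map_sum, LinearMap.rTensor_tmul,
      counit_interval, TensorProduct.mk_apply]
    rw [Finset.sum_eq_single (⟨a, le_rfl, h⟩ : Set.Icc a b)]
    · simp
    · intro c _ hc
      rw [if_neg, TensorProduct.zero_tmul]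
      intro e
      exact hc (Subtype.ext e.symm)
    · simp
  lTensor_counit_comp_comul := by
    classical
    refine hom_ext fun a b h => ?_
    simp only [LinearMap.comp_apply, comul_interval, map_sum, LinearMap.lTensor_tmul,
      counit_interval, LinearMap.flip_apply, TensorProduct.mk_apply]
    rw [Finset.sum_eq_single (⟨b, h, le_rfl⟩ : Set.Icc a b)]
    · simp
    · intro c _ hc
      rw [if_neg, TensorProduct.tmul_zero]
      intro e
      exact hc (Subtype.ext e)
    · simp

/-- The iterated coproduct `Δ^(r) = (Δ^(r-1) ⊗ id) ∘ Δ`, with `Δ^(0) = id`, from the coalgebra to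
its `(r + 1)`-st tensor power. -/
def iteratedComul : (r : ℕ) → IncidenceCoalgebra P →ₗ[ℚ] ⨂[ℚ]^(r + 1) (IncidenceCoalgebra P)
  | 0 => ((PiTensorProduct.subsingletonEquiv (R := ℚ)
      (s := fun _ : Fin 1 => IncidenceCoalgebra P) 0).symm).toLinearMap
  | r + 1 => TensorPower.mulEquiv.toLinearMap ∘ₗ
      TensorProduct.map (iteratedComul r)
        ((PiTensorProduct.subsingletonEquiv (R := ℚ)
          (s := fun _ : Fin 1 => IncidenceCoalgebra P) 0).symm).toLinearMap ∘ₗ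
      CoalgebraStruct.comul

end Coalgebra

/-- The pure tensor `[c₀, c₁] ⊗ [c₁, c₂] ⊗ ⋯ ⊗ [c_r, c_{r+1}]` of a chain
`c₀ ≤ c₁ ≤ ⋯ ≤ c_{r+1}`. -/
def chainTensor {P : Type*} [PartialOrder P] {r : ℕ} (c : Fin (r + 2) →o P) :
    ⨂[ℚ]^(r + 1) (IncidenceCoalgebra P) :=
  PiTensorProduct.tprod ℚ fun i : Fin (r + 1) => interval (c.monotone (Fin.castSucc_le_succ i))

end IncidenceCoalgebra

/-! ### Regular CW complexes, their face posets and their cellular chains -/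

namespace RegularCW

open PairHomology RelCWComplex

variable {X : Type u} [TopologicalSpace X]

/-- A CW complex is regular if every closed cell is a closed ball, its open cell and its frontier
being the interior and the boundary sphere of the ball, and if every frontier is a union of closed
cells of lower dimension. -/
class IsRegular (C : Set X) [CWComplex C] : Prop where
  exists_ball (n : ℕ) (σ : cell C n) : ∃ f : (Fin n → ℝ) → X,
    ContinuousOn f (closedBall 0 1) ∧ InjOn f (closedBall 0 1) ∧
      f '' ball 0 1 = openCell n σ ∧ f '' sphere 0 1 = cellFrontier n σ
  frontier_eq (n : ℕ) (σ : cell C n) : ∃ I : ∀ m, Set (cell C m),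
    cellFrontier n σ = ⋃ (m < n) (ρ ∈ I m), closedCell m ρ

/-- The cells of a CW complex, of all dimensions. -/
@[ext]
structure Face (C : Set X) [CWComplex C] where
  /-- the dimension of the cell -/
  dim : ℕ
  /-- the cell -/
  idx : cell C dim

/-- The closed cell, as a subspace. -/
def Face.carrier {C : Set X} [CWComplex C] (σ : Face C) : Set X := closedCell σ.dim σ.idx

theorem Face.carrier_injective {C : Set X} [CWComplex C] [T2Space X] :
    Function.Injective (Face.carrier : Face C → Set X) := by
  have key : ∀ σ τ : Face C, σ.dim ≤ τ.dim → σ.carrier = τ.carrier → σ = τ := by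
    rintro ⟨n, i⟩ ⟨m, j⟩ (hnm : n ≤ m) (h : closedCell n i = closedCell m j)
    by_contra hne
    have hmem : map m j 0 ∈ openCell m j := map_zero_mem_openCell m j
    have h1 : map m j 0 ∈ closedCell n i := h ▸ map_zero_mem_closedCell m j
    rw [← cellFrontier_union_openCell_eq_closedCell] at h1
    rcases h1 with h1 | h1
    · have h2 := CWComplex.cellFrontier_subset_finite_openCell n i
      obtain ⟨I, hI⟩ := h2
      have h3 := hI h1
      simp only [mem_iUnion] at h3
      obtain ⟨k, hk, l, _, hl⟩ := h3
      refine Set.disjoint_left.mp (CWComplex.disjoint_openCell_of_ne (i := l) (j := j) ?_) hl hmem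
      intro e
      have : k = m := congrArg Sigma.fst e
      lia
    · refine Set.disjoint_left.mp (CWComplex.disjoint_openCell_of_ne (i := i) (j := j) ?_) h1 hmem
      intro e
      apply hne
      cases e
      rfl
  intro σ τ h
  rcases le_total σ.dim τ.dim with h' | h'
  · exact key σ τ h' h
  · exact (key τ σ h' h.symm).symm

/-- The face poset: closed cells ordered by inclusion. -/
instance {C : Set X} [CWComplex C] [T2Space X] : PartialOrder (Face C) :=
  PartialOrder.lift Face.carrier Face.carrier_injective

instance {C : Set X} [CWComplex C] [CWComplex.Finite C] : Finite (Face C) := by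
  have h := (CWComplex.finite_iff_finite_cells (C := C)).mp inferInstance
  exact Finite.of_injective (fun σ : Face C => (⟨σ.dim, σ.idx⟩ : Σ n, cell C n))
    (by rintro ⟨n, i⟩ ⟨m, j⟩ h; cases h; rfl)

instance {C : Set X} [CWComplex C] [CWComplex.Finite C] [T2Space X] :
    LocallyFiniteOrder (Face C) :=
  letI := Fintype.ofFinite (Face C)
  letI := Classical.decRel (fun σ τ : Face C => σ ≤ τ)
  letI := Classical.decRel (fun σ τ : Face C => σ < τ)
  Fintype.toLocallyFiniteOrder

/-- `[σ, τ]` is a rank-one interval: `σ < τ` and `dim τ = dim σ + 1`. -/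
def IsRankOne {C : Set X} [CWComplex C] [T2Space X] (σ τ : Face C) : Prop :=
  σ < τ ∧ τ.dim = σ.dim + 1

/-- An orientation of a CW complex: for every `n`-cell `σ` a generator of the infinite cyclic group
`H_n(σ, ∂σ; ℤ)`, where `σ` is the closed cell and `∂σ` its frontier. -/
structure Orientation (C : Set X) [CWComplex C] where
  /-- the orientation class -/
  gen (n : ℕ) (σ : cell C n) : relHomology n (CWComplex.cellFrontier_subset_closedCell n σ)
  /-- it generates the group -/
  generates (n : ℕ) (σ : cell C n) : Submodule.span ℤ {gen n σ} = ⊤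

variable [T2Space X] (C : Set X) [CWComplex C]

/-- The `(n-1)`-skeleton `X^(n-1)`: the union of all cells of dimension less than `n`. -/
abbrev skel (n : ℕ) : Set X := (skeletonLT C (n : ℕ∞) : Set X)

theorem skel_subset (n : ℕ) : skel C n ⊆ skel C (n + 1) :=
  CWComplex.skeletonLT_mono (by exact_mod_cast Nat.le_succ n)

/-- The cellular chain group `C_n = H_n(X^(n), X^(n-1); ℤ)`. -/
abbrev CellularChains (n : ℕ) : ModuleCat.{u} ℤ := relHomology n (skel_subset C n)

/-- The cellular boundary operator `C_{n+1} ⟶ C_n`, the composite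
`H_{n+1}(X^(n+1), X^(n)) ⟶ H_n(X^(n)) ⟶ H_n(X^(n), X^(n-1))`. -/
def cellularBoundary (n : ℕ) : CellularChains C (n + 1) →ₗ[ℤ] CellularChains C n :=
  (connecting n (skel_subset C (n + 1)) ≫ toRel n (skel_subset C n)).hom

variable {C}

theorem closedCell_subset_skel (n : ℕ) (σ : cell C n) : closedCell n σ ⊆ skel C (n + 1) := by
  have := CWComplex.closedCell_subset_skeletonLT n σ
  exact_mod_cast this

theorem cellFrontier_subset_skel (n : ℕ) (σ : cell C n) :
    cellFrontier n σ ⊆ skel C n :=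
  CWComplex.cellFrontier_subset_skeletonLT n σ

theorem cellFrontier_subset_diff (n : ℕ) (σ : cell C n) :
    cellFrontier n σ ⊆ skel C (n + 1) \ openCell n σ := by
  intro x hx
  refine ⟨closedCell_subset_skel n σ (CWComplex.cellFrontier_subset_closedCell n σ hx), fun hx' => ?_⟩
  obtain ⟨I, hI⟩ := CWComplex.cellFrontier_subset_finite_openCell n σ
  have h3 := hI hx
  simp only [mem_iUnion] at h3
  obtain ⟨k, hk, l, _, hl⟩ := h3
  refine Set.disjoint_left.mp (CWComplex.disjoint_openCell_of_ne (i := l) (j := σ) ?_) hl hx'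
  intro e
  have : k = n := congrArg Sigma.fst e
  lia

namespace Orientation

variable (o : Orientation C)

/-- The cellular chain `σ ∈ C_n = H_n(X^(n), X^(n-1))` of an oriented `n`-cell: the image of its
orientation class. -/
def chain (n : ℕ) (σ : cell C n) : CellularChains C n :=
  (relMap n (CWComplex.cellFrontier_subset_closedCell n σ) (skel_subset C n)
    (cellFrontier_subset_skel n σ) (closedCell_subset_skel n σ)).hom (o.gen n σ)

/-- The image of the orientation class of the `n`-cell `σ` in `H_n(X^(n), X^(n) \ σ°)`, where `σ°`
is the open cell. -/
def localClass (n : ℕ) (σ : cell C n) :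
    relHomology n (sdiff_subset : skel C (n + 1) \ openCell n σ ⊆ skel C (n + 1)) :=
  (relMap n (CWComplex.cellFrontier_subset_closedCell n σ) sdiff_subset
    (cellFrontier_subset_diff n σ) (closedCell_subset_skel n σ)).hom (o.gen n σ)

/-- The image of the oriented boundary of the `(n+1)`-cell `τ` in `H_n(X^(n), X^(n) \ σ°)`, under
`H_{n+1}(τ, ∂τ) ⟶ H_n(∂τ) ⟶ H_n(X^(n)) ⟶ H_n(X^(n), X^(n) \ σ°)`. -/
def localBoundary (n : ℕ) (τ : cell C (n + 1)) (σ : cell C n) :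
    relHomology n (sdiff_subset : skel C (n + 1) \ openCell n σ ⊆ skel C (n + 1)) :=
  (connecting n (CWComplex.cellFrontier_subset_closedCell (n + 1) τ) ≫
    absMap n (cellFrontier_subset_skel (n + 1) τ) ≫ toRel n sdiff_subset).hom (o.gen (n + 1) τ)

/-- `k` is the degree with which the oriented boundary of `τ` meets the oriented cell `σ`. -/
def IsDegree (n : ℕ) (τ : cell C (n + 1)) (σ : cell C n) (k : ℤ) : Prop :=
  o.localBoundary n τ σ = k • o.localClass n σ

/-- The incidence number `[τ : σ]`: the degree with which the oriented boundary of `τ` meets `σ`. -/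
def incidence (n : ℕ) (τ : cell C (n + 1)) (σ : cell C n) : ℤ :=
  Classical.epsilon (o.IsDegree n τ σ)

end Orientation

end RegularCW

end

/-! Everything topological reduces to local homology at the centre of a cell, computed with explicit
singular chains. All degrees live in one free abelian group, with `relCycles` and `relBoundaries` as
submodules; `RelRep` is the dictionary to the homology of quotient complexes, and under it a class
vanishes exactly when its representative is a relative boundary, maps of pairs keep the
representative, and the connecting map is `sd`. Homotopy invariance comes from the prism operator
and excision (`relIso_excision`) from barycentric subdivision.

The geometric core is `relIso_ball`: if an embedded closed ball lies in `B` with interior relatively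
open, the ball modulo its sphere has the same homology as `B` modulo the complement of the centre. A
facet of the cube, placed in its boundary sphere, then gives by induction that the ball modulo its
sphere has infinite cyclic homology, in degree the dimension (`exists_isGen_closedBall`). Thus the
orientation class of an n-cell generates the local homology of X^(n) at its centre. Coefficients of
n-cells are read off there, which gives independence; attaching the n-cells one at a time
(`relIso_attach`) gives spanning. Expanding a boundary in this basis shows that incidence numbers
exist, are unique, and are its coefficients.

Now let τ cover σ. Since σ is maximal among the faces in the sphere ∂τ, its class generates the
homology of ∂τ modulo the complement of the centre of σ. The boundary of the class of τ generates
the same group, because τ modulo a punctured ∂τ is acyclic. Two generators of ℤ differ by a sign, so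
the incidence number is ±1. The same comparison forces dim τ = dim σ + 1, as otherwise a generator
would lie in the wrong degree and vanish (`isRankOne_iff_covBy`). If σ is not a face of τ, ∂τ misses
the open cell and the number is 0.

Consequently rank-one intervals are exactly the pairs with nonzero incidence number, and the
comparison of two complexes is linear algebra in the cellular bases. The coalgebra statements are
combinatorial: coefficients are compared in the tensor basis of intervals, and iterated coproducts
are expanded by splitting off the last interval of a chain. -/

noncomputable section

/-! ### Chains on a presimplicial set, in all degrees at once -/

namespace Chains

section Presimplicial

variable {T : ℕ → Type*} {T' : ℕ → Type*}

/-- The alternating sum of the faces of a simplex, as a linear map on the free abelian group on the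
simplices of all dimensions. -/
def bdry (δ : ∀ n, Fin (n + 2) → T (n + 1) → T n) :
    ((Σ n, T n) →₀ ℤ) →ₗ[ℤ] ((Σ n, T n) →₀ ℤ) :=
  Finsupp.linearCombination ℤ fun s : Σ n, T n =>
    match s with
    | ⟨0, _⟩ => 0
    | ⟨n + 1, t⟩ => ∑ i : Fin (n + 2), (-1 : ℤ) ^ (i : ℕ) • Finsupp.single ⟨n, δ n i t⟩ 1

variable {δ : ∀ n, Fin (n + 2) → T (n + 1) → T n}

theorem bdry_single_zero (t : T 0) : bdry δ (Finsupp.single ⟨0, t⟩ 1) = 0 := by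
  simp [bdry]

theorem bdry_single_succ (n : ℕ) (t : T (n + 1)) : bdry δ (Finsupp.single ⟨n + 1, t⟩ 1) =
    ∑ i : Fin (n + 2), (-1 : ℤ) ^ (i : ℕ) • Finsupp.single ⟨n, δ n i t⟩ 1 := by
  simp [bdry]

/-- The map on chains induced by a map of simplices. -/
def push (φ : ∀ n, T n → T' n) : ((Σ n, T n) →₀ ℤ) →ₗ[ℤ] ((Σ n, T' n) →₀ ℤ) :=
  Finsupp.lmapDomain ℤ ℤ fun s => ⟨s.1, φ s.1 s.2⟩

theorem push_single (φ : ∀ n, T n → T' n) (s : Σ n, T n) :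
    push φ (Finsupp.single s 1) = Finsupp.single ⟨s.1, φ s.1 s.2⟩ 1 := by
  simp [push]

theorem bdry_push {δ' : ∀ n, Fin (n + 2) → T' (n + 1) → T' n} (φ : ∀ n, T n → T' n)
    (h : ∀ n i t, φ n (δ n i t) = δ' n i (φ (n + 1) t)) (x : (Σ n, T n) →₀ ℤ) :
    bdry δ' (push φ x) = push φ (bdry δ x) := by
  induction x using Finsupp.induction_linear with
  | zero => simp
  | add x y hx hy => simp [hx, hy]
  | single s a =>
    rw [← Finsupp.smul_single_one, map_smul, map_smul, map_smul, map_smul, push_single]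
    congr 1
    obtain ⟨_ | n, t⟩ := s
    · rw [bdry_single_zero, bdry_single_zero, map_zero]
    · rw [bdry_single_succ, bdry_single_succ, map_sum]
      simp only [map_smul, push_single, h]

theorem lin_ext {M : Type*} [AddCommGroup M] {f g : ((Σ n, T n) →₀ ℤ) →ₗ[ℤ] M}
    (h : ∀ n (t : T n), f (Finsupp.single ⟨n, t⟩ 1) = g (Finsupp.single ⟨n, t⟩ 1))
    (x : (Σ n, T n) →₀ ℤ) : f x = g x :=
  LinearMap.congr_fun (Finsupp.lhom_ext' fun s => LinearMap.ext_ring (h s.1 s.2)) x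

/-- The part of a chain in degree `n`. -/
def degreePart (T : ℕ → Type*) (n : ℕ) : ((Σ n, T n) →₀ ℤ) →ₗ[ℤ] ((Σ n, T n) →₀ ℤ) :=
  Finsupp.linearCombination ℤ fun s => if s.1 = n then Finsupp.single s 1 else 0

theorem degreePart_single (n : ℕ) (s : Σ n, T n) :
    degreePart T n (Finsupp.single s 1) = if s.1 = n then Finsupp.single s 1 else 0 := by
  simp [degreePart]

theorem degreePart_single_self (n : ℕ) (t : T n) :
    degreePart T n (Finsupp.single ⟨n, t⟩ 1) = Finsupp.single ⟨n, t⟩ 1 := by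
  simp [degreePart_single]

theorem degreePart_degreePart_self (n : ℕ) (x : (Σ n, T n) →₀ ℤ) :
    degreePart T n (degreePart T n x) = degreePart T n x := by
  refine lin_ext (f := degreePart T n ∘ₗ degreePart T n) (g := degreePart T n) (fun m t => ?_) x
  rw [LinearMap.comp_apply, degreePart_single]
  split_ifs with h
  · rw [degreePart_single, if_pos h]
  · rw [map_zero]

theorem degreePart_degreePart_of_ne {n m : ℕ} (h : n ≠ m) (x : (Σ n, T n) →₀ ℤ) :
    degreePart T n (degreePart T m x) = 0 := by
  refine lin_ext (f := degreePart T n ∘ₗ degreePart T m) (g := 0) (fun k t => ?_) x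
  rw [LinearMap.comp_apply, degreePart_single]
  split_ifs with h'
  · rw [degreePart_single, if_neg (by rintro rfl; exact h h'), LinearMap.zero_apply]
  · rw [map_zero, LinearMap.zero_apply]

/-- Allows an identity between inhomogeneous chains to be truncated to the degree of interest. -/
theorem degreePart_bdry (n : ℕ) (x : (Σ n, T n) →₀ ℤ) :
    degreePart T n (bdry δ x) = bdry δ (degreePart T (n + 1) x) := by
  suffices H : ∀ k (t : T k), degreePart T n (bdry δ (Finsupp.single ⟨k, t⟩ 1)) =
      bdry δ (degreePart T (n + 1) (Finsupp.single ⟨k, t⟩ 1)) by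
    have := lin_ext (f := degreePart T n ∘ₗ bdry δ) (g := bdry δ ∘ₗ degreePart T (n + 1))
      (fun k t => by rw [LinearMap.comp_apply, LinearMap.comp_apply, H]) x
    rwa [LinearMap.comp_apply, LinearMap.comp_apply] at this
  intro k t
  rw [degreePart_single]
  obtain _ | k := k
  · rw [bdry_single_zero, map_zero, if_neg (by simp), map_zero]
  · rw [bdry_single_succ, map_sum]
    simp only [map_smul, degreePart_single, Nat.add_right_cancel_iff]
    split_ifs
    · rw [bdry_single_succ]
    · simp

theorem degreePart_push (φ : ∀ n, T n → T' n) (n : ℕ) (x : (Σ n, T n) →₀ ℤ) :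
    degreePart T' n (push φ x) = push φ (degreePart T n x) := by
  refine lin_ext (f := degreePart T' n ∘ₗ push φ) (g := push φ ∘ₗ degreePart T n)
    (fun k t => ?_) x
  simp only [LinearMap.comp_apply, degreePart_single, push_single]
  split_ifs
  · rw [push_single]
  · rw [map_zero]

/-- The chains all of whose simplices satisfy a predicate. -/
abbrev supp (A : Set (Σ n, T n)) : Submodule ℤ ((Σ n, T n) →₀ ℤ) := Finsupp.supported ℤ ℤ A

theorem single_mem_supp {A : Set (Σ n, T n)} {s : Σ n, T n} (h : s ∈ A) :
    Finsupp.single s 1 ∈ supp A := Finsupp.single_mem_supported ℤ _ h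

theorem map_mem_of_single {M : Type*} [AddCommGroup M] {A : Set (Σ n, T n)}
    {f : ((Σ n, T n) →₀ ℤ) →ₗ[ℤ] M} {N : Submodule ℤ M}
    (h : ∀ n (t : T n), ⟨n, t⟩ ∈ A → f (Finsupp.single ⟨n, t⟩ 1) ∈ N)
    {x : (Σ n, T n) →₀ ℤ} (hx : x ∈ supp A) : f x ∈ N := by
  rw [supp, Finsupp.supported_eq_span_single] at hx
  refine Submodule.span_induction (p := fun x _ => f x ∈ N) ?_ (by simp)
    (fun x y _ _ hx hy => by rw [map_add]; exact N.add_mem hx hy)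
    (fun a x _ hx => by rw [map_smul]; exact N.smul_mem a hx) hx
  rintro _ ⟨s, hs, rfl⟩
  exact h s.1 s.2 hs

end Presimplicial

/-! ### Ordered chains on a set of vertices -/

section Ordered

variable {V W V' W' : Type*}

/-- Ordered simplices with vertices in `V`. -/
abbrev OSimplex (V : Type*) (n : ℕ) : Type _ := Fin (n + 1) → V

/-- Chains of ordered simplices. -/
abbrev OChain (V : Type*) : Type _ := (Σ n, OSimplex V n) →₀ ℤ

/-- The ordered simplex as a chain. -/
abbrev osimp {n : ℕ} (v : Fin (n + 1) → V) : OChain V :=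
  Finsupp.single (⟨n, v⟩ : Σ n, OSimplex V n) 1

/-- The boundary of ordered chains. -/
abbrev od : OChain V →ₗ[ℤ] OChain V :=
  bdry (T := OSimplex V) fun _ i v => v ∘ i.succAbove

/-- The map on ordered chains induced by a map of vertices. -/
abbrev omap (f : V → W) : OChain V →ₗ[ℤ] OChain W :=
  push (T := OSimplex V) (T' := OSimplex W) fun _ v => f ∘ v

theorem omap_osimp (f : V → W) {n : ℕ} (v : Fin (n + 1) → V) :
    omap f (osimp v) = osimp (f ∘ v) := push_single _ _

theorem od_osimp {n : ℕ} (v : Fin (n + 2) → V) :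
    od (osimp v) = ∑ i : Fin (n + 2), (-1 : ℤ) ^ (i : ℕ) • osimp (v ∘ i.succAbove) :=
  bdry_single_succ _ _

theorem od_omap (f : V → W) (x : OChain V) : od (omap f x) = omap f (od x) :=
  bdry_push (T := OSimplex V) (T' := OSimplex W) (δ := fun _ i v => v ∘ i.succAbove)
    (δ' := fun _ i v => v ∘ i.succAbove) (fun _ v => f ∘ v) (fun _ _ _ => rfl) x

/-- The cone with apex `b`. -/
def cone (b : V) : OChain V →ₗ[ℤ] OChain V :=
  Finsupp.linearCombination ℤ fun s => osimp (Fin.cons b s.2 : Fin (s.1 + 2) → V)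

theorem cone_osimp (b : V) {n : ℕ} (v : Fin (n + 1) → V) :
    cone b (osimp v) = osimp (Fin.cons b v : Fin (n + 2) → V) := by
  simp [cone]

theorem omap_cone (f : V → W) (b : V) (x : OChain V) :
    omap f (cone b x) = cone (f b) (omap f x) := by
  refine lin_ext (T := OSimplex V) (f := omap f ∘ₗ cone b) (g := cone (f b) ∘ₗ omap f)
    (fun n v => ?_) x
  simp only [LinearMap.comp_apply, cone_osimp, omap_osimp]
  congr 2
  exact Fin.comp_cons f b v

/-- The augmentation. -/
def aug (V : Type*) : OChain V →ₗ[ℤ] ℤ :=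
  Finsupp.linearCombination ℤ fun s => if s.1 = 0 then 1 else 0

theorem aug_osimp {n : ℕ} (v : Fin (n + 1) → V) : aug V (osimp v) = if n = 0 then 1 else 0 := by
  simp [aug]

theorem aug_cone (b : V) (x : OChain V) : aug V (cone b x) = 0 := by
  refine lin_ext (T := OSimplex V) (f := aug V ∘ₗ cone b) (g := 0) (fun n v => ?_) x
  simp [cone_osimp, aug_osimp]

theorem aug_omap (f : V → W) (x : OChain V) : aug W (omap f x) = aug V x := by
  refine lin_ext (T := OSimplex V) (f := aug W ∘ₗ omap f) (g := aug V) (fun n v => ?_) x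
  rw [LinearMap.comp_apply, omap_osimp, aug_osimp, aug_osimp]

theorem aug_od (x : OChain V) : aug V (od x) = 0 := by
  refine lin_ext (T := OSimplex V) (f := aug V ∘ₗ od) (g := 0) (fun n v => ?_) x
  obtain _ | n := n
  · rw [LinearMap.comp_apply, bdry_single_zero, map_zero, LinearMap.zero_apply]
  · rw [LinearMap.comp_apply, od_osimp, map_sum]
    simp only [map_smul, aug_osimp]
    obtain _ | n := n
    · simp [Fin.sum_univ_two]
    · simp

/-- Omitting the apex returns `x`, and the other faces are cones over the faces of `x`. The
augmentation term arises because the cone on a vertex has the apex itself as its second face. -/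
theorem od_cone (b : V) (x : OChain V) :
    od (cone b x) = x - cone b (od x) - aug V x • osimp (fun _ : Fin 1 => b) := by
  refine lin_ext (T := OSimplex V) (f := od ∘ₗ cone b) (g := LinearMap.id - cone b ∘ₗ od -
    (aug V).smulRight (osimp (fun _ : Fin 1 => b))) (fun n v => ?_) x
  simp only [LinearMap.comp_apply, LinearMap.sub_apply, LinearMap.smulRight_apply,
    LinearMap.id_apply, cone_osimp, aug_osimp]
  rw [od_osimp, Fin.sum_univ_succ]
  have h0 : (Fin.cons b v : Fin (n + 2) → V) ∘ (0 : Fin (n + 2)).succAbove = v := by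
    ext j; simp
  rw [h0]
  obtain _ | n := n
  · have h1 : (Fin.cons b v : Fin 2 → V) ∘ (Fin.succ 0 : Fin 2).succAbove = fun _ => b := by
      ext j; fin_cases j; simp
    rw [bdry_single_zero, map_zero, sub_zero, Fin.sum_univ_one, h1, if_pos rfl, one_smul,
      Fin.val_zero, pow_zero, one_smul, Fin.val_succ, Fin.val_zero, zero_add, pow_one, neg_one_smul,
      sub_eq_add_neg]
  · have h1 (i : Fin (n + 2)) : (Fin.cons b v : Fin (n + 3) → V) ∘ i.succ.succAbove =
        Fin.cons b (v ∘ i.succAbove) := by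
      ext j; refine Fin.cases ?_ (fun j => ?_) j <;> simp
    rw [od_osimp, map_sum, if_neg (by simp), zero_smul, sub_zero, Fin.val_zero, pow_zero, one_smul,
      sub_eq_add_neg, ← Finset.sum_neg_distrib]
    simp only [h1, map_smul, cone_osimp, Fin.val_succ, pow_succ, mul_neg, mul_one, neg_smul]

/-- A simplex is the cone from its first vertex over the remaining ones, so the cone formula gives
the result by induction on the dimension, without cancelling signs. -/
theorem od_od (x : OChain V) : od (od x) = 0 := by
  suffices H : ∀ n (v : Fin (n + 1) → V), od (od (osimp v)) = 0 from
    lin_ext (T := OSimplex V) (f := od ∘ₗ od) (g := 0) H x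
  intro n
  induction n with
  | zero => intro v; rw [bdry_single_zero, map_zero]
  | succ n ih =>
    intro v
    have hv : osimp v = cone (v 0) (osimp (Fin.tail v)) := by rw [cone_osimp, Fin.cons_self_tail]
    rw [hv, od_cone, map_sub, map_sub, od_cone, ih, map_zero, sub_zero, map_smul,
      bdry_single_zero, smul_zero, sub_zero, aug_od, zero_smul, sub_zero, sub_self]

/-- The generator part of the chain homotopy built inductively by coning: see `homotopyOp`. -/
def homotopyGen (κ : ∀ n, (Fin (n + 1) → V) → W) (D : OChain V →ₗ[ℤ] OChain W) :
    ∀ n, (Fin (n + 1) → V) → OChain W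
  | 0, v => cone (κ 0 v) (D (osimp v))
  | n + 1, v => cone (κ (n + 1) v) (D (osimp v) -
      ∑ i : Fin (n + 2), (-1 : ℤ) ^ (i : ℕ) • homotopyGen κ D n (v ∘ i.succAbove))

/-- The chain homotopy from a chain map `D` of augmentation zero to `0`, built inductively as
`H v = cone (D v - H (∂ v))`. -/
def homotopyOp (κ : ∀ n, (Fin (n + 1) → V) → W) (D : OChain V →ₗ[ℤ] OChain W) :
    OChain V →ₗ[ℤ] OChain W :=
  Finsupp.linearCombination ℤ fun s => homotopyGen κ D s.1 s.2

theorem homotopyOp_osimp (κ : ∀ n, (Fin (n + 1) → V) → W) (D : OChain V →ₗ[ℤ] OChain W)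
    {n : ℕ} (v : Fin (n + 1) → V) : homotopyOp κ D (osimp v) =
      cone (κ n v) (D (osimp v) - homotopyOp κ D (od (osimp v))) := by
  obtain _ | n := n
  · rw [bdry_single_zero, map_zero, sub_zero]
    simp [homotopyOp, homotopyGen]
  · rw [od_osimp, map_sum]
    simp [homotopyOp, homotopyGen]

theorem aug_homotopyOp (κ : ∀ n, (Fin (n + 1) → V) → W) (D : OChain V →ₗ[ℤ] OChain W)
    (x : OChain V) : aug W (homotopyOp κ D x) = 0 := by
  refine lin_ext (T := OSimplex V) (f := aug W ∘ₗ homotopyOp κ D) (g := 0) (fun n v => ?_) x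
  rw [LinearMap.comp_apply, homotopyOp_osimp, aug_cone, LinearMap.zero_apply]

/-- Acyclic models in explicit form: by induction `D v - H (∂ v)` is a cycle of augmentation zero,
so its cone is a primitive of it. -/
theorem od_homotopyOp (κ : ∀ n, (Fin (n + 1) → V) → W) {D : OChain V →ₗ[ℤ] OChain W}
    (hD : ∀ x, od (D x) = D (od x)) (haug : ∀ x, aug W (D x) = 0) (x : OChain V) :
    od (homotopyOp κ D x) = D x - homotopyOp κ D (od x) := by
  suffices H : ∀ n (v : Fin (n + 1) → V), od (homotopyOp κ D (osimp v)) =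
      D (osimp v) - homotopyOp κ D (od (osimp v)) from
    lin_ext (T := OSimplex V) (f := od ∘ₗ homotopyOp κ D) (g := D - homotopyOp κ D ∘ₗ od) H x
  intro n
  induction n with
  | zero =>
    intro v
    rw [homotopyOp_osimp, bdry_single_zero, map_zero, sub_zero, od_cone, haug, hD,
      bdry_single_zero, map_zero, map_zero, zero_smul, sub_zero, sub_zero]
  | succ n ih =>
    intro v
    -- The induction hypothesis applies to each face; `∂∂ = 0` removes the last term, so `D v - H (∂
    -- v)` is a cycle.
    have h : od (homotopyOp κ D (od (osimp v))) = D (od (osimp v)) := by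
      have : od (homotopyOp κ D (od (osimp v))) = D (od (osimp v)) -
          homotopyOp κ D (od (od (osimp v))) := by
        rw [od_osimp]
        simp only [map_sum, map_smul, ih, smul_sub, Finset.sum_sub_distrib]
      rw [this, od_od, map_zero, sub_zero]
    rw [homotopyOp_osimp, od_cone, map_sub od, h, hD, sub_self, map_zero, sub_zero, map_sub (aug W),
      haug, aug_homotopyOp, sub_zero, zero_smul, sub_zero]

/-- The recursion involves only `D` and the apexes, so naturality of these two passes to the
homotopy. It is what makes the operator descend to singular chains. -/
theorem omap_homotopyOp {κ : ∀ n, (Fin (n + 1) → V) → W} {D : OChain V →ₗ[ℤ] OChain W}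
    {κ' : ∀ n, (Fin (n + 1) → V') → W'} {D' : OChain V' →ₗ[ℤ] OChain W'} {f : V → V'} {g : W → W'}
    (hκ : ∀ n v, g (κ n v) = κ' n (f ∘ v)) (hD : ∀ x, omap g (D x) = D' (omap f x))
    (x : OChain V) : omap g (homotopyOp κ D x) = homotopyOp κ' D' (omap f x) := by
  suffices H : ∀ n (v : Fin (n + 1) → V), omap g (homotopyOp κ D (osimp v)) =
      homotopyOp κ' D' (omap f (osimp v)) from
    lin_ext (T := OSimplex V) (f := omap g ∘ₗ homotopyOp κ D) (g := homotopyOp κ' D' ∘ₗ omap f) H x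
  intro n
  induction n with
  | zero =>
    intro v
    rw [omap_osimp, homotopyOp_osimp, homotopyOp_osimp, bdry_single_zero, bdry_single_zero,
      map_zero, map_zero, sub_zero, sub_zero, omap_cone, hκ, hD, omap_osimp]
  | succ n ih =>
    intro v
    have h : omap g (homotopyOp κ D (od (osimp v))) = homotopyOp κ' D' (od (osimp (f ∘ v))) := by
      rw [od_osimp, od_osimp]
      simp only [map_sum, map_smul, ih, omap_osimp]
      rfl
    rw [omap_osimp, homotopyOp_osimp, homotopyOp_osimp, omap_cone, hκ, map_sub (omap g), h, hD,
      omap_osimp]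

/-- The generator part of the subdivision operator: see `subdiv`. -/
def subdivGen (β : ∀ n, (Fin (n + 1) → V) → V) : ∀ n, (Fin (n + 1) → V) → OChain V
  | 0, v => osimp v
  | n + 1, v => cone (β (n + 1) v)
      (∑ i : Fin (n + 2), (-1 : ℤ) ^ (i : ℕ) • subdivGen β n (v ∘ i.succAbove))

/-- The subdivision operator, for a choice of the barycentres. -/
def subdiv (β : ∀ n, (Fin (n + 1) → V) → V) : OChain V →ₗ[ℤ] OChain V :=
  Finsupp.linearCombination ℤ fun s => subdivGen β s.1 s.2

theorem subdiv_osimp_zero (β : ∀ n, (Fin (n + 1) → V) → V) (v : Fin 1 → V) :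
    subdiv β (osimp v) = osimp v := by
  simp [subdiv, subdivGen]

theorem subdiv_osimp_succ (β : ∀ n, (Fin (n + 1) → V) → V) {n : ℕ} (v : Fin (n + 2) → V) :
    subdiv β (osimp v) = cone (β (n + 1) v) (subdiv β (od (osimp v))) := by
  rw [od_osimp, map_sum]
  simp [subdiv, subdivGen]

theorem aug_subdiv (β : ∀ n, (Fin (n + 1) → V) → V) (x : OChain V) :
    aug V (subdiv β x) = aug V x := by
  refine lin_ext (T := OSimplex V) (f := aug V ∘ₗ subdiv β) (g := aug V) (fun n v => ?_) x
  obtain _ | n := n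
  · rw [LinearMap.comp_apply, subdiv_osimp_zero]
  · rw [LinearMap.comp_apply, subdiv_osimp_succ, aug_cone, aug_osimp, if_neg (by simp)]

/-- The subdivided boundary is inductively a cycle of augmentation zero, hence is the boundary of
its cone from the barycentre. -/
theorem od_subdiv (β : ∀ n, (Fin (n + 1) → V) → V) (x : OChain V) :
    od (subdiv β x) = subdiv β (od x) := by
  suffices H : ∀ n (v : Fin (n + 1) → V), od (subdiv β (osimp v)) = subdiv β (od (osimp v)) from
    lin_ext (T := OSimplex V) (f := od ∘ₗ subdiv β) (g := subdiv β ∘ₗ od) H x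
  intro n
  induction n with
  | zero => intro v; rw [subdiv_osimp_zero, bdry_single_zero, map_zero]
  | succ n ih =>
    intro v
    have h : od (subdiv β (od (osimp v))) = 0 := by
      have : od (subdiv β (od (osimp v))) = subdiv β (od (od (osimp v))) := by
        rw [od_osimp]
        simp only [map_sum, map_smul, ih]
      rw [this, od_od, map_zero]
    rw [subdiv_osimp_succ, od_cone, h, aug_subdiv, aug_od, map_zero, zero_smul, sub_zero, sub_zero]

theorem omap_subdiv {β : ∀ n, (Fin (n + 1) → V) → V} {β' : ∀ n, (Fin (n + 1) → W) → W} {f : V → W}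
    (hβ : ∀ n v, f (β n v) = β' n (f ∘ v)) (x : OChain V) :
    omap f (subdiv β x) = subdiv β' (omap f x) := by
  suffices H : ∀ n (v : Fin (n + 1) → V), omap f (subdiv β (osimp v)) =
      subdiv β' (omap f (osimp v)) from
    lin_ext (T := OSimplex V) (f := omap f ∘ₗ subdiv β) (g := subdiv β' ∘ₗ omap f) H x
  intro n
  induction n with
  | zero => intro v; rw [omap_osimp, subdiv_osimp_zero, subdiv_osimp_zero, omap_osimp]
  | succ n ih =>
    intro v
    have h : omap f (subdiv β (od (osimp v))) = subdiv β' (od (osimp (f ∘ v))) := by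
      rw [od_osimp, od_osimp]
      simp only [map_sum, map_smul, ih, omap_osimp]
      rfl
    rw [omap_osimp, subdiv_osimp_succ, subdiv_osimp_succ, omap_cone, hβ, h]

end Ordered

end Chains

end

noncomputable section

/-! ### Singular chains of a space, in all degrees at once -/

namespace Chains

/-- The standard topological simplex. -/
abbrev Simplex (n : ℕ) : Type := stdSimplex ℝ (Fin (n + 1))

section Singular

variable {X Y Z : Type*} [TopologicalSpace X] [TopologicalSpace Y] [TopologicalSpace Z]

/-- Singular simplices. -/
abbrev SSimplex (X : Type*) [TopologicalSpace X] (n : ℕ) : Type _ := C(Simplex n, X)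

/-- The map of topological simplices induced by a map of vertices. -/
abbrev simplexMap {n m : ℕ} (f : Fin (n + 1) → Fin (m + 1)) : C(Simplex n, Simplex m) :=
  ⟨stdSimplex.map f, stdSimplex.continuous_map f⟩

/-- Singular chains. -/
abbrev SChain (X : Type*) [TopologicalSpace X] : Type _ := (Σ n, SSimplex X n) →₀ ℤ

/-- The singular simplex as a chain. -/
abbrev ssimp {n : ℕ} (σ : C(Simplex n, X)) : SChain X :=
  Finsupp.single (⟨n, σ⟩ : Σ n, SSimplex X n) 1

/-- The boundary of singular chains. -/
abbrev sd : SChain X →ₗ[ℤ] SChain X :=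
  bdry (T := SSimplex X) fun _ i σ => σ.comp (simplexMap i.succAbove)

/-- The map on singular chains induced by a continuous map. -/
abbrev smap (f : C(X, Y)) : SChain X →ₗ[ℤ] SChain Y :=
  push (T := SSimplex X) (T' := SSimplex Y) fun _ σ => f.comp σ

theorem smap_ssimp (f : C(X, Y)) {n : ℕ} (σ : C(Simplex n, X)) :
    smap f (ssimp σ) = ssimp (f.comp σ) := push_single _ _

theorem sd_ssimp {n : ℕ} (σ : C(Simplex (n + 1), X)) : sd (ssimp σ) =
    ∑ i : Fin (n + 2), (-1 : ℤ) ^ (i : ℕ) • ssimp (σ.comp (simplexMap i.succAbove)) :=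
  bdry_single_succ _ _

theorem sd_smap (f : C(X, Y)) (x : SChain X) : sd (smap f x) = smap f (sd x) :=
  bdry_push (T := SSimplex X) (T' := SSimplex Y)
    (δ := fun _ i σ => σ.comp (simplexMap i.succAbove))
    (δ' := fun _ i σ => σ.comp (simplexMap i.succAbove)) (fun _ σ => f.comp σ)
    (fun _ _ _ => rfl) x

theorem schain_ext {M : Type*} [AddCommGroup M] {f g : SChain X →ₗ[ℤ] M}
    (h : ∀ n (σ : C(Simplex n, X)), f (ssimp σ) = g (ssimp σ)) : f = g :=
  LinearMap.ext (lin_ext h)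

theorem smap_smap (g : C(Y, Z)) (f : C(X, Y)) (x : SChain X) :
    smap g (smap f x) = smap (g.comp f) x := by
  have : smap g ∘ₗ smap f = smap (g.comp f) := schain_ext fun n σ => by
    rw [LinearMap.comp_apply, smap_ssimp, smap_ssimp, smap_ssimp, ContinuousMap.comp_assoc]
  rw [← this, LinearMap.comp_apply]

theorem smap_injective {f : C(X, Y)} (hf : Function.Injective f) :
    Function.Injective (smap f) := by
  refine Finsupp.mapDomain_injective ?_
  rintro ⟨n, σ⟩ ⟨m, τ⟩ h
  obtain rfl : n = m := congrArg Sigma.fst h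
  have h2 := eq_of_heq (Sigma.mk.inj h).2
  congr 1
  ext1 t
  exact hf (DFunLike.congr_fun h2 t)

/-- The singular chains in a subset. -/
abbrev chainsIn (A : Set X) : Submodule ℤ (SChain X) :=
  supp (T := SSimplex X) {s | ∀ t, s.2 t ∈ A}

theorem chainsIn_mono {A B : Set X} (h : A ⊆ B) : chainsIn A ≤ chainsIn B :=
  Finsupp.supported_mono fun _ hs t => h (hs t)

theorem ssimp_mem {A : Set X} {n : ℕ} {σ : C(Simplex n, X)} (h : ∀ t, σ t ∈ A) :
    ssimp σ ∈ chainsIn A := single_mem_supp (T := SSimplex X) h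

theorem mem_of_ssimp {M : Type*} [AddCommGroup M] {A : Set X} {f : SChain X →ₗ[ℤ] M}
    {N : Submodule ℤ M} (h : ∀ n (σ : C(Simplex n, X)), (∀ t, σ t ∈ A) → f (ssimp σ) ∈ N)
    {x : SChain X} (hx : x ∈ chainsIn A) : f x ∈ N :=
  map_mem_of_single (T := SSimplex X) (A := {s | ∀ t, s.2 t ∈ A}) (f := f) (N := N) h hx

theorem sd_mem {A : Set X} {x : SChain X} (hx : x ∈ chainsIn A) : sd x ∈ chainsIn A := by
  refine mem_of_ssimp (fun n σ h => ?_) hx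
  obtain _ | n := n
  · rw [bdry_single_zero]; exact zero_mem _
  · rw [sd_ssimp]
    exact Submodule.sum_mem _ fun i _ => Submodule.smul_mem _ _ (ssimp_mem fun t => h _)

theorem smap_mem {A : Set X} {B : Set Y} {f : C(X, Y)} (hf : MapsTo f A B) {x : SChain X}
    (hx : x ∈ chainsIn A) : smap f x ∈ chainsIn B :=
  mem_of_ssimp (fun n σ h => by rw [smap_ssimp]; exact ssimp_mem fun t => hf (h t)) hx

theorem mem_chainsIn_univ (x : SChain X) : x ∈ chainsIn (univ : Set X) := by
  rw [Finsupp.mem_supported]; exact fun _ _ _ => mem_univ _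

theorem chainsIn_inter {A B : Set X} {x : SChain X} (hA : x ∈ chainsIn A) (hB : x ∈ chainsIn B) :
    x ∈ chainsIn (A ∩ B) := by
  rw [Finsupp.mem_supported] at *
  exact fun s hs t => ⟨hA hs t, hB hs t⟩

theorem eq_zero_of_mem_chainsIn_empty {x : SChain X} (h : x ∈ chainsIn (∅ : Set X)) : x = 0 := by
  rw [Finsupp.mem_supported] at h
  ext s
  by_contra hs
  exact h (Finset.mem_coe.mpr (Finsupp.mem_support_iff.mpr hs)) (Classical.arbitrary _)

/-- The part of a singular chain in degree `n`. -/
abbrev sdeg (n : ℕ) : SChain X →ₗ[ℤ] SChain X := degreePart (SSimplex X) n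

theorem sdeg_mem {A : Set X} (n : ℕ) {x : SChain X} (hx : x ∈ chainsIn A) :
    sdeg n x ∈ chainsIn A :=
  mem_of_ssimp (fun m σ h => by
    rw [degreePart_single]
    split_ifs
    · exact ssimp_mem h
    · exact zero_mem _) hx

theorem sdeg_sd (n : ℕ) (x : SChain X) : sdeg n (sd x) = sd (sdeg (n + 1) x) :=
  degreePart_bdry n x

/-! ### Affine singular simplices -/

/-- The affine map of simplices with prescribed vertices. -/
def aff {n m : ℕ} (w : Fin (n + 1) → Simplex m) : C(Simplex n, Simplex m) where
  toFun t := ⟨∑ j, t j • (w j : Fin (m + 1) → ℝ),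
    (convex_stdSimplex ℝ _).sum_mem (fun j _ => t.2.1 j) t.2.2 fun j _ => (w j).2⟩
  continuous_toFun := by
    refine Continuous.subtype_mk (continuous_finsetSum _ fun j _ => ?_) _
    exact ((continuous_apply j).comp continuous_subtype_val).smul continuous_const

theorem aff_coe {n m : ℕ} (w : Fin (n + 1) → Simplex m) (t : Simplex n) :
    (aff w t : Fin (m + 1) → ℝ) = ∑ j, t j • (w j : Fin (m + 1) → ℝ) := rfl

theorem sum_simplexMap_smul {n k : ℕ} {E : Type*} [AddCommGroup E] [Module ℝ E]
    (f : Fin (n + 1) → Fin (k + 1)) (t : Simplex n) (w : Fin (k + 1) → E) :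
    ∑ j, (simplexMap f t) j • w j = ∑ j, t j • w (f j) := by
  have h (j : Fin (k + 1)) : (simplexMap f t) j = ∑ i with f i = j, t i :=
    FunOnFinite.linearMap_apply_apply ℝ ℝ f t j
  simp only [h, Finset.sum_smul]
  rw [← Finset.sum_fiberwise Finset.univ f fun j => t j • w (f j)]
  refine Finset.sum_congr rfl fun j _ => Finset.sum_congr rfl fun i hi => ?_
  rw [(Finset.mem_filter.mp hi).2]

theorem aff_simplexMap {n k m : ℕ} (w : Fin (k + 1) → Simplex m) (f : Fin (n + 1) → Fin (k + 1)) :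
    (aff w).comp (simplexMap f) = aff (w ∘ f) := by
  ext t i
  exact congrFun (sum_simplexMap_smul f t fun j => (w j : Fin (m + 1) → ℝ)) i

theorem simplexMap_aff {n k m : ℕ} (w : Fin (n + 1) → Simplex k) (f : Fin (k + 1) → Fin (m + 1)) :
    (simplexMap f).comp (aff w) = aff (simplexMap f ∘ w) := by
  ext t i
  change FunOnFinite.linearMap ℝ ℝ f (∑ j, t j • (w j : Fin (k + 1) → ℝ)) i =
    (∑ j, t j • FunOnFinite.linearMap ℝ ℝ f (w j)) i
  rw [map_sum]
  simp only [map_smul]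

/-- The vertices of the standard simplex. -/
def vtx (m : ℕ) : Fin (m + 1) → Simplex m := fun i => stdSimplex.vertex i

theorem aff_vtx (m : ℕ) : aff (vtx m) = ContinuousMap.id _ := by
  ext t i
  rw [aff_coe]
  simp [vtx, Finset.sum_apply, Pi.single_apply]

theorem simplexMap_vtx {n m : ℕ} (f : Fin (n + 1) → Fin (m + 1)) :
    simplexMap f ∘ vtx n = vtx m ∘ f := by
  ext1 i
  exact stdSimplex.map_vertex f i

/-- The affine singular simplex of a product of two simplices with prescribed vertices. -/
def affProd {n m k : ℕ} (w : Fin (n + 1) → Simplex m × Simplex k) :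
    C(Simplex n, Simplex m × Simplex k) :=
  (aff (Prod.fst ∘ w)).prodMk (aff (Prod.snd ∘ w))

/-- The chain map from ordered chains to affine singular chains. -/
abbrev affChain (m k : ℕ) : OChain (Simplex m × Simplex k) →ₗ[ℤ] SChain (Simplex m × Simplex k) :=
  push (T := OSimplex (Simplex m × Simplex k)) (T' := SSimplex (Simplex m × Simplex k))
    fun _ w => affProd w

theorem affChain_osimp {n m k : ℕ} (w : Fin (n + 1) → Simplex m × Simplex k) :
    affChain m k (osimp w) = ssimp (affProd w) := push_single _ _

theorem sd_affChain {m k : ℕ} (x : OChain (Simplex m × Simplex k)) :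
    sd (affChain m k x) = affChain m k (od x) :=
  bdry_push (T := OSimplex (Simplex m × Simplex k)) (T' := SSimplex (Simplex m × Simplex k))
    (δ := fun _ i v => v ∘ i.succAbove)
    (δ' := fun _ i σ => σ.comp (simplexMap i.succAbove)) (fun _ w => affProd w)
    (fun _ i w => by
      change affProd (w ∘ i.succAbove) = (affProd w).comp (simplexMap i.succAbove)
      ext1 t
      exact Prod.ext (DFunLike.congr_fun (aff_simplexMap (Prod.fst ∘ w) i.succAbove).symm t)
        (DFunLike.congr_fun (aff_simplexMap (Prod.snd ∘ w) i.succAbove).symm t)) x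

theorem smap_affChain {m m' k : ℕ} (f : Fin (m + 1) → Fin (m' + 1))
    (x : OChain (Simplex m × Simplex k)) :
    smap ((simplexMap f).prodMap (ContinuousMap.id _)) (affChain m k x) =
      affChain m' k (omap (Prod.map (simplexMap f) id) x) := by
  refine lin_ext (T := OSimplex (Simplex m × Simplex k))
    (f := smap ((simplexMap f).prodMap (ContinuousMap.id _)) ∘ₗ affChain m k)
    (g := affChain m' k ∘ₗ omap (Prod.map (simplexMap f) id)) (fun n w => ?_) x
  rw [LinearMap.comp_apply, LinearMap.comp_apply, affChain_osimp, omap_osimp, affChain_osimp,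
    smap_ssimp]
  congr 2
  ext1 t
  exact Prod.ext (DFunLike.congr_fun (simplexMap_aff (Prod.fst ∘ w) f) t) rfl

/-! ### Natural operators on singular chains -/

/-- The operator on singular chains given by an operator on ordered chains in the simplices. -/
def natOp (Q : ∀ m, OChain (Simplex m) →ₗ[ℤ] OChain (Simplex m × Simplex 1))
    (h : C(X × Simplex 1, Y)) : SChain X →ₗ[ℤ] SChain Y :=
  Finsupp.linearCombination ℤ fun s =>
    smap (h.comp (s.2.prodMap (ContinuousMap.id _))) (affChain s.1 1 (Q s.1 (osimp (vtx s.1))))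

theorem natOp_ssimp (Q : ∀ m, OChain (Simplex m) →ₗ[ℤ] OChain (Simplex m × Simplex 1))
    (h : C(X × Simplex 1, Y)) {n : ℕ} (σ : C(Simplex n, X)) : natOp Q h (ssimp σ) =
      smap (h.comp (σ.prodMap (ContinuousMap.id _))) (affChain n 1 (Q n (osimp (vtx n)))) := by
  simp [natOp]

/-- Naturality of an operator on ordered chains for the maps of simplices. -/
def IsNatural (Q : ∀ m, OChain (Simplex m) →ₗ[ℤ] OChain (Simplex m × Simplex 1)) : Prop :=
  ∀ (n m : ℕ) (f : Fin (n + 1) → Fin (m + 1)) (x : OChain (Simplex n)),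
    omap (Prod.map (simplexMap f) id) (Q n x) = Q m (omap (simplexMap f) x)

variable {Q : ∀ m, OChain (Simplex m) →ₗ[ℤ] OChain (Simplex m × Simplex 1)}

theorem smap_natOp_simplexMap (hQ : IsNatural Q) (h : C(X × Simplex 1, Y)) {n m : ℕ}
    (σ : C(Simplex m, X)) (f : Fin (n + 1) → Fin (m + 1)) :
    natOp Q h (ssimp (σ.comp (simplexMap f))) =
      smap (h.comp (σ.prodMap (ContinuousMap.id _))) (affChain m 1 (Q m (osimp (vtx m ∘ f)))) := by
  rw [natOp_ssimp, ← simplexMap_vtx, ← omap_osimp, ← hQ, ← smap_affChain, smap_smap]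
  rfl

/-- Naturality along face inclusions replaces the operator on each face of `σ` by the operator on an
ordered simplex of the standard simplex. Boundary identities for singular chains are thereby reduced
to one identity for the tuple of vertices. -/
theorem natOp_sd (hQ : IsNatural Q) (h : C(X × Simplex 1, Y)) {n : ℕ} (σ : C(Simplex n, X)) :
    natOp Q h (sd (ssimp σ)) =
      smap (h.comp (σ.prodMap (ContinuousMap.id _))) (affChain n 1 (Q n (od (osimp (vtx n))))) := by
  obtain _ | n := n
  · rw [bdry_single_zero, bdry_single_zero]; simp only [map_zero]
  · rw [sd_ssimp, od_osimp]
    simp only [map_sum, map_smul, smap_natOp_simplexMap hQ]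

theorem sd_natOp (h : C(X × Simplex 1, Y)) {n : ℕ} (σ : C(Simplex n, X)) :
    sd (natOp Q h (ssimp σ)) =
      smap (h.comp (σ.prodMap (ContinuousMap.id _))) (affChain n 1 (od (Q n (osimp (vtx n))))) := by
  rw [natOp_ssimp, sd_smap, sd_affChain]

theorem natOp_mem {A : Set X} {B : Set Y} {h : C(X × Simplex 1, Y)}
    (hAB : ∀ x ∈ A, ∀ t, h (x, t) ∈ B) {x : SChain X} (hx : x ∈ chainsIn A) :
    natOp Q h x ∈ chainsIn B := by
  refine mem_of_ssimp (fun n σ hσ => ?_) hx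
  rw [natOp_ssimp]
  exact smap_mem (fun y _ => hAB _ (hσ _) _) (mem_chainsIn_univ _)

/-- The inclusion as the bottom of a prism, followed by projection, is a natural operator inducing
the identity on singular chains, so `∂∂ = 0` is inherited from ordered chains. -/
theorem sd_sd (x : SChain X) : sd (sd x) = 0 := by
  suffices H : sd ∘ₗ sd = (0 : SChain X →ₗ[ℤ] SChain X) from LinearMap.congr_fun H x
  refine schain_ext fun n σ => ?_
  let Q : ∀ m, OChain (Simplex m) →ₗ[ℤ] OChain (Simplex m × Simplex 1) :=
    fun m => omap fun v => (v, vtx 1 0)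
  have hQ : IsNatural Q := fun n m f x => by
    simp only [Q]
    refine lin_ext (T := OSimplex (Simplex n)) (f := omap (Prod.map (simplexMap f) id) ∘ₗ
      omap fun v => (v, vtx 1 0)) (g := (omap fun v => (v, vtx 1 0)) ∘ₗ omap (simplexMap f))
      (fun k v => ?_) x
    simp only [LinearMap.comp_apply, omap_osimp]
    rfl
  have hid : ∀ {n : ℕ} (σ : C(Simplex n, X)), natOp Q ContinuousMap.fst (ssimp σ) = ssimp σ := by
    intro n σ
    rw [natOp_ssimp]
    simp only [Q, omap_osimp, affChain_osimp, smap_ssimp]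
    congr 2
    ext1 t
    exact congrArg σ (DFunLike.congr_fun (aff_vtx n) t)
  have hid' : natOp Q ContinuousMap.fst = (LinearMap.id : SChain X →ₗ[ℤ] SChain X) :=
    schain_ext fun n σ => hid σ
  have key := natOp_sd hQ (ContinuousMap.fst : C(X × Simplex 1, X)) σ
  rw [hid', LinearMap.id_apply] at key
  rw [LinearMap.comp_apply, key, sd_smap, sd_affChain]
  simp only [Q]
  rw [od_omap, od_od]
  simp only [map_zero, LinearMap.zero_apply]

end Singular

end Chains

end

noncomputable section

namespace Chains

/-! ### Barycentric subdivision and the prism operator on singular chains -/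

section Subdivision

variable {X Y : Type*} [TopologicalSpace X] [TopologicalSpace Y]

theorem aff_aff {n m k : ℕ} (w : Fin (m + 1) → Simplex k) (u : Fin (n + 1) → Simplex m) :
    (aff w).comp (aff u) = aff (aff w ∘ u) := by
  ext t i
  change (∑ j, (∑ l, t l • (u l : Fin (m + 1) → ℝ)) j • (w j : Fin (k + 1) → ℝ)) i =
    (∑ l, t l • ∑ j, (u l) j • (w j : Fin (k + 1) → ℝ)) i
  simp only [Finset.sum_apply, Pi.smul_apply, Finset.sum_smul, Finset.smul_sum, smul_assoc]
  exact Finset.sum_comm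

theorem aff_comp_vtx {m k : ℕ} (w : Fin (m + 1) → Simplex k) : aff w ∘ vtx m = w := by
  ext j i
  change (∑ l, (vtx m j) l • (w l : Fin (k + 1) → ℝ)) i = w j i
  simp [vtx, Pi.single_apply, Finset.sum_apply, ite_apply]

/-- The barycentre of an affine simplex. -/
def bary {m : ℕ} (n : ℕ) (w : Fin (n + 1) → Simplex m) : Simplex m :=
  aff w stdSimplex.barycenter

theorem aff_bary {m k n : ℕ} (w : Fin (m + 1) → Simplex k) (u : Fin (n + 1) → Simplex m) :
    aff w (bary n u) = bary n (aff w ∘ u) :=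
  DFunLike.congr_fun (aff_aff w u) _

theorem simplexMap_bary {m k n : ℕ} (f : Fin (m + 1) → Fin (k + 1)) (u : Fin (n + 1) → Simplex m) :
    simplexMap f (bary n u) = bary n (simplexMap f ∘ u) :=
  DFunLike.congr_fun (simplexMap_aff u f) _

/-- The inclusion of ordered chains in a simplex as the bottom of a prism. -/
abbrev bottom (m : ℕ) : OChain (Simplex m) →ₗ[ℤ] OChain (Simplex m × Simplex 1) :=
  omap fun v => (v, vtx 1 0)

/-- The inclusion of ordered chains in a simplex as the top of a prism. -/
abbrev top (m : ℕ) : OChain (Simplex m) →ₗ[ℤ] OChain (Simplex m × Simplex 1) :=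
  omap fun v => (v, vtx 1 1)

theorem omap_omap {U V W : Type*} (g : V → W) (f : U → V) (x : OChain U) :
    omap g (omap f x) = omap (g ∘ f) x := by
  have := lin_ext (T := OSimplex U) (f := omap g ∘ₗ omap f) (g := omap (g ∘ f)) (fun n v => by
    rw [LinearMap.comp_apply, omap_osimp, omap_osimp, omap_osimp, Function.comp_assoc]) x
  rwa [LinearMap.comp_apply] at this

/-- Barycentric subdivision of singular chains. -/
def sSubdiv : SChain X →ₗ[ℤ] SChain X :=
  natOp (fun m => bottom m ∘ₗ subdiv bary) ContinuousMap.fst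

/-- The chain homotopy between barycentric subdivision and the identity. -/
def sSubdivHomotopy : SChain X →ₗ[ℤ] SChain X :=
  natOp (fun m => bottom m ∘ₗ homotopyOp (fun _ w => w 0) (LinearMap.id - subdiv bary))
    ContinuousMap.fst

/-- The prism operator of a homotopy. -/
def prism (h : C(X × Simplex 1, Y)) : SChain X →ₗ[ℤ] SChain Y :=
  natOp (fun m => homotopyOp (fun _ w => (w 0, vtx 1 0)) (top m - bottom m)) h

theorem isNatural_subdiv : IsNatural fun m => bottom m ∘ₗ subdiv bary := by
  intro n m f x
  rw [LinearMap.comp_apply, LinearMap.comp_apply,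
    ← omap_subdiv (fun k v => simplexMap_bary f v), omap_omap, omap_omap]
  rfl

/-- The cones have the first vertex as apex, a choice preserved by every map of vertices. -/
theorem isNatural_subdivHomotopy : IsNatural fun m =>
    bottom m ∘ₗ homotopyOp (fun _ w => w 0) (LinearMap.id - subdiv bary) := by
  intro n m f x
  rw [LinearMap.comp_apply, LinearMap.comp_apply,
    ← omap_homotopyOp (f := simplexMap f) (g := simplexMap f) (κ := fun _ w => w 0)
      (D := LinearMap.id - subdiv bary) (fun k v => rfl) (fun y => ?_), omap_omap, omap_omap]
  · rfl
  · rw [LinearMap.sub_apply, LinearMap.sub_apply, map_sub,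
      omap_subdiv (fun k v => simplexMap_bary f v)]
    rfl

theorem isNatural_prism : IsNatural fun m =>
    homotopyOp (fun _ w => (w 0, vtx 1 0)) (top m - bottom m) := by
  intro n m f x
  refine omap_homotopyOp (fun k v => rfl) (fun y => ?_) x
  rw [LinearMap.sub_apply, LinearMap.sub_apply, map_sub, omap_omap, omap_omap, omap_omap, omap_omap]
  rfl

/-- The chain of affine simplices in a singular simplex given by an ordered chain. -/
def subst {n : ℕ} (σ : C(Simplex n, X)) : OChain (Simplex n) →ₗ[ℤ] SChain X :=
  smap (ContinuousMap.fst.comp (σ.prodMap (ContinuousMap.id _))) ∘ₗ affChain n 1 ∘ₗ bottom n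

theorem subst_osimp {n m : ℕ} (σ : C(Simplex n, X)) (w : Fin (m + 1) → Simplex n) :
    subst σ (osimp w) = ssimp (σ.comp (aff w)) := by
  rw [subst, LinearMap.comp_apply, LinearMap.comp_apply, omap_osimp, affChain_osimp, smap_ssimp]
  rfl

theorem subst_vtx {n : ℕ} (σ : C(Simplex n, X)) : subst σ (osimp (vtx n)) = ssimp σ := by
  rw [subst_osimp, aff_vtx, ContinuousMap.comp_id]

theorem sSubdiv_ssimp {n : ℕ} (σ : C(Simplex n, X)) :
    sSubdiv (ssimp σ) = subst σ (subdiv bary (osimp (vtx n))) := natOp_ssimp _ _ σ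

theorem subst_omap_aff {n m : ℕ} (σ : C(Simplex n, X)) (w : Fin (m + 1) → Simplex n)
    (x : OChain (Simplex m)) : subst (σ.comp (aff w)) x = subst σ (omap (aff w) x) := by
  have := lin_ext (T := OSimplex (Simplex m)) (f := subst (σ.comp (aff w)))
    (g := subst σ ∘ₗ omap (aff w)) (fun n v => by
      rw [LinearMap.comp_apply, omap_osimp, subst_osimp, subst_osimp, ContinuousMap.comp_assoc,
        aff_aff]) x
  rwa [LinearMap.comp_apply] at this

/-- Affine maps preserve barycentres. Iterated subdivision of a singular simplex can therefore be
carried out inside the standard simplex, where distances are available. -/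
theorem sSubdiv_subst {n : ℕ} (σ : C(Simplex n, X)) (x : OChain (Simplex n)) :
    sSubdiv (subst σ x) = subst σ (subdiv bary x) := by
  have := lin_ext (T := OSimplex (Simplex n)) (f := sSubdiv ∘ₗ subst σ)
    (g := subst σ ∘ₗ subdiv bary) (fun m w => by
      rw [LinearMap.comp_apply, LinearMap.comp_apply, subst_osimp, sSubdiv_ssimp, subst_omap_aff,
        omap_subdiv (fun k v => aff_bary w v), omap_osimp, aff_comp_vtx]) x
  rwa [LinearMap.comp_apply, LinearMap.comp_apply] at this

theorem sSubdiv_iterate_ssimp {n : ℕ} (σ : C(Simplex n, X)) (k : ℕ) :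
    sSubdiv^[k] (ssimp σ) = subst σ ((subdiv bary)^[k] (osimp (vtx n))) := by
  induction k with
  | zero => exact (subst_vtx σ).symm
  | succ k ih => rw [Function.iterate_succ_apply', Function.iterate_succ_apply', ih, sSubdiv_subst]

theorem sd_sSubdiv (x : SChain X) : sd (sSubdiv x) = sSubdiv (sd x) := by
  suffices H : sd ∘ₗ sSubdiv = (sSubdiv ∘ₗ sd : SChain X →ₗ[ℤ] SChain X) from
    LinearMap.congr_fun H x
  refine schain_ext fun n σ => ?_
  rw [LinearMap.comp_apply, LinearMap.comp_apply, sSubdiv, natOp_sd isNatural_subdiv, sd_natOp,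
    LinearMap.comp_apply, LinearMap.comp_apply, od_omap, od_subdiv]

theorem sd_sSubdivHomotopy (x : SChain X) :
    sd (sSubdivHomotopy x) = x - sSubdiv x - sSubdivHomotopy (sd x) := by
  suffices H : sd ∘ₗ sSubdivHomotopy =
      (LinearMap.id - sSubdiv - sSubdivHomotopy ∘ₗ sd : SChain X →ₗ[ℤ] SChain X) from
    LinearMap.congr_fun H x
  refine schain_ext fun n σ => ?_
  rw [LinearMap.comp_apply, LinearMap.sub_apply, LinearMap.sub_apply, LinearMap.comp_apply,
    sSubdivHomotopy, natOp_sd isNatural_subdivHomotopy, sd_natOp, LinearMap.comp_apply,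
    LinearMap.comp_apply, od_omap, od_homotopyOp, LinearMap.sub_apply]
  · rw [map_sub, map_sub, map_sub, map_sub, map_sub, map_sub, LinearMap.id_apply,
      LinearMap.id_apply, sSubdiv_ssimp]
    conv_rhs => rw [← subst_vtx σ]
    rfl
  · intro y
    rw [LinearMap.sub_apply, LinearMap.sub_apply, map_sub, od_subdiv]
    rfl
  · intro y
    rw [LinearMap.sub_apply, map_sub, aug_subdiv, LinearMap.id_apply, sub_self]

theorem sSubdiv_mem {A : Set X} {x : SChain X} (hx : x ∈ chainsIn A) : sSubdiv x ∈ chainsIn A :=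
  natOp_mem (fun _ hx _ => hx) hx

theorem sSubdivHomotopy_mem {A : Set X} {x : SChain X} (hx : x ∈ chainsIn A) :
    sSubdivHomotopy x ∈ chainsIn A :=
  natOp_mem (fun _ hx _ => hx) hx

/-- The difference of the top and bottom inclusions is a chain map of augmentation zero, so
`od_homotopyOp` applies. -/
theorem sd_prism (h : C(X × Simplex 1, Y)) (x : SChain X) :
    sd (prism h x) = smap (h.comp ((ContinuousMap.id X).prodMk (ContinuousMap.const X (vtx 1 1)))) x -
      smap (h.comp ((ContinuousMap.id X).prodMk (ContinuousMap.const X (vtx 1 0)))) x -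
      prism h (sd x) := by
  suffices H : sd ∘ₗ prism h =
      smap (h.comp ((ContinuousMap.id X).prodMk (ContinuousMap.const X (vtx 1 1)))) -
      smap (h.comp ((ContinuousMap.id X).prodMk (ContinuousMap.const X (vtx 1 0)))) -
      prism h ∘ₗ sd from
    LinearMap.congr_fun H x
  refine schain_ext fun n σ => ?_
  rw [LinearMap.comp_apply, LinearMap.sub_apply, LinearMap.sub_apply, LinearMap.comp_apply,
    prism, natOp_sd isNatural_prism, sd_natOp, od_homotopyOp, LinearMap.sub_apply]
  · rw [map_sub, map_sub, map_sub, map_sub, omap_osimp, omap_osimp, affChain_osimp, affChain_osimp,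
      smap_ssimp, smap_ssimp, smap_ssimp, smap_ssimp]
    -- The affine simplex whose vertices all have height `i` stays at that height, since barycentric
    -- coordinates sum to one.
    have key (i : Fin 2) : (h.comp (σ.prodMap (ContinuousMap.id (Simplex 1)))).comp
        (affProd ((fun v => (v, vtx 1 i)) ∘ vtx n)) =
        (h.comp ((ContinuousMap.id X).prodMk (ContinuousMap.const X (vtx 1 i)))).comp σ := by
      ext1 t
      refine congrArg h (Prod.ext ?_ ?_)
      · exact congrArg σ (DFunLike.congr_fun (aff_vtx n) t)
      · ext j
        change (∑ l, t l • (vtx 1 i : Fin 2 → ℝ)) j = vtx 1 i j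
        rw [← Finset.sum_smul, show ∑ l, t l = 1 from t.2.2, one_smul]
    rw [key, key]
  · intro y
    rw [LinearMap.sub_apply, LinearMap.sub_apply, map_sub, od_omap, od_omap]
  · intro y
    rw [LinearMap.sub_apply, map_sub, aug_omap, aug_omap, sub_self]

theorem prism_mem {A : Set X} {B : Set Y} {h : C(X × Simplex 1, Y)}
    (hAB : ∀ x ∈ A, ∀ t, h (x, t) ∈ B) {x : SChain X} (hx : x ∈ chainsIn A) :
    prism h x ∈ chainsIn B :=
  natOp_mem hAB hx

end Subdivision

end Chains

end

noncomputable section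

namespace Chains

/-! ### Subdivision makes chains small -/

section Mesh

theorem dist_aff_le {n m : ℕ} (w : Fin (n + 1) → Simplex m) (t : Simplex n) (p : Simplex m) {R : ℝ}
    (h : ∀ j, dist p (w j) ≤ R) : dist p (aff w t) ≤ R := by
  have hmem : (aff w t : Fin (m + 1) → ℝ) ∈ Metric.closedBall (p : Fin (m + 1) → ℝ) R := by
    rw [aff_coe]
    refine (convex_closedBall _ _).sum_mem (fun j _ => t.2.1 j) t.2.2 fun j _ => ?_
    rw [Metric.mem_closedBall, dist_comm]
    exact h j
  rw [Metric.mem_closedBall, dist_comm] at hmem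
  exact hmem

/-- The vector from `w j` to the barycentre averages the differences `w i - w j` over `n + 1`
indices, and the term `i = j` is zero; this produces the factor `n / (n + 1)`. -/
theorem dist_bary_le {n m : ℕ} (w : Fin (n + 1) → Simplex m) {D : ℝ}
    (h : ∀ i j, dist (w i) (w j) ≤ D) (j : Fin (n + 1)) :
    dist (bary n w) (w j) ≤ (n / (n + 1) : ℝ) * D := by
  have hD : 0 ≤ D := dist_nonneg.trans (h j j)
  have hn : (0 : ℝ) < n + 1 := by positivity
  rw [Subtype.dist_eq, dist_eq_norm]
  have e : (bary n w : Fin (m + 1) → ℝ) - w j =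
      ∑ i, (n + 1 : ℝ)⁻¹ • ((w i : Fin (m + 1) → ℝ) - w j) := by
    have hb : (bary n w : Fin (m + 1) → ℝ) = ∑ i, (n + 1 : ℝ)⁻¹ • (w i : Fin (m + 1) → ℝ) := by
      rw [bary, aff_coe]
      refine Finset.sum_congr rfl fun i _ => ?_
      congr 1
      change ((Fintype.card (Fin (n + 1)) : ℝ))⁻¹ = _
      rw [Fintype.card_fin]
      push_cast
      rfl
    simp only [smul_sub, Finset.sum_sub_distrib, hb]
    rw [Finset.sum_const, Finset.card_univ, Fintype.card_fin, ← Nat.cast_smul_eq_nsmul ℝ, smul_smul]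
    push_cast
    rw [mul_inv_cancel₀ hn.ne', one_smul]
  refine (congrArg norm e).trans_le ?_
  refine (norm_sum_le _ _).trans ?_
  rw [← Finset.add_sum_erase _ _ (Finset.mem_univ j), sub_self, smul_zero, norm_zero, zero_add]
  refine (Finset.sum_le_card_nsmul _ _ ((n + 1 : ℝ)⁻¹ * D) fun i _ => ?_).trans ?_
  · rw [norm_smul, Real.norm_of_nonneg (by positivity)]
    refine mul_le_mul_of_nonneg_left ?_ (by positivity)
    rw [← dist_eq_norm]
    exact h i j
  · rw [Finset.card_erase_of_mem (Finset.mem_univ _), Finset.card_univ, Fintype.card_fin,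
      nsmul_eq_mul, Nat.add_sub_cancel, div_eq_mul_inv, mul_assoc]

/-- The ordered simplices of dimension `n` that lie in every ball containing the vertices of `v`,
and whose vertices have mutual distance at most `D`. -/
def meshIn {n m : ℕ} (v : Fin (n + 1) → Simplex m) (D : ℝ) : Set (Σ k, OSimplex (Simplex m) k) :=
  {s | s.1 = n ∧ (∀ p R, (∀ j, dist p (v j) ≤ R) → ∀ i, dist p (s.2 i) ≤ R) ∧
    ∀ i j, dist (s.2 i) (s.2 j) ≤ D}

/-- The ball condition is carried through the induction to control edges at the new apex: all old
vertices lie within `n / (n + 1) * D` of the barycentre, hence so do the vertices of the subdivided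
faces. -/
theorem subdiv_mem_meshIn {m : ℕ} {D : ℝ} {n : ℕ} (v : Fin (n + 1) → Simplex m)
    (h : ∀ i j, dist (v i) (v j) ≤ D) :
    subdiv bary (osimp v) ∈ supp (T := OSimplex (Simplex m)) (meshIn v (n / (n + 1) * D)) := by
  induction n with
  | zero =>
    rw [subdiv_osimp_zero]
    refine single_mem_supp (T := OSimplex (Simplex m)) ⟨rfl, fun p R hp i => hp i, fun i j => ?_⟩
    rw [Subsingleton.elim (α := Fin 1) i j]
    simp
  | succ n ih =>
    have hD : 0 ≤ D := dist_nonneg.trans (h 0 0)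
    -- The contraction factor increases with the dimension, so the bound for the faces is good
    -- enough for the whole simplex.
    have hle : (n / (n + 1) * D : ℝ) ≤ ((n + 1 : ℕ) : ℝ) / ((n + 1 : ℕ) + 1) * D := by
      refine mul_le_mul_of_nonneg_right ?_ hD
      rw [div_le_div_iff₀ (by positivity) (by positivity)]
      push_cast
      nlinarith
    have hb := dist_bary_le v h
    rw [subdiv_osimp_succ, od_osimp]
    simp only [map_sum, map_smul]
    refine Submodule.sum_mem _ fun i _ => Submodule.smul_mem _ _ ?_
    refine map_mem_of_single (T := OSimplex (Simplex m)) (A := meshIn (v ∘ i.succAbove) _)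
      (fun k u hu => ?_) (ih (v ∘ i.succAbove) fun a b => h _ _)
    obtain ⟨rfl, hu1, hu2⟩ := hu
    rw [cone_osimp]
    have hu1' : ∀ p R, (∀ j, dist p (v j) ≤ R) → ∀ i, dist p (u i) ≤ R :=
      fun p R hp => hu1 p R fun j => hp _
    refine single_mem_supp (T := OSimplex (Simplex m)) ⟨rfl, fun p R hp a => ?_, fun a b => ?_⟩
    · refine Fin.cases ?_ (fun a => ?_) a
      · exact dist_aff_le _ _ _ hp
      · exact hu1' p R hp a
    · refine Fin.cases ?_ (fun a => ?_) a <;> refine Fin.cases ?_ (fun b => ?_) b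
      · simp only [Fin.cons_zero, dist_self]; positivity
      · exact hu1' _ _ hb b
      · rw [dist_comm]; exact hu1' _ _ hb a
      · exact (hu2 a b).trans hle

/-- The ordered simplices of dimension `n` whose vertices have mutual distance at most `D`. -/
def mesh (m n : ℕ) (D : ℝ) : Set (Σ k, OSimplex (Simplex m) k) :=
  {s | s.1 = n ∧ ∀ i j, dist (s.2 i) (s.2 j) ≤ D}

theorem subdiv_iterate_mem_mesh {m n : ℕ} {D : ℝ} (v : Fin (n + 1) → Simplex m)
    (h : ∀ i j, dist (v i) (v j) ≤ D) (k : ℕ) : (subdiv bary)^[k] (osimp v) ∈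
      supp (T := OSimplex (Simplex m)) (mesh m n ((n / (n + 1)) ^ k * D)) := by
  induction k with
  | zero =>
    rw [pow_zero, one_mul]
    exact single_mem_supp (T := OSimplex (Simplex m)) ⟨rfl, h⟩
  | succ k ih =>
    rw [Function.iterate_succ_apply']
    refine map_mem_of_single (T := OSimplex (Simplex m)) (A := mesh m n _) (fun l u hu => ?_) ih
    obtain ⟨rfl, hu⟩ := hu
    refine Finsupp.supported_mono (fun s hs => ?_) (subdiv_mem_meshIn u hu)
    rw [pow_succ', mul_assoc]
    exact ⟨hs.1, hs.2.2⟩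

variable {X : Type*} [TopologicalSpace X]

theorem sSubdiv_iterate_mem {A : Set X} {x : SChain X} (hx : x ∈ chainsIn A) (k : ℕ) :
    sSubdiv^[k] x ∈ chainsIn A := by
  induction k with
  | zero => exact hx
  | succ k ih => rw [Function.iterate_succ_apply']; exact sSubdiv_mem ih

theorem sSubdiv_iterate_add (x y : SChain X) (k : ℕ) :
    sSubdiv^[k] (x + y) = sSubdiv^[k] x + sSubdiv^[k] y := iterate_map_add sSubdiv k x y

theorem sSubdiv_iterate_mem_sup {U V : Set X} {x : SChain X} (hx : x ∈ chainsIn U ⊔ chainsIn V)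
    (k : ℕ) : sSubdiv^[k] x ∈ chainsIn U ⊔ chainsIn V := by
  obtain ⟨y, hy, z, hz, rfl⟩ := Submodule.mem_sup.mp hx
  rw [sSubdiv_iterate_add]
  exact Submodule.add_mem_sup (sSubdiv_iterate_mem hy k) (sSubdiv_iterate_mem hz k)

/-- A Lebesgue number argument on the compact standard simplex. Stating it with ambient open sets
whose traces on `U ∪ V` lie in `U` and `V` lets excision be used inside arbitrary subspaces. -/
theorem exists_sSubdiv_ssimp_mem {U V O O' : Set X} (hO : IsOpen O) (hO' : IsOpen O') {n : ℕ}
    (σ : C(Simplex n, X)) (hσ : ∀ t, σ t ∈ U ∪ V) (hcov : U ∪ V ⊆ O ∪ O')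
    (hU : (U ∪ V) ∩ O ⊆ U) (hV : (U ∪ V) ∩ O' ⊆ V) :
    ∃ k, sSubdiv^[k] (ssimp σ) ∈ chainsIn U ⊔ chainsIn V := by
  obtain ⟨δ, hδ, hleb⟩ := lebesgue_number_lemma_of_metric (s := (univ : Set (Simplex n)))
    (c := fun b : Bool => if b then σ ⁻¹' O else σ ⁻¹' O') isCompact_univ
    (by rintro (_ | _)
        · exact hO'.preimage σ.continuous
        · exact hO.preimage σ.continuous)
    (fun t _ => by
      rcases hcov (hσ t) with h | h
      · exact mem_iUnion.mpr ⟨true, h⟩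
      · exact mem_iUnion.mpr ⟨false, h⟩)
  set D := Metric.diam (univ : Set (Simplex n))
  have hdist (i j) : dist (vtx n i) (vtx n j) ≤ D :=
    Metric.dist_le_diam_of_mem isCompact_univ.isBounded (mem_univ _) (mem_univ _)
  have hlim : Filter.Tendsto (fun k : ℕ => ((n : ℝ) / (n + 1)) ^ k * D) Filter.atTop (𝓝 (0 * D)) :=
    (tendsto_pow_atTop_nhds_zero_of_lt_one (by positivity)
      (by rw [div_lt_one (by positivity)]; linarith)).mul_const D
  rw [zero_mul] at hlim
  obtain ⟨k, hk⟩ := (hlim.eventually_lt_const hδ).exists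
  refine ⟨k, ?_⟩
  rw [sSubdiv_iterate_ssimp]
  refine map_mem_of_single (T := OSimplex (Simplex n)) (A := mesh n n _) (fun l u hu => ?_)
    (subdiv_iterate_mem_mesh (vtx n) hdist k)
  obtain ⟨-, hu⟩ := hu
  rw [subst_osimp]
  -- A simplex of mesh below the Lebesgue number lies in the ball about its first vertex.
  have hball (t) : aff u t ∈ Metric.ball (u 0) δ := by
    rw [Metric.mem_ball, dist_comm]
    exact (dist_aff_le u t (u 0) fun j => hu 0 j).trans_lt hk
  obtain ⟨b, hb⟩ := hleb (u 0) (mem_univ _)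
  rcases b with _ | _
  · exact Submodule.mem_sup_right (ssimp_mem fun t => hV ⟨hσ _, hb (hball t)⟩)
  · exact Submodule.mem_sup_left (ssimp_mem fun t => hU ⟨hσ _, hb (hball t)⟩)

theorem exists_sSubdiv_mem {U V O O' : Set X} (hO : IsOpen O) (hO' : IsOpen O')
    (hcov : U ∪ V ⊆ O ∪ O') (hU : (U ∪ V) ∩ O ⊆ U) (hV : (U ∪ V) ∩ O' ⊆ V) {x : SChain X}
    (hx : x ∈ chainsIn (U ∪ V)) : ∃ k, sSubdiv^[k] x ∈ chainsIn U ⊔ chainsIn V := by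
  rw [chainsIn, supp, Finsupp.supported_eq_span_single] at hx
  have hle {y : SChain X} {k l : ℕ} (hkl : k ≤ l) (h : sSubdiv^[k] y ∈ chainsIn U ⊔ chainsIn V) :
      sSubdiv^[l] y ∈ chainsIn U ⊔ chainsIn V := by
    obtain ⟨j, rfl⟩ := Nat.exists_eq_add_of_le hkl
    rw [Nat.add_comm, Function.iterate_add_apply]
    exact sSubdiv_iterate_mem_sup h j
  refine Submodule.span_induction ?_ ⟨0, zero_mem _⟩ ?_ ?_ hx
  · rintro _ ⟨s, hs, rfl⟩
    exact exists_sSubdiv_ssimp_mem hO hO' s.2 hs hcov hU hV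
  · rintro y z _ _ ⟨k, hk⟩ ⟨l, hl⟩
    -- Further subdivision keeps a chain split, so finitely many exponents have a common bound.
    refine ⟨max k l, ?_⟩
    rw [sSubdiv_iterate_add]
    exact add_mem (hle (le_max_left k l) hk) (hle (le_max_right k l) hl)
  · rintro a y _ ⟨k, hk⟩
    refine ⟨k, ?_⟩
    rw [iterate_map_zsmul sSubdiv k y a]
    exact Submodule.smul_mem _ a hk

theorem exists_sSubdiv_iterate_homotopy (k : ℕ) : ∃ H : SChain X →ₗ[ℤ] SChain X,
    (∀ (A : Set X) x, x ∈ chainsIn A → H x ∈ chainsIn A) ∧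
      ∀ x, x - sSubdiv^[k] x = sd (H x) + H (sd x) := by
  induction k with
  | zero => exact ⟨0, fun A x _ => zero_mem _, fun x => by simp⟩
  | succ k ih =>
    obtain ⟨H, hH, e⟩ := ih
    -- Comes from `x - S^(k+1) x = (x - S x) + S (x - S^k x)`, writing `S` for subdivision.
    refine ⟨sSubdivHomotopy + sSubdiv ∘ₗ H, fun A x hx => add_mem (sSubdivHomotopy_mem hx)
      (sSubdiv_mem (hH A x hx)), fun x => ?_⟩
    have e1 := sd_sSubdivHomotopy x
    have e2 := congrArg sSubdiv (e x)
    rw [map_sub, map_add, ← sd_sSubdiv] at e2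
    rw [Function.iterate_succ_apply']
    simp only [LinearMap.add_apply, LinearMap.comp_apply, map_add]
    rw [e1, eq_add_of_sub_eq e2]
    abel

end Mesh

end Chains

end

noncomputable section

/-! ### Relative cycles and boundaries -/

namespace Chains

section Relative

variable {X Y : Type*} [TopologicalSpace X] [TopologicalSpace Y]

/-- The relative cycles of the pair `(B, A)`. -/
def relCycles (B A : Set X) : Submodule ℤ (SChain X) := chainsIn B ⊓ (chainsIn A).comap sd

/-- The relative boundaries of the pair `(B, A)`. -/
def relBoundaries (B A : Set X) : Submodule ℤ (SChain X) := (chainsIn B).map sd ⊔ chainsIn A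

theorem mem_relCycles {B A : Set X} {z : SChain X} :
    z ∈ relCycles B A ↔ z ∈ chainsIn B ∧ sd z ∈ chainsIn A := Iff.rfl

theorem mem_relBoundaries {B A : Set X} {z : SChain X} :
    z ∈ relBoundaries B A ↔ ∃ b ∈ chainsIn B, ∃ a ∈ chainsIn A, sd b + a = z := by
  simp only [relBoundaries, Submodule.mem_sup, Submodule.mem_map]
  exact ⟨fun ⟨_, ⟨b, hb, rfl⟩, a, ha, h⟩ => ⟨b, hb, a, ha, h⟩,
    fun ⟨b, hb, a, ha, h⟩ => ⟨_, ⟨b, hb, rfl⟩, a, ha, h⟩⟩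

variable {A B A' B' A'' B'' : Set X}

theorem relCycles_mono (hA : A ⊆ A') (hB : B ⊆ B') : relCycles B A ≤ relCycles B' A' :=
  fun _ hz => ⟨chainsIn_mono hB hz.1, chainsIn_mono hA hz.2⟩

theorem relBoundaries_mono (hA : A ⊆ A') (hB : B ⊆ B') : relBoundaries B A ≤ relBoundaries B' A' :=
  sup_le_sup (Submodule.map_mono (chainsIn_mono hB)) (chainsIn_mono hA)

theorem sd_mem_relBoundaries {b : SChain X} (hb : b ∈ chainsIn B) : sd b ∈ relBoundaries B A :=
  Submodule.mem_sup_left ⟨b, hb, rfl⟩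

theorem mem_relBoundaries_of_mem {a : SChain X} (ha : a ∈ chainsIn A) : a ∈ relBoundaries B A :=
  Submodule.mem_sup_right ha

theorem sdeg_mem_relBoundaries (n : ℕ) {z : SChain X} (hz : z ∈ relBoundaries B A) :
    sdeg n z ∈ relBoundaries B A := by
  obtain ⟨b, hb, a, ha, rfl⟩ := mem_relBoundaries.mp hz
  rw [map_add, sdeg_sd]
  exact add_mem (sd_mem_relBoundaries (sdeg_mem _ hb)) (mem_relBoundaries_of_mem (sdeg_mem _ ha))

/-- The inclusion of pairs `(B, A) ⊆ (B', A')` is an isomorphism in homology. -/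
structure RelIso (B A B' A' : Set X) : Prop where
  surj : ∀ z ∈ relCycles B' A', ∃ w ∈ relCycles B A, z - w ∈ relBoundaries B' A'
  inj : ∀ z ∈ relCycles B A, z ∈ relBoundaries B' A' → z ∈ relBoundaries B A

/-- With the two lemmas that follow, the two-out-of-three property for nested pairs. -/
theorem RelIso.trans (h : RelIso B A B' A') (h' : RelIso B' A' B'' A'') (hA : A ⊆ A')
    (hB : B ⊆ B') (hA' : A' ⊆ A'') (hB' : B' ⊆ B'') : RelIso B A B'' A'' where
  surj z hz := by
    obtain ⟨w, hw, hzw⟩ := h'.surj z hz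
    obtain ⟨v, hv, hwv⟩ := h.surj w hw
    refine ⟨v, hv, ?_⟩
    rw [← sub_add_sub_cancel z w v]
    exact add_mem hzw (relBoundaries_mono hA' hB' hwv)
  inj z hz hz' := h.inj z hz (h'.inj z (relCycles_mono hA hB hz) hz')

theorem RelIso.of_trans_right (h : RelIso B A B'' A'') (h' : RelIso B' A' B'' A'') (hA : A ⊆ A')
    (hB : B ⊆ B') (hA' : A' ⊆ A'') (hB' : B' ⊆ B'') : RelIso B A B' A' where
  surj z hz := by
    obtain ⟨w, hw, hzw⟩ := h.surj z (relCycles_mono hA' hB' hz)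
    exact ⟨w, hw, h'.inj _ (sub_mem hz (relCycles_mono hA hB hw)) hzw⟩
  inj z hz hz' := h.inj z hz (relBoundaries_mono hA' hB' hz')

theorem RelIso.of_trans_left (h : RelIso B A B' A') (h' : RelIso B A B'' A'') (hA : A ⊆ A')
    (hB : B ⊆ B') (hA' : A' ⊆ A'') (hB' : B' ⊆ B'') : RelIso B' A' B'' A'' where
  surj z hz := by
    obtain ⟨w, hw, hzw⟩ := h'.surj z hz
    exact ⟨w, relCycles_mono hA hB hw, hzw⟩
  inj z hz hz' := by
    obtain ⟨w, hw, hzw⟩ := h.surj z hz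
    have hw' : w ∈ relBoundaries B'' A'' := by
      rw [← sub_sub_cancel z w]
      exact sub_mem hz' (relBoundaries_mono hA' hB' hzw)
    rw [← sub_add_cancel z w]
    exact add_mem hzw (relBoundaries_mono hA hB (h'.inj w hw hw'))

/-- The homology of the pair `(B, A)` vanishes. -/
def Acyclic (B A : Set X) : Prop := relCycles B A ≤ relBoundaries B A

/-- The exact sequence of the triple by hand: the boundary of a cycle modulo `A'` is a cycle of
`(A', A)`, hence equals `sd b + a`, and subtracting `b` turns the given cycle into one modulo `A`.
-/
theorem Acyclic.relIso (hA : Acyclic A' A) (h' : A' ⊆ B) : RelIso B A B A' where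
  surj z hz := by
    obtain ⟨b, hb, a, ha, e⟩ := mem_relBoundaries.mp (hA (mem_relCycles.mpr ⟨hz.2, by rw [sd_sd]; exact zero_mem _⟩))
    refine ⟨z - b, mem_relCycles.mpr ⟨sub_mem hz.1 (chainsIn_mono h' hb), ?_⟩, ?_⟩
    · rw [map_sub, ← e, add_sub_cancel_left]
      exact ha
    · rw [sub_sub_cancel]
      exact mem_relBoundaries_of_mem hb
  inj z hz hz' := by
    obtain ⟨b, hb, a, ha, e⟩ := mem_relBoundaries.mp hz'
    have e' : sd a = sd z := by rw [← e, map_add, sd_sd, zero_add]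
    have := hA (x := a) (mem_relCycles.mpr ⟨ha, by rw [e']; exact hz.2⟩)
    rw [← e]
    exact add_mem (sd_mem_relBoundaries hb) (relBoundaries_mono le_rfl h' this)

/-- In a triple `A ⊆ A' ⊆ B`, if `(B, A)` and `(A', A)` are acyclic, so is `(B, A')`. -/
theorem Acyclic.of_acyclic (hB : Acyclic B A) (hA : Acyclic A' A) (h : A ⊆ A') (h' : A' ⊆ B) :
    Acyclic B A' := fun z hz => by
  obtain ⟨w, hw, hzw⟩ := (hA.relIso h').surj z hz
  rw [← sub_add_cancel z w]
  exact add_mem hzw (relBoundaries_mono h le_rfl (hB hw))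

/-- The relative cycle `z` is a generator of the homology of `(B, A)`, which is infinite cyclic. -/
structure IsGen (z : SChain X) (B A : Set X) : Prop where
  mem : z ∈ relCycles B A
  exists_smul : ∀ w ∈ relCycles B A, ∃ k : ℤ, w - k • z ∈ relBoundaries B A
  eq_zero : ∀ k : ℤ, k • z ∈ relBoundaries B A → k = 0

theorem IsGen.of_relIso {z : SChain X} (hz : IsGen z B A) (h : RelIso B A B' A') (hA : A ⊆ A')
    (hB : B ⊆ B') : IsGen z B' A' where
  mem := relCycles_mono hA hB hz.mem
  exists_smul w hw := by
    obtain ⟨v, hv, hwv⟩ := h.surj w hw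
    obtain ⟨k, hk⟩ := hz.exists_smul v hv
    refine ⟨k, ?_⟩
    rw [← sub_add_sub_cancel w v]
    exact add_mem hwv (relBoundaries_mono hA hB hk)
  eq_zero k hk := hz.eq_zero k (h.inj _ (Submodule.smul_mem _ k hz.mem) hk)

/-- Each generator is a multiple of the other modulo boundaries, and since the group is torsion-free
the two multipliers are inverse integers. -/
theorem IsGen.sub_mem_or_add_mem {z w : SChain X} (hz : IsGen z B A) (hw : IsGen w B A) :
    ∃ k : ℤ, (k = 1 ∨ k = -1) ∧ w - k • z ∈ relBoundaries B A := by
  obtain ⟨k, hk⟩ := hz.exists_smul w hw.mem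
  obtain ⟨l, hl⟩ := hw.exists_smul z hz.mem
  refine ⟨k, ?_, hk⟩
  have h : (1 - k * l) • w ∈ relBoundaries B A := by
    have : (1 - k * l) • w = w - k • z + k • (z - l • w) := by
      rw [smul_sub, smul_smul, sub_smul, one_smul]; abel
    rw [this]
    exact add_mem hk (Submodule.smul_mem _ k hl)
  exact Int.isUnit_iff.mp (IsUnit.of_mul_eq_one l (sub_eq_zero.mp (hw.eq_zero _ h)).symm)

theorem IsGen.congr {z w : SChain X} (hz : IsGen z B A) (hw : w ∈ relCycles B A) {k : ℤ}
    (hk : k = 1 ∨ k = -1) (h : w - k • z ∈ relBoundaries B A) : IsGen w B A where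
  mem := hw
  exists_smul v hv := by
    obtain ⟨l, hl⟩ := hz.exists_smul v hv
    refine ⟨l * k, ?_⟩
    have hkk : k * k = 1 := by rcases hk with rfl | rfl <;> rfl
    have : v - (l * k) • w = v - l • z - (l * k) • (w - k • z) := by
      rw [smul_sub, smul_smul, mul_assoc, hkk, mul_one]; abel
    rw [this]
    exact sub_mem hl (Submodule.smul_mem _ _ h)
  eq_zero l hl := by
    have : (l * k) • z ∈ relBoundaries B A := by
      have : (l * k) • z = l • w - l • (w - k • z) := by rw [smul_sub, smul_smul]; abel
      rw [this]
      exact sub_mem hl (Submodule.smul_mem _ _ h)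
    have := hz.eq_zero _ this
    rcases hk with rfl | rfl <;> simpa using this

/-- A generating cycle of the same pair is a generator, once one generator is known. -/
theorem IsGen.of_generates {z w : SChain X} (hz : IsGen z B A) (hw : w ∈ relCycles B A)
    (h : ∃ k : ℤ, z - k • w ∈ relBoundaries B A) : IsGen w B A := by
  obtain ⟨l, hl⟩ := h
  obtain ⟨k, hk⟩ := hz.exists_smul w hw
  refine hz.congr hw ?_ hk
  have h : (1 - k * l) • z ∈ relBoundaries B A := by
    have : (1 - k * l) • z = z - l • w + l • (w - k • z) := by
      rw [smul_sub, smul_smul, sub_smul, one_smul, mul_comm k l]; abel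
    rw [this]
    exact add_mem hl (Submodule.smul_mem _ l hk)
  exact Int.isUnit_iff.mp (IsUnit.of_mul_eq_one l (sub_eq_zero.mp (hz.eq_zero _ h)).symm)

variable {F : Set X}

/-- In the triple `A ⊆ F ⊆ B` with vanishing homology of `(B, A)`, the connecting map from `(B, F)`
to `(F, A)` is an isomorphism. -/
theorem IsGen.sd_of_acyclic {z : SChain X} (hz : IsGen z B F) (h : Acyclic B A) (hAF : A ⊆ F)
    (hFB : F ⊆ B) : IsGen (sd z) F A where
  mem := mem_relCycles.mpr ⟨hz.mem.2, by rw [sd_sd]; exact zero_mem _⟩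
  exists_smul w hw := by
    obtain ⟨b, hb, a, ha, e⟩ := mem_relBoundaries.mp (h (relCycles_mono le_rfl hFB hw))
    have hbF : b ∈ relCycles B F := by
      refine mem_relCycles.mpr ⟨hb, ?_⟩
      rw [eq_sub_of_add_eq e]
      exact sub_mem hw.1 (chainsIn_mono hAF ha)
    obtain ⟨k, hk⟩ := hz.exists_smul b hbF
    obtain ⟨c, hc, f, hf, e'⟩ := mem_relBoundaries.mp hk
    refine ⟨k, mem_relBoundaries.mpr ⟨f, hf, a, ha, ?_⟩⟩
    have := congrArg sd e'
    rw [map_add, sd_sd, zero_add, map_sub, map_smul] at this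
    rw [← e, this]
    abel
  eq_zero k hk := by
    obtain ⟨f, hf, a, ha, e⟩ := mem_relBoundaries.mp hk
    have h1 : k • z - f ∈ relCycles B A := by
      refine mem_relCycles.mpr ⟨sub_mem (Submodule.smul_mem _ k hz.mem.1) (chainsIn_mono hFB hf), ?_⟩
      rw [map_sub, map_smul, ← e, add_sub_cancel_left]
      exact ha
    refine hz.eq_zero k ?_
    rw [← sub_add_cancel (k • z) f]
    exact add_mem (relBoundaries_mono hAF le_rfl (h h1)) (mem_relBoundaries_of_mem hf)

/-- The inverse of the same connecting isomorphism, with track kept of the degree, which it raises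
by one. -/
theorem IsGen.exists_of_acyclic {w : SChain X} {n : ℕ} (hw : IsGen w F A) (hn : sdeg n w = w)
    (h : Acyclic B A) (hAF : A ⊆ F) (hFB : F ⊆ B) :
    ∃ z, sdeg (n + 1) z = z ∧ IsGen z B F := by
  obtain ⟨b, hb, a, ha, e⟩ := mem_relBoundaries.mp (h (relCycles_mono le_rfl hFB hw.mem))
  -- The primitive may be inhomogeneous; its part in degree `n + 1` serves equally well because `w`
  -- is concentrated in degree `n`.
  have e' : sd (sdeg (n + 1) b) + sdeg n a = w := by
    rw [← sdeg_sd, ← map_add, e, hn]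
  refine ⟨sdeg (n + 1) b, degreePart_degreePart_self _ _, ?_⟩
  have hb' := sdeg_mem (n + 1) hb
  have ha' := sdeg_mem n ha
  generalize sdeg (n + 1) b = b at *
  generalize sdeg n a = a at *
  clear e hb ha
  constructor
  · refine mem_relCycles.mpr ⟨hb', ?_⟩
    rw [eq_sub_of_add_eq e']
    exact sub_mem hw.mem.1 (chainsIn_mono hAF ha')
  · intro v hv
    obtain ⟨k, hk⟩ := hw.exists_smul (sd v)
      (mem_relCycles.mpr ⟨hv.2, by rw [sd_sd]; exact zero_mem _⟩)
    obtain ⟨f, hf, a', ha'', e''⟩ := mem_relBoundaries.mp hk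
    refine ⟨k, ?_⟩
    rw [← sub_add_cancel (v - k • b) f]
    refine add_mem (relBoundaries_mono hAF le_rfl (h (mem_relCycles.mpr ⟨sub_mem (sub_mem hv.1
      (Submodule.smul_mem _ k hb')) (chainsIn_mono hFB hf), ?_⟩))) (mem_relBoundaries_of_mem hf)
    have : sd (v - k • b - f) = a' + k • a := by
      rw [map_sub, map_sub, map_smul, eq_sub_of_add_eq e', eq_sub_of_add_eq e'', smul_sub]; abel
    rw [this]
    exact add_mem ha'' (Submodule.smul_mem _ k ha')
  · intro k hk
    obtain ⟨c, hc, f, hf, e''⟩ := mem_relBoundaries.mp hk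
    refine hw.eq_zero k (mem_relBoundaries.mpr ⟨f, hf, k • a, Submodule.smul_mem _ k ha', ?_⟩)
    have := congrArg sd e''
    rw [map_add, sd_sd, zero_add, map_smul] at this
    rw [this, ← smul_add, e']

/-- Excision. -/
theorem relIso_excision {U V O O' : Set X} (hO : IsOpen O) (hO' : IsOpen O')
    (hcov : U ∪ V ⊆ O ∪ O') (hU : (U ∪ V) ∩ O ⊆ U) (hV : (U ∪ V) ∩ O' ⊆ V) :
    RelIso U (U ∩ V) (U ∪ V) V where
  surj z hz := by
    -- After enough subdivisions the cycle splits; its part in `U` is homologous to it modulo `V`.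
    obtain ⟨k, hk⟩ := exists_sSubdiv_mem hO hO' hcov hU hV hz.1
    obtain ⟨H, hH, e⟩ := exists_sSubdiv_iterate_homotopy (X := X) k
    obtain ⟨a, ha, b, hb, eab⟩ := Submodule.mem_sup.mp hk
    have h2 : z - a = sd (H z) + (H (sd z) + b) := by
      rw [← add_assoc, ← e, ← eab]; abel
    have hVb : H (sd z) + b ∈ chainsIn V := add_mem (hH _ _ hz.2) hb
    refine ⟨a, ⟨ha, chainsIn_inter (sd_mem ha) ?_⟩, ?_⟩
    · have : sd a = sd z - sd (H (sd z) + b) := by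
        rw [← sub_sub_cancel z a, h2, map_sub, map_add sd (sd _), sd_sd, zero_add]
      rw [this]
      exact sub_mem hz.2 (sd_mem hVb)
    · rw [h2]
      exact mem_relBoundaries.mpr ⟨_, hH _ _ hz.1, _, hVb, rfl⟩
  inj a ha hab := by
    obtain ⟨c, hc, b, hb, e⟩ := mem_relBoundaries.mp hab
    obtain ⟨k, hk⟩ := exists_sSubdiv_mem hO hO' hcov hU hV hc
    obtain ⟨H, hH, eH⟩ := exists_sSubdiv_iterate_homotopy (X := X) k
    obtain ⟨c₁, h₁, c₂, h₂, ec⟩ := Submodule.mem_sup.mp hk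
    have hS : sSubdiv^[k] a = sd c₁ + (sd c₂ + sSubdiv^[k] b) := by
      rw [← e, sSubdiv_iterate_add, ← add_assoc, ← map_add, ec]
      congr 1
      exact ((show Function.Commute (sd : SChain X →ₗ[ℤ] SChain X) sSubdiv from
        fun x => sd_sSubdiv x).iterate_right k c).symm
    -- This chain is visibly in `V`, and by `hS` it is a difference of chains in `U`.
    have hI : sd c₂ + sSubdiv^[k] b ∈ chainsIn (U ∩ V) := by
      refine chainsIn_inter ?_ (add_mem (sd_mem h₂) (sSubdiv_iterate_mem hb k))
      rw [← sub_eq_of_eq_add' hS]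
      exact sub_mem (sSubdiv_iterate_mem ha.1 k) (sd_mem h₁)
    refine mem_relBoundaries.mpr ⟨H a + c₁, add_mem (hH _ _ ha.1) h₁,
      H (sd a) + (sd c₂ + sSubdiv^[k] b), add_mem (hH _ _ ha.2) hI, ?_⟩
    have := eH a
    rw [sub_eq_iff_eq_add, hS] at this
    rw [map_add]
    conv_rhs => rw [this]
    abel

/-! ### Induced maps -/

theorem smap_mem_relCycles {A B : Set X} {A' B' : Set Y} {f : C(X, Y)} (hA : MapsTo f A A')
    (hB : MapsTo f B B') {z : SChain X} (hz : z ∈ relCycles B A) :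
    smap f z ∈ relCycles B' A' :=
  mem_relCycles.mpr ⟨smap_mem hB hz.1, by rw [sd_smap]; exact smap_mem hA hz.2⟩

/-- A simplex with values in the image lifts pointwise, and continuously because `f` is an
embedding. Thus embedded pairs have the same homology as their images. -/
theorem map_smap_chainsIn {f : C(X, Y)} (hf : IsEmbedding f) (A : Set X) :
    (chainsIn A).map (smap f) = chainsIn (f '' A) := by
  apply le_antisymm
  · rintro _ ⟨x, hx, rfl⟩
    exact smap_mem (mapsTo_image f A) hx
  · intro y hy
    rw [← LinearMap.id_apply (R := ℤ) y]
    refine mem_of_ssimp (fun n σ h => ?_) hy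
    let τ : Simplex n → X := fun t => (h t).choose
    have hτ : f ∘ τ = σ := funext fun t => (h t).choose_spec.2
    have hcont : Continuous τ := hf.continuous_iff.mpr (by rw [hτ]; exact σ.continuous)
    refine ⟨ssimp ⟨τ, hcont⟩, ssimp_mem fun t => (h t).choose_spec.1, ?_⟩
    rw [smap_ssimp, LinearMap.id_apply]
    congr 2
    ext1 t
    exact (h t).choose_spec.2

theorem smap_mem_relBoundaries_iff {f : C(X, Y)} (hf : IsEmbedding f) {B A : Set X}
    {z : SChain X} : smap f z ∈ relBoundaries (f '' B) (f '' A) ↔ z ∈ relBoundaries B A := by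
  constructor
  · intro h
    obtain ⟨b, hb, a, ha, e⟩ := mem_relBoundaries.mp h
    rw [← map_smap_chainsIn hf] at hb ha
    obtain ⟨b, hb, rfl⟩ := hb
    obtain ⟨a, ha, rfl⟩ := ha
    rw [sd_smap, ← map_add] at e
    exact mem_relBoundaries.mpr ⟨b, hb, a, ha, smap_injective hf.injective e⟩
  · intro h
    obtain ⟨b, hb, a, ha, rfl⟩ := mem_relBoundaries.mp h
    rw [map_add, ← sd_smap]
    exact mem_relBoundaries.mpr ⟨_, smap_mem (mapsTo_image f B) hb, _,
      smap_mem (mapsTo_image f A) ha, rfl⟩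

theorem exists_smap_of_mem_relCycles {f : C(X, Y)} (hf : IsEmbedding f) {B A : Set X}
    {y : SChain Y} (hy : y ∈ relCycles (f '' B) (f '' A)) : ∃ z ∈ relCycles B A, smap f z = y := by
  obtain ⟨h1, h2⟩ := mem_relCycles.mp hy
  rw [← map_smap_chainsIn hf] at h1
  rw [← map_smap_chainsIn hf] at h2
  obtain ⟨z, hz, rfl⟩ := h1
  obtain ⟨a, ha, e⟩ := h2
  rw [sd_smap] at e
  exact ⟨z, mem_relCycles.mpr ⟨hz, by rw [← smap_injective hf.injective e]; exact ha⟩, rfl⟩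

theorem IsGen.smap {f : C(X, Y)} (hf : IsEmbedding f) {B A : Set X} {z : SChain X}
    (hz : IsGen z B A) : IsGen (smap f z) (f '' B) (f '' A) where
  mem := smap_mem_relCycles (mapsTo_image f A) (mapsTo_image f B) hz.mem
  exists_smul w hw := by
    obtain ⟨v, hv, rfl⟩ := exists_smap_of_mem_relCycles hf hw
    obtain ⟨k, hk⟩ := hz.exists_smul v hv
    refine ⟨k, ?_⟩
    rw [← map_smul, ← map_sub]
    exact (smap_mem_relBoundaries_iff hf).mpr hk
  eq_zero k hk := by
    rw [← map_smul] at hk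
    exact hz.eq_zero k ((smap_mem_relBoundaries_iff hf).mp hk)

theorem Acyclic.image {f : C(X, Y)} (hf : IsEmbedding f) {B A : Set X} (h : Acyclic B A) :
    Acyclic (f '' B) (f '' A) := fun w hw => by
  obtain ⟨v, hv, rfl⟩ := exists_smap_of_mem_relCycles hf hw
  exact (smap_mem_relBoundaries_iff hf).mpr (h hv)

end Relative

end Chains

end

noncomputable section

/-! ### Homotopies and the homology of balls and spheres -/

namespace Chains

section Homotopy

variable {X : Type*} [TopologicalSpace X]

/-- In the prism formula the time-one chain and the prism on the boundary lie in `A`, so a cycle is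
a boundary modulo `A`. Since `H` is continuous only over `A'`, the cycle is first lifted to that
subspace. -/
theorem acyclic_of_homotopy {A A' : Set X} (hAA' : A ⊆ A') (H : X × ℝ → X)
    (hc : ContinuousOn H (A' ×ˢ Icc 0 1)) (h0 : ∀ x ∈ A', H (x, 0) = x)
    (h1 : ∀ x ∈ A', H (x, 1) ∈ A) (hA' : ∀ x ∈ A', ∀ t ∈ Icc (0 : ℝ) 1, H (x, t) ∈ A')
    (hA : ∀ x ∈ A, ∀ t ∈ Icc (0 : ℝ) 1, H (x, t) ∈ A) : Acyclic A' A := by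
  intro z hz
  have hmem (s : Simplex 1) : s 1 ∈ Icc (0 : ℝ) 1 := mem_Icc_of_mem_stdSimplex s.2 1
  -- The second barycentric coordinate of the 1-simplex plays the role of time.
  let h : C(A' × Simplex 1, X) := ⟨fun p => H (p.1, p.2 1), hc.comp_continuous
    ((continuous_subtype_val.comp continuous_fst).prodMk
      ((continuous_apply 1).comp (continuous_subtype_val.comp continuous_snd)))
    fun p => ⟨p.1.2, hmem _⟩⟩
  let ι : C(A', X) := ⟨Subtype.val, continuous_subtype_val⟩
  have hι : IsEmbedding ι := IsEmbedding.subtypeVal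
  have e1 : ι '' univ = A' := by simp [ι]
  have e2 : ι '' (ι ⁻¹' A) = A := by
    rw [image_preimage_eq_inter_range, ← image_univ, e1, inter_eq_left]; exact hAA'
  rw [← e1, ← e2] at hz
  have hz2 : sd z ∈ chainsIn (ι '' (ι ⁻¹' A)) := (mem_relCycles.mp hz).2
  obtain ⟨z, hz, rfl⟩ := exists_smap_of_mem_relCycles hι hz
  have key := sd_prism h z
  have hbot : h.comp ((ContinuousMap.id A').prodMk (ContinuousMap.const A' (vtx 1 0))) = ι := by
    ext x
    change H (x, (Pi.single 0 1 : Fin 2 → ℝ) 1) = x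
    rw [Pi.single_eq_of_ne (by decide)]
    exact h0 x x.2
  rw [hbot] at key
  rw [sd_smap, ← map_smap_chainsIn hι] at hz2
  obtain ⟨y, hy, ey⟩ := hz2
  have hz2 : sd z ∈ chainsIn (ι ⁻¹' A) := smap_injective hι.injective ey ▸ hy
  have m1 : prism h z ∈ chainsIn A' :=
    prism_mem (A := univ) (fun x _ t => hA' x.1 x.2 _ (hmem t)) (mem_chainsIn_univ z)
  have m2 : smap (h.comp ((ContinuousMap.id A').prodMk (ContinuousMap.const A' (vtx 1 1)))) z ∈
      chainsIn A := by
    refine smap_mem (A := univ) (fun x _ => ?_) (mem_chainsIn_univ z)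
    change H (x, (Pi.single 1 1 : Fin 2 → ℝ) 1) ∈ A
    rw [Pi.single_eq_same]
    exact h1 x x.2
  have m3 : prism h (sd z) ∈ chainsIn A :=
    prism_mem (A := ι ⁻¹' A) (fun x hx t => hA x.1 hx _ (hmem t)) hz2
  refine mem_relBoundaries.mpr ⟨_, neg_mem m1, _, sub_mem m2 m3, ?_⟩
  rw [map_neg, key]
  abel

variable {E : Type*} [NormedAddCommGroup E] [NormedSpace ℝ E]

theorem acyclic_closedBall_singleton {p : E} (hp : p ∈ closedBall (0 : E) 1) :
    Acyclic (closedBall (0 : E) 1) {p} := by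
  refine acyclic_of_homotopy (singleton_subset_iff.mpr hp)
    (fun q => (1 - q.2) • q.1 + q.2 • p) (by fun_prop) (fun x _ => by simp) (fun x _ => by simp)
    (fun x hx t ht => convex_closedBall _ _ hx hp (by linarith [ht.2]) ht.1 (by ring)) ?_
  rintro x rfl t -
  rw [← add_smul, sub_add_cancel, one_smul]
  rfl

theorem neg_ne_self_of_norm_eq_one {y : E} (hy : ‖y‖ = 1) : -y ≠ y := by
  intro h
  have h0 : (2 : ℝ) • y = 0 := by
    rw [two_smul]
    nth_rewrite 1 [← h]
    exact neg_add_cancel y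
  rw [(smul_eq_zero.mp h0).resolve_left two_ne_zero, norm_zero] at hy
  exact zero_ne_one hy

/-- Passing through zero would force `t = 1 / 2` by comparison of norms, and then `x = y`. -/
theorem segment_neg_ne_zero {x y : E} (hx : ‖x‖ = 1) (hy : ‖y‖ = 1) (hxy : x ≠ y) {t : ℝ}
    (ht : t ∈ Icc (0 : ℝ) 1) : (1 - t) • x + t • -y ≠ 0 := by
  intro h
  rw [smul_neg, ← sub_eq_add_neg, sub_eq_zero] at h
  have hn := congrArg norm h
  rw [norm_smul, norm_smul, hx, hy, mul_one, mul_one, Real.norm_of_nonneg ht.1,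
    Real.norm_of_nonneg (by linarith [ht.2])] at hn
  have ht' : t = 1 / 2 := by linarith
  rw [ht'] at h
  norm_num at h
  exact hxy h

/-- The normalised straight-line homotopy to the antipode of the missing point. No inner product is
used, so the argument covers the sup norm. -/
theorem acyclic_sphere_diff {y : E} (hy : y ∈ sphere (0 : E) 1) :
    Acyclic (sphere (0 : E) 1 \ {y}) {-y} := by
  have hy' : ‖y‖ = 1 := by simpa using hy
  have hyy := neg_ne_self_of_norm_eq_one hy'
  have hneg : -y ∈ sphere (0 : E) 1 \ {y} := ⟨by simpa using hy', hyy⟩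
  let f : E × ℝ → E := fun q => (1 - q.2) • q.1 + q.2 • -y
  have hf : Continuous f := by fun_prop
  have hf0 : ∀ x ∈ sphere (0 : E) 1 \ {y}, ∀ t ∈ Icc (0 : ℝ) 1, f (x, t) ≠ 0 :=
    fun x hx t ht => segment_neg_ne_zero (by simpa using hx.1) hy' hx.2 ht
  refine acyclic_of_homotopy (singleton_subset_iff.mpr hneg) (fun q => ‖f q‖⁻¹ • f q) ?_ ?_ ?_ ?_ ?_
  · refine (hf.norm.continuousOn.inv₀ ?_).smul hf.continuousOn
    rintro ⟨x, t⟩ ⟨hx, ht⟩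
    exact norm_ne_zero_iff.mpr (hf0 x hx t ht)
  · rintro x ⟨hx, -⟩
    have : ‖x‖ = 1 := by simpa using hx
    simp [f, this]
  · rintro x -
    simp [f, hy']
  · intro x hx t ht
    have h0 := norm_ne_zero_iff.mpr (hf0 x hx t ht)
    refine ⟨?_, fun h => ?_⟩
    · rw [mem_sphere_zero_iff_norm, norm_smul, norm_inv, norm_norm, inv_mul_cancel₀ h0]
    · have h' : ‖f (x, t)‖⁻¹ • f (x, t) = y := h
      have hxn : ‖x‖ = 1 := by simpa using hx.1
      -- If the normalised path met `y`, then `x` and `y` would be proportional with the nonnegative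
      -- factors `1 - t` and `‖f (x, t)‖ + t`; unit norms make the factors equal and positive, so `x
      -- = y`.
      have e : (1 - t) • x = (‖f (x, t)‖ + t) • y := by
        rw [add_smul]
        conv_rhs => rw [← h', smul_smul, mul_inv_cancel₀ h0, one_smul, h']
        simp [f]
      have hn := congrArg norm e
      rw [norm_smul, norm_smul, hxn, hy', mul_one, mul_one, Real.norm_of_nonneg
        (by linarith [ht.2]), Real.norm_of_nonneg (add_nonneg (norm_nonneg _) ht.1)] at hn
      rw [← hn] at e
      have hpos : 0 < ‖f (x, t)‖ := lt_of_le_of_ne (norm_nonneg _) (Ne.symm h0)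
      exact hx.2 (smul_right_injective E (show (1 - t) ≠ 0 by linarith [ht.1]) e)
  · rintro x hx t -
    rw [mem_singleton_iff] at hx ⊢
    subst hx
    have : f (-y, t) = -y := by
      simp only [f]
      rw [← add_smul, sub_add_cancel, one_smul]
    rw [this, norm_neg, hy', inv_one, one_smul]

/-- The ball and the punctured sphere both contract to the antipode `-y`. -/
theorem acyclic_closedBall_sphere_diff {y : E} (hy : y ∈ sphere (0 : E) 1) :
    Acyclic (closedBall (0 : E) 1) (sphere (0 : E) 1 \ {y}) := by
  have hy' : ‖y‖ = 1 := by simpa using hy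
  have hyy := neg_ne_self_of_norm_eq_one hy'
  exact (acyclic_closedBall_singleton (p := -y) (by simp [hy'])).of_acyclic
    (acyclic_sphere_diff hy) (singleton_subset_iff.mpr ⟨by simpa using hy', hyy⟩)
    (sdiff_subset.trans sphere_subset_closedBall)

end Homotopy

/-! ### Local homology at the centre of an embedded ball -/

section Ball

variable {E : Type*} [NormedAddCommGroup E] [NormedSpace ℝ E]

/-- The radial deformation of a punctured ball onto its boundary sphere. -/
def radial (q : E × ℝ) : E := ((1 - q.2) + q.2 / ‖q.1‖) • q.1

theorem norm_radial {v : E} (hv : v ≠ 0) {t : ℝ} (ht : t ∈ Icc (0 : ℝ) 1) :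
    ‖radial (v, t)‖ = (1 - t) * ‖v‖ + t := by
  have hv' : 0 < ‖v‖ := norm_pos_iff.mpr hv
  have : 0 ≤ (1 - t) + t / ‖v‖ := add_nonneg (by linarith [ht.2]) (div_nonneg ht.1 hv'.le)
  rw [radial, norm_smul, Real.norm_of_nonneg this, add_mul, div_mul_cancel₀ _ hv'.ne']

theorem radial_mem {v : E} (hv : v ≠ 0) (hv1 : v ∈ closedBall (0 : E) 1) {t : ℝ}
    (ht : t ∈ Icc (0 : ℝ) 1) : radial (v, t) ∈ closedBall (0 : E) 1 ∧ radial (v, t) ≠ 0 := by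
  have hv' : 0 < ‖v‖ := norm_pos_iff.mpr hv
  rw [mem_closedBall_zero_iff] at hv1
  rw [mem_closedBall_zero_iff, ← norm_ne_zero_iff, norm_radial hv ht]
  have h1 := mul_le_mul_of_nonneg_left hv1 (show 0 ≤ 1 - t by linarith [ht.2])
  refine ⟨by linarith, ne_of_gt ?_⟩
  rcases eq_or_lt_of_le ht.1 with h | h
  · rw [← h]; simpa using hv'
  · have := mul_nonneg (show 0 ≤ 1 - t by linarith [ht.2]) hv'.le
    linarith

theorem continuousOn_radial : ContinuousOn (radial : E × ℝ → E) ({0}ᶜ ×ˢ univ) := by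
  refine ContinuousOn.smul (((continuous_const.sub continuous_snd).continuousOn).add
    (continuous_snd.continuousOn.div continuous_fst.norm.continuousOn ?_))
    continuous_fst.continuousOn
  rintro ⟨v, t⟩ ⟨hv, -⟩
  exact norm_ne_zero_iff.mpr hv

variable {X : Type*} [TopologicalSpace X] [T2Space X] [FiniteDimensional ℝ E] {g : E → X}

/-- A continuous injection from a compact set to a Hausdorff space is closed onto its image. -/
theorem continuousOn_invFunOn_of_isCompact {Z : Type*} [TopologicalSpace Z] [Nonempty Z]
    {f : Z → X} {K : Set Z} (hK : IsCompact K) (hf : ContinuousOn f K) (hi : InjOn f K) :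
    ContinuousOn (Function.invFunOn f K) (f '' K) := by
  rw [continuousOn_iff_isClosed]
  intro t ht
  refine ⟨f '' (K ∩ t), ((hK.inter_right ht).image_of_continuousOn
    (hf.mono inter_subset_left)).isClosed, ?_⟩
  ext x
  constructor
  · rintro ⟨hx, v, hv, rfl⟩
    rw [mem_preimage, hi.leftInvOn_invFunOn hv] at hx
    exact ⟨⟨v, ⟨hv, hx⟩, rfl⟩, v, hv, rfl⟩
  · rintro ⟨⟨v, ⟨hv, hvt⟩, rfl⟩, hx⟩
    refine ⟨?_, hx⟩
    rw [mem_preimage, hi.leftInvOn_invFunOn hv]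
    exact hvt

/-- If `A` is closed and meets an embedded closed ball exactly in its boundary sphere, then the
union of `A` and the ball deforms onto `A` after removal of the centre of the ball. -/
theorem acyclic_union_ball_diff (hg : ContinuousOn g (closedBall 0 1))
    (hi : InjOn g (closedBall 0 1)) {A : Set X} (hA : IsClosed A) (hgA : g '' sphere 0 1 ⊆ A)
    (hAg : A ∩ g '' closedBall 0 1 ⊆ g '' sphere 0 1) :
    Acyclic ((A ∪ g '' closedBall 0 1) \ {g 0}) A := by
  classical
  set K := g '' closedBall 0 1 with hKdef
  have hcpt : IsCompact (closedBall (0 : E) 1) := isCompact_closedBall 0 1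
  have hK : IsClosed K := (hcpt.image_of_continuousOn hg).isClosed
  have hleft := hi.leftInvOn_invFunOn
  have hinv := continuousOn_invFunOn_of_isCompact hcpt hg hi
  set r := Function.invFunOn g (closedBall 0 1)
  have h0 : (0 : E) ∈ closedBall 0 1 := mem_closedBall_self zero_le_one
  have hxA : g 0 ∉ A := fun h => by
    obtain ⟨v, hv, e⟩ := hAg ⟨h, 0, h0, rfl⟩
    rw [hi (sphere_subset_closedBall hv) h0 e] at hv
    simp at hv
  have hAx : A ⊆ (A ∪ K) \ {g 0} := fun x hx => ⟨Or.inl hx, fun h => hxA (h ▸ hx)⟩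
  -- The radial deformation transported by `g` on the ball and the identity off it; the two
  -- prescriptions agree on `A ∩ K`, which lies in the sphere, where the radial deformation is
  -- constant.
  let H : X × ℝ → X := fun q => if q.1 ∈ K then g (radial (r q.1, q.2)) else q.1
  have hHK : ∀ v ∈ closedBall (0 : E) 1, ∀ t, H (g v, t) = g (radial (v, t)) := fun v hv t => by
    have : g v ∈ K := ⟨v, hv, rfl⟩
    simp only [H, if_pos this, hleft hv]
  have hHA : ∀ x ∈ A, ∀ t, H (x, t) = x := fun x hx t => by
    by_cases hxK : x ∈ K
    · obtain ⟨v, hv, rfl⟩ := hAg ⟨hx, hxK⟩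
      have hv' : ‖v‖ = 1 := by simpa using hv
      rw [hHK v (sphere_subset_closedBall hv), radial, hv', div_one, sub_add_cancel, one_smul]
    · simp only [H, if_neg hxK]
  have hne : ∀ v ∈ closedBall (0 : E) 1, g v ≠ g 0 → v ≠ 0 := fun v _ h e => h (by rw [e])
  refine acyclic_of_homotopy hAx H ?_ ?_ ?_ ?_ ?_
  · have hcA : ContinuousOn H (A ×ˢ univ) :=
      continuous_fst.continuousOn.congr fun q hq => hHA q.1 hq.1 q.2
    have hcK : ContinuousOn H ((K \ {g 0}) ×ˢ Icc 0 1) := by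
      have h1 : ContinuousOn (fun q : X × ℝ => (r q.1, q.2)) ((K \ {g 0}) ×ˢ Icc 0 1) :=
        ((hinv.mono sdiff_subset).comp continuousOn_fst fun q hq => hq.1).prodMk continuousOn_snd
      have h2 : MapsTo (fun q : X × ℝ => (r q.1, q.2)) ((K \ {g 0}) ×ˢ Icc 0 1)
          ((closedBall 0 1 \ {0}) ×ˢ Icc 0 1) := by
        rintro ⟨_, t⟩ ⟨⟨⟨v, hv, rfl⟩, hx⟩, ht⟩
        refine ⟨?_, ht⟩
        change r (g v) ∈ _
        rw [hleft hv]
        exact ⟨hv, hne v hv hx⟩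
      have h3 : ContinuousOn (fun q => g (radial q)) (((closedBall (0 : E) 1 \ {0}) ×ˢ Icc 0 1)) :=
        hg.comp (continuousOn_radial.mono fun q hq => ⟨hq.1.2, mem_univ _⟩)
          fun q hq => (radial_mem hq.1.2 hq.1.1 hq.2).1
      refine (h3.comp h1 h2).congr ?_
      rintro ⟨x, t⟩ ⟨hx, -⟩
      simp only [H, if_pos hx.1]
      rfl
    rintro ⟨x, t⟩ ⟨hx, ht⟩
    have hsub : ((A ∪ K) \ {g 0}) ×ˢ Icc (0 : ℝ) 1 ⊆
        A ×ˢ univ ∪ (K \ {g 0}) ×ˢ Icc (0 : ℝ) 1 := by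
      rintro ⟨x, t⟩ ⟨⟨hx | hx, hx'⟩, ht⟩
      · exact Or.inl ⟨hx, mem_univ _⟩
      · exact Or.inr ⟨⟨hx, hx'⟩, ht⟩
    -- Pasting along two pieces: as `A` and `K` are closed, a piece imposes no condition at points
    -- outside its closed set.
    refine ContinuousWithinAt.mono (ContinuousWithinAt.union ?_ ?_) hsub
    · by_cases hxA : x ∈ A
      · exact hcA (x, t) ⟨hxA, mem_univ _⟩
      · refine continuousWithinAt_of_notMem_closure fun h => hxA ?_
        exact ((hA.prod isClosed_univ).closure_subset h).1
    · by_cases hxK : x ∈ K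
      · exact hcK (x, t) ⟨⟨hxK, hx.2⟩, ht⟩
      · refine continuousWithinAt_of_notMem_closure fun h => hxK ?_
        exact ((hK.prod isClosed_univ).closure_subset
          (closure_mono (prod_mono sdiff_subset (subset_univ _)) h)).1
  · rintro x ⟨hx | ⟨v, hv, rfl⟩, hx'⟩
    · exact hHA x hx 0
    · rw [hHK v hv, radial, sub_zero, zero_div, add_zero, one_smul]
  · rintro x ⟨hx | ⟨v, hv, rfl⟩, hx'⟩
    · rw [hHA x hx]; exact hx
    · rw [hHK v hv]
      refine hgA ⟨_, ?_, rfl⟩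
      rw [mem_sphere_zero_iff_norm, norm_radial (hne v hv hx') ⟨zero_le_one, le_rfl⟩, sub_self,
        zero_mul, zero_add]
  · rintro x ⟨hx | ⟨v, hv, rfl⟩, hx'⟩ t ht
    · rw [hHA x hx]; exact hAx hx
    · rw [hHK v hv]
      have h := radial_mem (hne v hv hx') hv ht
      exact ⟨Or.inr ⟨_, h.1, rfl⟩, fun e => h.2 (hi h.1 h0 e)⟩
  · intro x hx t _
    rw [hHA x hx]; exact hx

theorem image_ball_eq_diff {E X : Type*} [NormedAddCommGroup E] {g : E → X}
    (hi : InjOn g (closedBall 0 1)) :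
    g '' ball 0 1 = g '' closedBall 0 1 \ g '' sphere 0 1 := by
  rw [← hi.image_sdiff_subset sphere_subset_closedBall, closedBall_sdiff_sphere]

/-- If an embedded closed ball is contained in `B` and its interior is relatively open in `B`, the
homology of the ball modulo its boundary is the local homology of `B` at the centre. -/
theorem relIso_ball (hg : ContinuousOn g (closedBall 0 1)) (hi : InjOn g (closedBall 0 1))
    {B W : Set X} (hB : g '' closedBall 0 1 ⊆ B) (hW : IsOpen W) (hBW : B ∩ W = g '' ball 0 1) :
    RelIso (g '' closedBall 0 1) (g '' sphere 0 1) B (B \ {g 0}) := by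
  set K := g '' closedBall 0 1 with hKdef
  have hF : IsClosed (g '' sphere 0 1) := ((isCompact_sphere (0 : E) 1).image_of_continuousOn
    (hg.mono sphere_subset_closedBall)).isClosed
  have hFK : g '' sphere 0 1 ⊆ K := image_mono sphere_subset_closedBall
  have hOK : g '' ball 0 1 ⊆ K := image_mono ball_subset_closedBall
  have h0O : g 0 ∈ g '' ball 0 1 := ⟨0, mem_ball_self zero_lt_one, rfl⟩
  have hF0 : g 0 ∉ g '' sphere 0 1 := by
    rw [image_ball_eq_diff hi] at h0O
    exact h0O.2
  -- With `A` the sphere itself: the punctured ball deforms onto its boundary.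
  have hac := acyclic_union_ball_diff hg hi hF le_rfl inter_subset_left
  rw [union_eq_self_of_subset_left hFK] at hac
  have h1 := hac.relIso (B := K) sdiff_subset
  -- Both the ball and the whole of `B` are compared by excision with the open ball, whose openness
  -- relative to `B` enters here.
  have excise {C : Set X} (hC : K ⊆ C) (hCB : C ⊆ B) :
      RelIso (g '' ball 0 1) (g '' ball 0 1 \ {g 0}) C (C \ {g 0}) := by
    have hU : g '' ball 0 1 ∪ C \ {g 0} = C := by
      refine subset_antisymm (union_subset (hOK.trans hC) sdiff_subset) fun x hx => ?_
      by_cases h : x = g 0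
      · exact Or.inl (h ▸ h0O)
      · exact Or.inr ⟨hx, h⟩
    have hI : (g '' ball 0 1) ∩ (C \ {g 0}) = (g '' ball 0 1) \ {g 0} := by
      rw [← inter_sdiff_assoc, inter_eq_left.mpr (hOK.trans hC)]
    have := relIso_excision (U := g '' ball 0 1) (V := C \ {g 0}) hW
      (isOpen_compl_singleton (x := g 0)) ?_ ?_ ?_
    · rwa [hU, hI] at this
    · rw [hU]
      intro x hx
      by_cases h : x = g 0
      · exact Or.inl (hBW.symm ▸ (h ▸ h0O : x ∈ g '' ball 0 1) : x ∈ B ∩ W).2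
      · exact Or.inr h
    · rw [hU]
      exact fun x hx => hBW ▸ (⟨hCB hx.1, hx.2⟩ : x ∈ B ∩ W)
    · rw [hU]
      exact fun x hx => ⟨hx.1, hx.2⟩
  refine h1.trans ((excise le_rfl hB).of_trans_left (excise hB le_rfl) ?_ hOK ?_ hB) ?_ le_rfl ?_ hB
  · exact sdiff_subset_sdiff_left hOK
  · exact sdiff_subset_sdiff_left hB
  · exact fun x hx => ⟨hFK hx, fun h => hF0 (h ▸ hx)⟩
  · exact sdiff_subset_sdiff_left hB

end Ball

end Chains

end

noncomputable section

namespace Chains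

/-! ### Generators of the homology of a ball modulo its sphere -/

section Generators

variable {X : Type*} [TopologicalSpace X] {Y : Type*} [TopologicalSpace Y]

theorem IsGen.exists_comap {f : C(X, Y)} (hf : IsEmbedding f) {B A : Set X} {y : SChain Y}
    (hy : IsGen y (f '' B) (f '' A)) : ∃ z, Chains.smap f z = y ∧ IsGen z B A := by
  obtain ⟨z, hz, rfl⟩ := exists_smap_of_mem_relCycles hf hy.mem
  refine ⟨z, rfl, hz, fun w hw => ?_, fun k hk => ?_⟩
  · obtain ⟨k, hk⟩ := hy.exists_smul _ (smap_mem_relCycles (mapsTo_image f A) (mapsTo_image f B) hw)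
    rw [← map_smul, ← map_sub, smap_mem_relBoundaries_iff hf] at hk
    exact ⟨k, hk⟩
  · refine hy.eq_zero k ?_
    rw [← map_smul, smap_mem_relBoundaries_iff hf]
    exact hk

theorem Acyclic.comap {f : C(X, Y)} (hf : IsEmbedding f) {B A : Set X}
    (h : Acyclic (f '' B) (f '' A)) : Acyclic B A := fun _ hz =>
  (smap_mem_relBoundaries_iff hf).mp
    (h (smap_mem_relCycles (mapsTo_image f A) (mapsTo_image f B) hz))

variable {E : Type*} [NormedAddCommGroup E] {g : E → X}

/-- The restriction of a map to the closed unit ball. -/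
def ballMap (g : E → X) (hg : ContinuousOn g (closedBall 0 1)) : C(closedBall (0 : E) 1, X) :=
  ⟨(closedBall 0 1).domRestrict g, hg.domRestrict⟩

/-- The inclusion of the closed unit ball. -/
def ballIncl (E : Type*) [NormedAddCommGroup E] : C(closedBall (0 : E) 1, E) :=
  ⟨Subtype.val, continuous_subtype_val⟩

theorem ballMap_image (hg : ContinuousOn g (closedBall 0 1)) {S : Set E}
    (hS : S ⊆ closedBall 0 1) : ballMap g hg '' (ballIncl E ⁻¹' S) = g '' S := by
  ext x
  constructor
  · rintro ⟨v, hv, rfl⟩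
    exact ⟨v, hv, rfl⟩
  · rintro ⟨v, hv, rfl⟩
    exact ⟨⟨v, hS hv⟩, hv, rfl⟩

theorem ballIncl_image {S : Set E} (hS : S ⊆ closedBall 0 1) :
    ballIncl E '' (ballIncl E ⁻¹' S) = S := by
  rw [image_preimage_eq_inter_range, inter_eq_left]
  exact fun v hv => ⟨⟨v, hS hv⟩, rfl⟩

variable [NormedSpace ℝ E] [FiniteDimensional ℝ E] [T2Space X]

theorem isEmbedding_ballMap (hg : ContinuousOn g (closedBall 0 1))
    (hi : InjOn g (closedBall 0 1)) : IsEmbedding (ballMap g hg) :=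
  haveI : CompactSpace (closedBall (0 : E) 1) :=
    isCompact_iff_compactSpace.mp (isCompact_closedBall 0 1)
  (Continuous.isClosedEmbedding (ballMap g hg).continuous
    (injOn_iff_injective.mp hi)).isEmbedding

/-- As `g` is controlled only on the closed ball, the generator is lifted to that subspace, where
`g` restricts to an embedding, and then pushed forward. -/
theorem IsGen.exists_image_ball (hg : ContinuousOn g (closedBall 0 1))
    (hi : InjOn g (closedBall 0 1)) {n : ℕ} {B A : Set E} (hB : B ⊆ closedBall 0 1)
    (hA : A ⊆ closedBall 0 1) {z : SChain E} (hn : sdeg n z = z) (hz : IsGen z B A) :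
    ∃ w, sdeg n w = w ∧ IsGen w (g '' B) (g '' A) := by
  have hι : IsEmbedding (ballIncl E) := IsEmbedding.subtypeVal
  rw [← ballIncl_image hB, ← ballIncl_image hA] at hz
  obtain ⟨w, rfl, hw⟩ := hz.exists_comap hι
  rw [sdeg, degreePart_push] at hn
  have hn := smap_injective hι.injective hn
  refine ⟨Chains.smap (ballMap g hg) w, ?_, ?_⟩
  · rw [sdeg, degreePart_push, hn]
  · have := hw.smap (isEmbedding_ballMap hg hi)
    rwa [ballMap_image hg hB, ballMap_image hg hA] at this

theorem Acyclic.image_ball (hg : ContinuousOn g (closedBall 0 1))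
    (hi : InjOn g (closedBall 0 1)) {B A : Set E} (hB : B ⊆ closedBall 0 1)
    (hA : A ⊆ closedBall 0 1) (h : Acyclic B A) : Acyclic (g '' B) (g '' A) := by
  have hι : IsEmbedding (ballIncl E) := IsEmbedding.subtypeVal
  rw [← ballIncl_image hB, ← ballIncl_image hA] at h
  have := (h.comap hι).image (isEmbedding_ballMap hg hi)
  rwa [ballMap_image hg hB, ballMap_image hg hA] at this

/-- A point has one singular simplex in each dimension, so its chains are the ordered chains on a
single vertex. Coning contracts these up to the augmentation, which also detects multiples of the
point. -/
theorem exists_isGen_of_subsingleton (X : Type*) [TopologicalSpace X] [Nonempty X]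
    [Subsingleton X] : ∃ z : SChain X, sdeg 0 z = z ∧ IsGen z univ ∅ := by
  let p : X := Classical.arbitrary X
  let φ : OChain Unit →ₗ[ℤ] SChain X :=
    push (T := OSimplex Unit) (T' := SSimplex X) fun _ _ => ContinuousMap.const _ p
  let ψ : SChain X →ₗ[ℤ] OChain Unit :=
    push (T := SSimplex X) (T' := OSimplex Unit) fun _ _ _ => ()
  have hφ (x) : sd (φ x) = φ (od x) := bdry_push (T := OSimplex Unit) (T' := SSimplex X)
    (δ := fun _ i v => v ∘ i.succAbove) (δ' := fun _ i σ => σ.comp (simplexMap i.succAbove))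
    (fun _ _ => ContinuousMap.const _ p) (fun _ _ _ => rfl) x
  have hψ (x) : od (ψ x) = ψ (sd x) := bdry_push (T := SSimplex X) (T' := OSimplex Unit)
    (δ' := fun _ i v => v ∘ i.succAbove) (δ := fun _ i σ => σ.comp (simplexMap i.succAbove))
    (fun _ _ _ => ()) (fun _ _ _ => rfl) x
  have hφψ (x) : φ (ψ x) = x := by
    have : φ ∘ₗ ψ = LinearMap.id := schain_ext fun n σ => by
      rw [LinearMap.comp_apply, LinearMap.id_apply]
      simp only [φ, ψ, push_single]
      congr 2
      ext1 t
      exact Subsingleton.elim _ _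
    rw [← LinearMap.comp_apply, this, LinearMap.id_apply]
  let pt : OChain Unit := osimp fun _ : Fin 1 => ()
  refine ⟨φ pt, ?_, ?_, ?_, ?_⟩
  · simp only [φ, pt, push_single]
    exact degreePart_single_self (T := SSimplex X) 0 _
  · refine mem_relCycles.mpr ⟨mem_chainsIn_univ _, ?_⟩
    rw [hφ, bdry_single_zero, map_zero]
    exact zero_mem _
  · intro w hw
    have h0 : sd w = 0 := eq_zero_of_mem_chainsIn_empty (mem_relCycles.mp hw).2
    refine ⟨aug Unit (ψ w), mem_relBoundaries.mpr ⟨φ (cone () (ψ w)), mem_chainsIn_univ _, 0,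
      zero_mem _, ?_⟩⟩
    rw [hφ, od_cone, hψ, h0, map_zero, map_zero, sub_zero, map_sub, map_smul, hφψ, add_zero]
  · intro k hk
    obtain ⟨b, -, a, ha, e⟩ := mem_relBoundaries.mp hk
    rw [eq_zero_of_mem_chainsIn_empty ha, add_zero] at e
    have h1 := congrArg (fun x => aug Unit (ψ x)) e
    simp only [← hψ, aug_od, map_smul] at h1
    have h2 : aug Unit (ψ (φ pt)) = 1 := by
      simp only [φ, ψ, pt, push_single]
      rw [aug_osimp, if_pos rfl]
    rw [h2] at h1
    simpa using h1.symm

/-- The homology of the `n`-ball modulo its boundary is infinite cyclic, in degree `n`. -/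
theorem exists_isGen_closedBall (n : ℕ) : ∃ z : SChain (Fin n → ℝ), sdeg n z = z ∧
    IsGen z (closedBall (0 : Fin n → ℝ) 1) (sphere 0 1) := by
  induction n with
  | zero =>
    obtain ⟨z, hz, hgen⟩ := exists_isGen_of_subsingleton (Fin 0 → ℝ)
    refine ⟨z, hz, ?_⟩
    have h1 : closedBall (0 : Fin 0 → ℝ) 1 = univ :=
      eq_univ_of_forall fun x => by simp [Subsingleton.elim x 0]
    have h2 : sphere (0 : Fin 0 → ℝ) 1 = ∅ :=
      eq_empty_of_forall_notMem fun x hx => by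
      rw [mem_sphere_zero_iff_norm, Subsingleton.elim x 0, norm_zero] at hx
      exact zero_ne_one hx
    rwa [h1, h2]
  | succ n ih =>
    obtain ⟨z, hz, hgen⟩ := ih
    -- In the sup norm the unit sphere bounds a cube; its facet with first coordinate 1 is an
    -- embedded ball of dimension `n`.
    let g : (Fin n → ℝ) → (Fin (n + 1) → ℝ) := fun v => Fin.cons 1 v
    have hgc : Continuous g := continuous_pi fun i => by
      refine Fin.cases ?_ (fun i => ?_) i
      · exact continuous_const
      · exact continuous_apply i
    have hi : Function.Injective g := Fin.cons_right_injective (α := fun _ => ℝ) 1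
    have hnorm : ∀ v ∈ closedBall (0 : Fin n → ℝ) 1, g v ∈ sphere (0 : Fin (n + 1) → ℝ) 1 := by
      intro v hv
      rw [mem_closedBall_zero_iff] at hv
      rw [mem_sphere_zero_iff_norm]
      refine le_antisymm ((pi_norm_le_iff_of_nonneg zero_le_one).mpr fun i => ?_) ?_
      · refine Fin.cases ?_ (fun i => ?_) i
        · simp [g]
        · exact (norm_le_pi_norm v i).trans hv
      · simpa [g] using norm_le_pi_norm (g v) 0
    have hsub : g '' closedBall 0 1 ⊆ sphere 0 1 := by
      rintro _ ⟨v, hv, rfl⟩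
      exact hnorm v hv
    -- Positivity of the first coordinate excludes the opposite facet, and the bound on the others
    -- leaves only the interior of the chosen one.
    let W : Set (Fin (n + 1) → ℝ) := {v | 0 < v 0} ∩ {v | ‖Fin.tail v‖ < 1}
    have hW : IsOpen W := by
      refine (isOpen_lt continuous_const (continuous_apply 0)).inter
        (isOpen_lt (Continuous.norm ?_) continuous_const)
      exact continuous_pi fun i => continuous_apply i.succ
    have hSW : sphere 0 1 ∩ W = g '' ball 0 1 := by
      ext v
      constructor
      · rintro ⟨hv, hv0, hv1⟩
        rw [mem_sphere_zero_iff_norm] at hv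
        refine ⟨Fin.tail v, by simpa using hv1, ?_⟩
        have h0 : v 0 = 1 := by
          have hle : v 0 ≤ 1 := (le_abs_self _).trans ((norm_le_pi_norm v 0).trans hv.le)
          by_contra hne
          have hlt : ‖v‖ < 1 := (pi_norm_lt_iff zero_lt_one).mpr fun i => by
            refine Fin.cases ?_ (fun i => ?_) i
            · rw [Real.norm_of_nonneg (le_of_lt hv0)]
              exact lt_of_le_of_ne hle hne
            · exact (norm_le_pi_norm (Fin.tail v) i).trans_lt hv1
          exact hlt.ne hv
        change Fin.cons 1 (Fin.tail v) = v
        rw [← h0, Fin.cons_self_tail]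
      · rintro ⟨v, hv, rfl⟩
        refine ⟨hnorm v (ball_subset_closedBall hv), ?_, ?_⟩
        · simp [g]
        · simpa [g] using hv
    obtain ⟨w, hw, hgenw⟩ := hgen.exists_image_ball hgc.continuousOn hi.injOn le_rfl
      sphere_subset_closedBall hz
    have hiso := relIso_ball hgc.continuousOn hi.injOn hsub hW hSW
    have hg0 := hnorm 0 (mem_closedBall_self zero_le_one)
    -- The facet's generator becomes one for the sphere modulo the complement of the facet's centre,
    -- and the inverse connecting map carries it to the ball modulo the sphere.
    refine (hgenw.of_relIso hiso ?_ hsub).exists_of_acyclic hw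
      (acyclic_closedBall_sphere_diff hg0) sdiff_subset sphere_subset_closedBall
    rintro _ ⟨v, hv, rfl⟩
    refine ⟨hnorm v (sphere_subset_closedBall hv), fun h => ?_⟩
    rw [hi h] at hv
    simp at hv

variable {n m : ℕ} {f : (Fin n → ℝ) → X} {h : (Fin m → ℝ) → X}

theorem exists_isGen_ball (hf : ContinuousOn f (closedBall 0 1)) (hi : InjOn f (closedBall 0 1)) :
    ∃ z : SChain X, sdeg n z = z ∧ IsGen z (f '' closedBall 0 1) (f '' sphere 0 1) := by
  obtain ⟨z, hz, hgen⟩ := exists_isGen_closedBall n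
  exact hgen.exists_image_ball hf hi le_rfl sphere_subset_closedBall hz

theorem acyclic_ball_sphere_diff (hf : ContinuousOn f (closedBall 0 1))
    (hi : InjOn f (closedBall 0 1)) {x : X} (hx : x ∈ f '' sphere 0 1) :
    Acyclic (f '' closedBall 0 1) (f '' sphere 0 1 \ {x}) := by
  obtain ⟨y, hy, rfl⟩ := hx
  have := (acyclic_closedBall_sphere_diff hy).image_ball hf hi le_rfl
    (sdiff_subset.trans sphere_subset_closedBall)
  rwa [InjOn.image_sdiff_subset (hi.mono sphere_subset_closedBall) (singleton_subset_iff.mpr hy),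
    image_singleton] at this

end Generators

end Chains

end

noncomputable section

open PairHomology

/-! ### Homology classes of elements -/

namespace Chains

section Classes

variable {K L : ChainComplex (ModuleCat.{u} ℤ) ℕ} {n : ℕ}

/-- The homology class `ξ` is represented by the cycle `x`. -/
def IsClass (ξ : K.homology n) (x : K.X n) : Prop :=
  ∃ c : K.cycles n, K.iCycles n c = x ∧ K.homologyπ n c = ξ

theorem exists_isClass (ξ : K.homology n) : ∃ x, IsClass ξ x := by
  obtain ⟨c, hc⟩ := (ModuleCat.epi_iff_surjective (K.homologyπ n)).mp inferInstance ξ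
  exact ⟨_, c, rfl, hc⟩

theorem iCycles_injective (K : ChainComplex (ModuleCat.{u} ℤ) ℕ) (n : ℕ) :
    Function.Injective (K.iCycles n) :=
  (ModuleCat.mono_iff_injective (K.iCycles n)).mp inferInstance

theorem exists_class_of_d_eq_zero {x : K.X n}
    (hx : K.d n ((ComplexShape.down ℕ).next n) x = 0) : ∃ ξ : K.homology n, IsClass ξ x := by
  -- An element is treated as a morphism from ℤ, so that it can be lifted to cycles.
  let f : ModuleCat.of ℤ (ULift.{u} ℤ) ⟶ K.X n := ModuleCat.ofHom
    { toFun := fun r => r.down • x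
      map_add' := fun r s => add_zsmul x r.down s.down
      map_smul' := fun r s => (mul_zsmul x r s.down).trans
        (int_smul_eq_zsmul (K.X n).isModule r (s.down • x)).symm }
  have hf1 : f (ULift.up 1) = x := one_smul ℤ x
  have hf : f ≫ K.d n ((ComplexShape.down ℕ).next n) = 0 := by
    refine ModuleCat.hom_ext (LinearMap.ext fun r => ?_)
    change K.d n ((ComplexShape.down ℕ).next n) (r.down • x) = 0
    rw [map_zsmul, hx, zsmul_zero]
  refine ⟨K.homologyπ n (K.liftCycles f _ rfl hf (ULift.up 1)), _, ?_, rfl⟩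
  rw [← ModuleCat.comp_apply, HomologicalComplex.liftCycles_i, hf1]

theorem IsClass.d_eq_zero {ξ : K.homology n} {x : K.X n} (h : IsClass ξ x) (m : ℕ) :
    K.d n m x = 0 := by
  obtain ⟨c, rfl, -⟩ := h
  rw [← ModuleCat.comp_apply, HomologicalComplex.iCycles_d]
  rfl

theorem IsClass.unique {ξ ξ' : K.homology n} {x : K.X n} (h : IsClass ξ x) (h' : IsClass ξ' x) :
    ξ = ξ' := by
  obtain ⟨c, rfl, rfl⟩ := h
  obtain ⟨c', e, rfl⟩ := h'
  rw [iCycles_injective K n e]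

theorem IsClass.add {ξ ξ' : K.homology n} {x x' : K.X n} (h : IsClass ξ x) (h' : IsClass ξ' x') :
    IsClass (ξ + ξ') (x + x') := by
  obtain ⟨c, rfl, rfl⟩ := h
  obtain ⟨c', rfl, rfl⟩ := h'
  exact ⟨c + c', map_add _ _ _, map_add _ _ _⟩

theorem IsClass.smul {ξ : K.homology n} {x : K.X n} (h : IsClass ξ x) (k : ℤ) :
    IsClass (k • ξ) (k • x) := by
  obtain ⟨c, rfl, rfl⟩ := h
  exact ⟨k • c, map_zsmul _ _ _, map_zsmul _ _ _⟩

theorem isClass_zero_iff {x : K.X n} : IsClass (0 : K.homology n) x ↔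
    ∃ y, K.d (n + 1) n y = x := by
  have hex : Function.Exact (K.toCycles (n + 1) n) (K.homologyπ n) :=
    (ShortComplex.ShortExact.moduleCat_exact_iff_function_exact
      (ShortComplex.mk _ _ (K.toCycles_comp_homologyπ (n + 1) n))).mp
      (ShortComplex.exact_of_g_is_cokernel _ (K.homologyIsCokernel (n + 1) n (by simp)))
  constructor
  · rintro ⟨c, rfl, hc⟩
    obtain ⟨y, rfl⟩ := (hex c).mp hc
    exact ⟨y, by rw [← ModuleCat.comp_apply, HomologicalComplex.toCycles_i]⟩
  · rintro ⟨y, rfl⟩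
    refine ⟨K.toCycles (n + 1) n y, ?_, (hex _).mpr ⟨y, rfl⟩⟩
    rw [← ModuleCat.comp_apply, HomologicalComplex.toCycles_i]

theorem IsClass.map {ξ : K.homology n} {x : K.X n} (h : IsClass ξ x) (f : K ⟶ L) :
    IsClass (HomologicalComplex.homologyMap f n ξ) (f.f n x) := by
  obtain ⟨c, rfl, rfl⟩ := h
  refine ⟨HomologicalComplex.cyclesMap f n c, ?_, ?_⟩
  · rw [← ModuleCat.comp_apply, ← ModuleCat.comp_apply, HomologicalComplex.cyclesMap_i]
  · rw [← ModuleCat.comp_apply, ← ModuleCat.comp_apply, HomologicalComplex.homologyπ_naturality]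

/-- The snake-lemma recipe on elements: lift the cycle, take its boundary, and pull that back along
the injection. -/
theorem IsClass.delta {S : ShortComplex (ChainComplex (ModuleCat.{u} ℤ) ℕ)} (hS : S.ShortExact)
    {ξ : S.X₃.homology (n + 1)} {x₂ : S.X₂.X (n + 1)} (h : IsClass ξ (S.g.f (n + 1) x₂))
    {x₁ : S.X₁.X n} (hx₁ : S.f.f n x₁ = S.X₂.d (n + 1) n x₂) :
    IsClass (hS.δ (n + 1) n rfl ξ) x₁ := by
  have hmono : ∀ m, Function.Injective (S.f.f m) := fun m => by
    have := hS.mono_f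
    exact (ModuleCat.mono_iff_injective (S.f.f m)).mp inferInstance
  have hd : ∀ m, S.X₁.d n m x₁ = 0 := fun m => hmono m (by
    rw [← ModuleCat.comp_apply, ← S.f.comm, ModuleCat.comp_apply, hx₁, ← ModuleCat.comp_apply,
      S.X₂.d_comp_d, map_zero]
    rfl)
  obtain ⟨η, c₁, hc₁, rfl⟩ := exists_class_of_d_eq_zero (hd _)
  refine ⟨c₁, hc₁, ?_⟩
  obtain ⟨c, hc, rfl⟩ := h
  symm
  refine hS.δ_apply' (n + 1) n rfl (S.X₃.homologyπ (n + 1) c) (S.X₂.pOpcycles (n + 1) x₂) c₁ ?_ ?_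
  · change HomologicalComplex.opcyclesMap S.g (n + 1) (S.X₂.pOpcycles (n + 1) x₂) =
      S.X₃.homologyι (n + 1) (S.X₃.homologyπ (n + 1) c)
    rw [← ModuleCat.comp_apply, ← ModuleCat.comp_apply, HomologicalComplex.p_opcyclesMap,
      HomologicalComplex.homology_π_ι, ModuleCat.comp_apply, ModuleCat.comp_apply, hc]
  · change HomologicalComplex.cyclesMap S.f n c₁ =
      S.X₂.opcyclesToCycles (n + 1) n (S.X₂.pOpcycles (n + 1) x₂)
    apply iCycles_injective
    rw [← ModuleCat.comp_apply, HomologicalComplex.cyclesMap_i, ModuleCat.comp_apply, hc₁, hx₁,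
      ← ModuleCat.comp_apply, ← ModuleCat.comp_apply,
      HomologicalComplex.pOpcycles_opcyclesToCycles_assoc, HomologicalComplex.toCycles_i]

end Classes

end Chains

end

noncomputable section

open PairHomology Opposite Simplicial

/-! ### Comparison with the singular chain complex -/

namespace Chains

section Comparison

variable {X : Type u} [TopologicalSpace X]

/-- The singular simplices of a subspace, as in the singular simplicial set. -/
abbrev SetSimplex (A : Set X) (n : ℕ) : Type u := (TopCat.toSSet.obj (TopCat.of A)) _⦋n⦌

/-- A singular simplex of a subspace, as a singular simplex of the ambient space. -/
def simplexOf {A : Set X} {n : ℕ} (s : SetSimplex A n) : C(Simplex n, X) :=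
  (⟨Subtype.val, continuous_subtype_val⟩ : C(A, X)).comp
    (TopCat.toSSetObjEquiv (TopCat.of A) (op ⦋n⦌) s)

theorem simplexOf_injective {A : Set X} {n : ℕ} :
    Function.Injective (simplexOf : SetSimplex A n → C(Simplex n, X)) := fun s t h => by
  refine (TopCat.toSSetObjEquiv (TopCat.of A) (op ⦋n⦌)).injective ?_
  ext1 p
  exact Subtype.ext (DFunLike.congr_fun h p)

theorem exists_simplexOf {A : Set X} {n : ℕ} {σ : C(Simplex n, X)} (h : ∀ t, σ t ∈ A) :
    ∃ s : SetSimplex A n, simplexOf s = σ :=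
  ⟨(TopCat.toSSetObjEquiv (TopCat.of A) (op ⦋n⦌)).symm
    ⟨fun t => ⟨σ t, h t⟩, σ.continuous.subtype_mk h⟩, by
      ext1 t
      simp only [simplexOf, Equiv.apply_symm_apply]
      rfl⟩

theorem simplexOf_mem {A : Set X} {n : ℕ} (s : SetSimplex A n) (t : Simplex n) :
    simplexOf s t ∈ A := Subtype.property _

theorem simplexOf_map {A B : Set X} (h : A ⊆ B) {n : ℕ} (s : SetSimplex A n) :
    simplexOf ((TopCat.toSSet.map (inclusionMap h)).app _ s) = simplexOf s := rfl

/-- The inclusion of the summand of the singular chains given by a singular simplex. -/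
def genHom {A : Set X} {n : ℕ} (s : SetSimplex A n) :
    ModuleCat.of ℤ (ULift.{u} ℤ) ⟶ (singularChains A).X n :=
  SSet.ιChainComplex (TopCat.toSSet.obj (TopCat.of A)) s

/-- The generator of the singular chains given by a singular simplex. -/
def gen {A : Set X} {n : ℕ} (s : SetSimplex A n) : (singularChains A).X n :=
  genHom s (ULift.up (1 : ℤ))

theorem genHom_apply_eq {A : Set X} {n : ℕ} {M : ModuleCat.{u} ℤ}
    {f : (singularChains A).X n ⟶ M} {s : SetSimplex A n}
    {g : ModuleCat.of ℤ (ULift.{u} ℤ) ⟶ M} (h : genHom s ≫ f = g) :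
    f (gen s) = g (ULift.up (1 : ℤ)) := by
  rw [gen, ← ModuleCat.comp_apply, h]

theorem ulift_hom_ext {M : ModuleCat.{u} ℤ} {f g : ModuleCat.of ℤ (ULift.{u} ℤ) ⟶ M}
    (h : f (ULift.up (1 : ℤ)) = g (ULift.up (1 : ℤ))) : f = g := by
  refine ModuleCat.hom_ext (LinearMap.ext fun r => ?_)
  have e : r = r.down • (ULift.up 1 : ULift.{u} ℤ) := ULift.ext _ _ (mul_one r.down).symm
  rw [e, map_zsmul, map_zsmul]
  exact congrArg (r.down • ·) h

theorem singularChains_hom_ext {A : Set X} {n : ℕ} {M : ModuleCat.{u} ℤ}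
    {f g : (singularChains A).X n ⟶ M} (h : ∀ s : SetSimplex A n, f (gen s) = g (gen s)) :
    f = g := by
  refine SSet.chainComplex_hom_ext (X := TopCat.toSSet.obj (TopCat.of A)) fun s => ?_
  refine ulift_hom_ext ?_
  exact h s

theorem genHom_d {A : Set X} {n : ℕ} (s : SetSimplex A (n + 1)) :
    genHom s ≫ (singularChains A).d (n + 1) n =
      ∑ i : Fin (n + 2), (-1 : ℤ) ^ (i : ℕ) •
        genHom ((TopCat.toSSet.obj (TopCat.of A)).δ i s) :=
  SSet.ιChainComplex_d _ _ s

theorem genHom_map {A B : Set X} (h : A ⊆ B) {n : ℕ} (s : SetSimplex A n) :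
    genHom s ≫ (singularChainsMap h).f n =
      genHom ((TopCat.toSSet.map (inclusionMap h)).app _ s : SetSimplex B n) :=
  SSet.ι_chainComplexMap_f _ _ (TopCat.toSSet.map (inclusionMap h)) _ s

/-- The morphism from the integers given by an element. -/
def elementHom {M : Type u} [AddCommGroup M] (m : M) :
    ModuleCat.of ℤ (ULift.{u} ℤ) ⟶ ModuleCat.of ℤ M :=
  ModuleCat.ofHom ((LinearMap.toSpanSingleton ℤ M m) ∘ₗ ULift.moduleEquiv.toLinearMap)

theorem elementHom_one {M : Type u} [AddCommGroup M] (m : M) :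
    elementHom m (ULift.up (1 : ℤ)) = m := one_smul ℤ m

/-- The comparison of singular chains of a subspace with singular chains of the ambient space. -/
def toSChain (A : Set X) (n : ℕ) : (singularChains A).X n ⟶ ModuleCat.of ℤ (SChain X) :=
  Limits.Sigma.desc (f := fun _ : SetSimplex A n => ModuleCat.of ℤ (ULift.{u} ℤ)) fun s =>
    elementHom (ssimp (simplexOf s))

theorem genHom_toSChain {A : Set X} {n : ℕ} (s : SetSimplex A n) :
    genHom s ≫ toSChain A n = elementHom (ssimp (simplexOf s)) :=
  Limits.Sigma.ι_desc _ _

theorem toSChain_gen {A : Set X} {n : ℕ} (s : SetSimplex A n) :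
    toSChain A n (gen s) = ssimp (simplexOf s) :=
  (genHom_apply_eq (genHom_toSChain s)).trans (elementHom_one _)

/-- Coordinates of singular chains of a subspace. -/
def coords (A : Set X) (n : ℕ) :
    (singularChains A).X n ⟶ ModuleCat.of ℤ (SetSimplex A n →₀ ℤ) :=
  Limits.Sigma.desc (f := fun _ : SetSimplex A n => ModuleCat.of ℤ (ULift.{u} ℤ)) fun s =>
    elementHom (Finsupp.single s 1)

theorem coords_gen {A : Set X} {n : ℕ} (s : SetSimplex A n) :
    coords A n (gen s) = Finsupp.single s (1 : ℤ) :=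
  (genHom_apply_eq (Limits.Sigma.ι_desc _ _ :
    genHom s ≫ coords A n = elementHom (Finsupp.single s (1 : ℤ)))).trans (elementHom_one _)

/-- The morphism from a free module given by a family of elements. -/
def familyHom {S : Type u} {M : ModuleCat.{u} ℤ} (g : S → M) : ModuleCat.of ℤ (S →₀ ℤ) ⟶ M :=
  ModuleCat.ofHom (@Finsupp.linearCombination S M ℤ _ _ M.isModule g)

theorem familyHom_single {S : Type u} {M : ModuleCat.{u} ℤ} (g : S → M) (s : S) :
    familyHom g (Finsupp.single s (1 : ℤ)) = g s :=
  (@Finsupp.linearCombination_single S M ℤ _ _ M.isModule _ _ _).trans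
    (@one_smul ℤ M _ M.isModule.toMulAction _)

/-- Coordinates in the free module on simplices have the generators as a left inverse, and different
simplices of the subspace stay different in `X`. -/
theorem toSChain_injective (A : Set X) (n : ℕ) : Function.Injective (toSChain A n) := by
  let ψ := familyHom (fun s : SetSimplex A n => gen s)
  let ι : ModuleCat.of ℤ (SetSimplex A n →₀ ℤ) ⟶ ModuleCat.of ℤ (SChain X) :=
    ModuleCat.ofHom (Finsupp.lmapDomain ℤ ℤ fun s => ⟨n, simplexOf s⟩)
  have hι : Function.Injective ι := Finsupp.mapDomain_injective fun s t h =>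
    simplexOf_injective (eq_of_heq (Sigma.mk.inj h).2)
  have h1 : coords A n ≫ ι = toSChain A n := singularChains_hom_ext fun s => by
    rw [ModuleCat.comp_apply, coords_gen, toSChain_gen]
    exact Finsupp.mapDomain_single
  have h2 : coords A n ≫ ψ = 𝟙 _ := singularChains_hom_ext fun s => by
    rw [ModuleCat.comp_apply, coords_gen]
    exact familyHom_single _ s
  intro x y hxy
  rw [← h1, ModuleCat.comp_apply, ModuleCat.comp_apply] at hxy
  have := congrArg ψ (hι hxy)
  rwa [← ModuleCat.comp_apply, ← ModuleCat.comp_apply, h2] at this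

/-- Together with `toSChain_mem` and `sdeg_toSChain`, this identifies the image as the homogeneous
chains supported in `A`. -/
theorem exists_toSChain {A : Set X} {n : ℕ} {z : SChain X} (hz : z ∈ chainsIn A)
    (hn : sdeg n z = z) : ∃ x, toSChain A n x = z := by
  -- Projecting to degree `n` first makes the claim linear in `z`, so it can be checked on simplices
  -- of every dimension.
  suffices h : sdeg n z ∈ LinearMap.range (toSChain A n).hom by rwa [hn] at h
  refine mem_of_ssimp (fun m σ hσ => ?_) hz
  rw [degreePart_single]
  split_ifs with h
  · change m = n at h
    subst h
    obtain ⟨s, rfl⟩ := exists_simplexOf hσ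
    exact ⟨gen s, toSChain_gen s⟩
  · exact zero_mem _

theorem toSChain_mem {A : Set X} {n : ℕ} (x : (singularChains A).X n) :
    toSChain A n x ∈ chainsIn A := by
  have : toSChain A n ≫ ModuleCat.ofHom (chainsIn A).mkQ = 0 := singularChains_hom_ext fun s => by
    rw [ModuleCat.comp_apply, toSChain_gen]
    exact (Submodule.Quotient.mk_eq_zero _).mpr (ssimp_mem (simplexOf_mem s))
  have := DFunLike.congr_fun (congrArg ModuleCat.Hom.hom this) x
  exact (Submodule.Quotient.mk_eq_zero _).mp this

theorem sdeg_toSChain {A : Set X} {n : ℕ} (x : (singularChains A).X n) :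
    sdeg n (toSChain A n x) = toSChain A n x := by
  have : toSChain A n ≫ ModuleCat.ofHom (sdeg n) = toSChain A n :=
    singularChains_hom_ext fun s => by
      rw [ModuleCat.comp_apply, toSChain_gen]
      exact degreePart_single_self (T := SSimplex X) n _
  exact DFunLike.congr_fun (congrArg ModuleCat.Hom.hom this) x

theorem toSChain_d {A : Set X} {n : ℕ} (x : (singularChains A).X (n + 1)) :
    toSChain A n ((singularChains A).d (n + 1) n x) = sd (toSChain A (n + 1) x) := by
  have : (singularChains A).d (n + 1) n ≫ toSChain A n =
      toSChain A (n + 1) ≫ ModuleCat.ofHom sd := singularChains_hom_ext fun s => by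
    have h : genHom s ≫ (singularChains A).d (n + 1) n ≫ toSChain A n = elementHom
        (∑ i : Fin (n + 2), (-1 : ℤ) ^ (i : ℕ) • ssimp ((simplexOf s).comp
          (simplexMap i.succAbove))) := by
      rw [reassoc_of% genHom_d, Preadditive.sum_comp]
      refine ulift_hom_ext ?_
      rw [elementHom_one]
      change ModuleCat.Hom.hom _ _ = _
      rw [ModuleCat.hom_sum, LinearMap.sum_apply]
      refine Finset.sum_congr rfl fun i _ => ?_
      rw [Preadditive.zsmul_comp, genHom_toSChain, ModuleCat.hom_zsmul]
      exact congrArg ((-1 : ℤ) ^ (i : ℕ) • ·)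
        (elementHom_one (ssimp ((simplexOf s).comp (simplexMap i.succAbove))))
    rw [ModuleCat.comp_apply (toSChain A (n + 1)), toSChain_gen, genHom_apply_eq h, elementHom_one]
    exact (sd_ssimp _).symm
  exact DFunLike.congr_fun (congrArg ModuleCat.Hom.hom this) x

theorem toSChain_map {A B : Set X} (h : A ⊆ B) {n : ℕ} (x : (singularChains A).X n) :
    toSChain B n ((singularChainsMap h).f n x) = toSChain A n x := by
  have : (singularChainsMap h).f n ≫ toSChain B n = toSChain A n :=
    singularChains_hom_ext fun s => by
      have h' : genHom s ≫ (singularChainsMap h).f n ≫ toSChain B n =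
          elementHom (ssimp (simplexOf s)) := by
        rw [reassoc_of% genHom_map, genHom_toSChain, simplexOf_map]
      rw [genHom_apply_eq h', toSChain_gen, elementHom_one]
  exact DFunLike.congr_fun (congrArg ModuleCat.Hom.hom this) x

/-! ### Chains representing homology classes -/

variable {n : ℕ} {A B A' B' : Set X}

/-- The singular chain `z` represents the absolute homology class `ξ`. -/
def AbsRep (ξ : absHomology n A) (z : SChain X) : Prop :=
  ∃ x : (singularChains A).X n, toSChain A n x = z ∧ IsClass ξ x

/-- The quotient map from the chains of `B` to the chains of the pair `(B, A)`. -/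
abbrev quot (h : A ⊆ B) : singularChains B ⟶ Limits.cokernel (singularChainsMap h) :=
  Limits.cokernel.π (singularChainsMap h)

/-- The singular chain `z` represents the relative homology class `ξ`. -/
def RelRep {h : A ⊆ B} (ξ : relHomology n h) (z : SChain X) : Prop :=
  ∃ x : (singularChains B).X n, toSChain B n x = z ∧ IsClass ξ ((quot h).f n x)

theorem degreewise_shortExact (h : A ⊆ B) (n : ℕ) :
    ((chainSequence h).map (HomologicalComplex.eval _ _ n)).ShortExact :=
  (chainSequence_shortExact h).map_of_exact _

theorem quot_surjective (h : A ⊆ B) (n : ℕ) : Function.Surjective ((quot h).f n) :=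
  (degreewise_shortExact h n).moduleCat_surjective_g

theorem quot_exact (h : A ⊆ B) (n : ℕ) :
    Function.Exact ((singularChainsMap h).f n) ((quot h).f n) :=
  (ShortComplex.ShortExact.moduleCat_exact_iff_function_exact _).mp
    (degreewise_shortExact h n).exact

/-- Degreewise exactness turns vanishing in the quotient complex into a condition on supports. -/
theorem quot_eq_zero_iff (h : A ⊆ B) {x : (singularChains B).X n} :
    (quot h).f n x = 0 ↔ toSChain B n x ∈ chainsIn A := by
  rw [quot_exact h n x]
  constructor
  · rintro ⟨y, rfl⟩
    rw [toSChain_map]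
    exact toSChain_mem y
  · intro hx
    obtain ⟨y, hy⟩ := exists_toSChain hx (sdeg_toSChain x)
    exact ⟨y, toSChain_injective B n (by rw [toSChain_map, hy])⟩

theorem sd_toSChain_zero (x : (singularChains A).X 0) : sd (toSChain A 0 x) = 0 := by
  rw [← sdeg_toSChain x]
  refine LinearMap.congr_fun (f := sd ∘ₗ sdeg 0) (g := 0) (schain_ext fun m σ => ?_)
    (toSChain A 0 x)
  rw [LinearMap.comp_apply, degreePart_single]
  split_ifs with h
  · change m = 0 at h
    subst h
    exact bdry_single_zero _
  · rw [map_zero, LinearMap.zero_apply]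

theorem quot_d (h : A ⊆ B) (m : ℕ) (x : (singularChains B).X n) :
    (Limits.cokernel (singularChainsMap h)).d n m ((quot h).f n x) =
      (quot h).f m ((singularChains B).d n m x) := by
  rw [← ModuleCat.comp_apply, (quot h).comm, ModuleCat.comp_apply]

theorem RelRep.mem {h : A ⊆ B} {ξ : relHomology n h} {z : SChain X} (hz : RelRep ξ z) :
    z ∈ relCycles B A := by
  obtain ⟨x, rfl, hx⟩ := hz
  refine mem_relCycles.mpr ⟨toSChain_mem x, ?_⟩
  obtain _ | n := n
  · rw [sd_toSChain_zero]; exact zero_mem _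
  · rw [← toSChain_d, ← quot_eq_zero_iff h, ← quot_d]
    exact hx.d_eq_zero n

theorem RelRep.sdeg {h : A ⊆ B} {ξ : relHomology n h} {z : SChain X} (hz : RelRep ξ z) :
    sdeg n z = z := by
  obtain ⟨x, rfl, hx⟩ := hz
  exact sdeg_toSChain x

theorem exists_relRep {h : A ⊆ B} (ξ : relHomology n h) : ∃ z, RelRep ξ z := by
  obtain ⟨y, hy⟩ := exists_isClass ξ
  obtain ⟨x, rfl⟩ := quot_surjective h n y
  exact ⟨_, x, rfl, hy⟩

theorem exists_relRep_of_mem (h : A ⊆ B) {z : SChain X} (hz : z ∈ relCycles B A)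
    (hn : sdeg n z = z) : ∃ ξ : relHomology n h, RelRep ξ z := by
  obtain ⟨x, rfl⟩ := exists_toSChain (mem_relCycles.mp hz).1 hn
  obtain ⟨ξ, hξ⟩ := exists_class_of_d_eq_zero (K := Limits.cokernel (singularChainsMap h))
    (x := (quot h).f n x) (by
      obtain _ | n := n
      · rw [HomologicalComplex.shape _ _ _ (by simp)]; rfl
      · rw [ChainComplex.next_nat_succ, quot_d, quot_eq_zero_iff, toSChain_d]
        exact (mem_relCycles.mp hz).2)
  exact ⟨ξ, x, rfl, hξ⟩

theorem RelRep.add {h : A ⊆ B} {ξ ξ' : relHomology n h} {z z' : SChain X} (hz : RelRep ξ z)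
    (hz' : RelRep ξ' z') : RelRep (ξ + ξ') (z + z') := by
  obtain ⟨x, rfl, hx⟩ := hz
  obtain ⟨x', rfl, hx'⟩ := hz'
  exact ⟨x + x', map_add _ _ _, by rw [map_add]; exact hx.add hx'⟩

theorem RelRep.smul {h : A ⊆ B} {ξ : relHomology n h} {z : SChain X} (hz : RelRep ξ z) (k : ℤ) :
    RelRep (k • ξ) (k • z) := by
  obtain ⟨x, rfl, hx⟩ := hz
  exact ⟨k • x, map_zsmul _ _ _, by rw [map_zsmul]; exact hx.smul k⟩

theorem RelRep.sub {h : A ⊆ B} {ξ ξ' : relHomology n h} {z z' : SChain X} (hz : RelRep ξ z)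
    (hz' : RelRep ξ' z') : RelRep (ξ - ξ') (z - z') := by
  have := hz.add (hz'.smul (-1))
  rwa [neg_one_zsmul, neg_one_zsmul, ← sub_eq_add_neg, ← sub_eq_add_neg] at this

/-- The central entry of the dictionary: equality of homology classes becomes membership in an
explicit submodule. -/
theorem RelRep.eq_zero_iff {h : A ⊆ B} {ξ : relHomology n h} {z : SChain X} (hz : RelRep ξ z) :
    ξ = 0 ↔ z ∈ relBoundaries B A := by
  obtain ⟨x, rfl, hx⟩ := hz
  constructor
  · rintro rfl
    obtain ⟨y, hy⟩ := isClass_zero_iff.mp hx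
    obtain ⟨b, rfl⟩ := quot_surjective h (n + 1) y
    rw [quot_d, ← sub_eq_zero, ← map_sub, quot_eq_zero_iff, map_sub, toSChain_d] at hy
    refine mem_relBoundaries.mpr ⟨_, toSChain_mem b, _, neg_mem hy, ?_⟩
    rw [neg_sub, add_sub_cancel]
  · intro hz
    obtain ⟨b, hb, a, ha, e⟩ := mem_relBoundaries.mp hz
    -- A witness of `relBoundaries` can have parts in every degree; only the homogeneous part
    -- belongs to the complex.
    have e' := congrArg (Chains.sdeg n) e
    rw [map_add, sdeg_sd, sdeg_toSChain] at e'
    obtain ⟨y, hy⟩ := exists_toSChain (Chains.sdeg_mem (n + 1) hb)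
      (degreePart_degreePart_self (T := SSimplex X) _ _)
    refine hx.unique (isClass_zero_iff.mpr ⟨(quot h).f (n + 1) y, ?_⟩)
    rw [quot_d, ← sub_eq_zero, ← map_sub, quot_eq_zero_iff, map_sub, toSChain_d, hy, ← e',
      sub_add_cancel_left]
    exact neg_mem (Chains.sdeg_mem n ha)

theorem RelRep.map {h : A ⊆ B} {ξ : relHomology n h} {z : SChain X} (hz : RelRep ξ z)
    (h' : A' ⊆ B') (hA : A ⊆ A') (hB : B ⊆ B') : RelRep (relMap n h h' hA hB ξ) z := by
  obtain ⟨x, rfl, hx⟩ := hz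
  refine ⟨(singularChainsMap hB).f n x, toSChain_map hB x, ?_⟩
  have := hx.map (Limits.cokernel.map (singularChainsMap h) (singularChainsMap h')
    (singularChainsMap hA) (singularChainsMap hB) (singularChainsMap_comp hA hB h h'))
  have e : (quot h).f n ≫ (Limits.cokernel.map (singularChainsMap h) (singularChainsMap h')
      (singularChainsMap hA) (singularChainsMap hB) (singularChainsMap_comp hA hB h h')).f n =
      (singularChainsMap hB).f n ≫ (quot h').f n := by
    rw [← HomologicalComplex.comp_f, ← HomologicalComplex.comp_f, Limits.cokernel.π_desc]
  rw [← ModuleCat.comp_apply, e, ModuleCat.comp_apply] at this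
  exact this

theorem AbsRep.map {ξ : absHomology n A} {z : SChain X} (hz : AbsRep ξ z) (h : A ⊆ B) :
    AbsRep (absMap n h ξ) z := by
  obtain ⟨x, rfl, hx⟩ := hz
  exact ⟨_, toSChain_map h x, hx.map _⟩

theorem AbsRep.toRel {ξ : absHomology n B} {z : SChain X} (hz : AbsRep ξ z) (h : A ⊆ B) :
    RelRep (toRel n h ξ) z := by
  obtain ⟨x, rfl, hx⟩ := hz
  exact ⟨x, rfl, hx.map _⟩

theorem RelRep.connecting {h : A ⊆ B} {ξ : relHomology (n + 1) h} {z : SChain X}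
    (hz : RelRep ξ z) : AbsRep (connecting n h ξ) (sd z) := by
  have hm := (mem_relCycles.mp hz.mem).2
  obtain ⟨x, rfl, hx⟩ := hz
  obtain ⟨a, ha⟩ := exists_toSChain hm (by rw [← toSChain_d, sdeg_toSChain])
  refine ⟨a, ha, ?_⟩
  refine IsClass.delta (chainSequence_shortExact h) hx (x₁ := a) ?_
  refine toSChain_injective B n ?_
  rw [toSChain_d, ← ha]
  exact toSChain_map h a

end Comparison

end Chains

end

noncomputable section

namespace Chains

open RelCWComplex RegularCW

/-! ### Closed cells, their boundary spheres and local homology at centres -/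

section Faces

variable {X : Type u} [TopologicalSpace X] [T2Space X] {C : Set X} [CWComplex C]

/-- The open cell of a face. -/
def openFace (σ : Face C) : Set X := openCell σ.dim σ.idx

/-- The boundary sphere of a face. -/
def rim (σ : Face C) : Set X := cellFrontier σ.dim σ.idx

theorem rim_union_openFace (σ : Face C) : rim σ ∪ openFace σ = σ.carrier :=
  cellFrontier_union_openCell_eq_closedCell σ.dim σ.idx

theorem rim_subset (σ : Face C) : rim σ ⊆ σ.carrier :=
  CWComplex.cellFrontier_subset_closedCell σ.dim σ.idx

theorem eq_of_mem_openFace {σ τ : Face C} {x : X} (h : x ∈ openFace σ) (h' : x ∈ openFace τ) :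
    σ = τ := by
  have := eq_of_not_disjoint_openCell (not_disjoint_iff.mpr ⟨x, h, h'⟩)
  obtain ⟨n, i⟩ := σ
  obtain ⟨m, j⟩ := τ
  cases this
  rfl

theorem isClosed_carrier (σ : Face C) : IsClosed σ.carrier := isClosed_closedCell

variable [IsRegular C]

theorem exists_face_of_mem_rim {τ : Face C} {x : X} (h : x ∈ rim τ) :
    ∃ ρ : Face C, ρ.dim < τ.dim ∧ x ∈ ρ.carrier ∧ ρ.carrier ⊆ rim τ := by
  obtain ⟨I, hI⟩ := IsRegular.frontier_eq τ.dim τ.idx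
  have h1 := h
  rw [rim, hI] at h1
  simp only [mem_iUnion] at h1
  obtain ⟨m, hm, i, hi, hx⟩ := h1
  refine ⟨⟨m, i⟩, hm, hx, ?_⟩
  rw [rim, hI]
  exact fun y hy => mem_iUnion₂.mpr ⟨m, hm, mem_iUnion₂.mpr ⟨i, hi, hy⟩⟩

/-- A face whose open cell meets a closed cell is contained in it. -/
theorem le_of_mem_openFace {σ τ : Face C} {x : X} (h : x ∈ openFace σ) (h' : x ∈ τ.carrier) :
    σ ≤ τ := by
  induction hn : τ.dim using Nat.strong_induction_on generalizing τ with
  | _ n ih =>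
    rw [← rim_union_openFace] at h'
    obtain h' | h' := h'
    · obtain ⟨ρ, hρ, hx, hle⟩ := exists_face_of_mem_rim h'
      exact (ih ρ.dim (hn ▸ hρ) hx rfl).trans (hle.trans (rim_subset τ) : ρ.carrier ⊆ τ.carrier)
    · exact (eq_of_mem_openFace h h').le

theorem exists_chart (σ : Face C) : ∃ f : (Fin σ.dim → ℝ) → X,
    ContinuousOn f (closedBall 0 1) ∧ InjOn f (closedBall 0 1) ∧ f '' ball 0 1 = openFace σ ∧
      f '' sphere 0 1 = rim σ ∧ f '' closedBall 0 1 = σ.carrier := by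
  obtain ⟨f, hf, hi, h1, h2⟩ := IsRegular.exists_ball σ.dim σ.idx
  refine ⟨f, hf, hi, h1, h2, ?_⟩
  rw [← ball_union_sphere, image_union, h1, h2, union_comm]
  exact rim_union_openFace σ

/-- The centre of a face. -/
def center (σ : Face C) : X := (exists_chart σ).choose 0

theorem exists_chart_center (σ : Face C) : ∃ f : (Fin σ.dim → ℝ) → X,
    ContinuousOn f (closedBall 0 1) ∧ InjOn f (closedBall 0 1) ∧ f '' ball 0 1 = openFace σ ∧
      f '' sphere 0 1 = rim σ ∧ f '' closedBall 0 1 = σ.carrier ∧ f 0 = center σ :=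
  have h := (exists_chart σ).choose_spec
  ⟨_, h.1, h.2.1, h.2.2.1, h.2.2.2.1, h.2.2.2.2, rfl⟩

theorem center_mem (σ : Face C) : center σ ∈ openFace σ := by
  obtain ⟨f, -, -, h, -, -, h0⟩ := exists_chart_center σ
  rw [← h, ← h0]
  exact ⟨0, mem_ball_self zero_lt_one, rfl⟩

theorem openFace_eq_diff (σ : Face C) : openFace σ = σ.carrier \ rim σ := by
  obtain ⟨f, -, hi, h, h', h'', -⟩ := exists_chart_center σ
  rw [← h, ← h', ← h'', image_ball_eq_diff hi]

theorem openFace_subset (σ : Face C) : openFace σ ⊆ σ.carrier := by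
  rw [openFace_eq_diff]
  exact sdiff_subset

theorem center_notMem_rim (σ : Face C) : center σ ∉ rim σ := by
  have := center_mem σ
  rw [openFace_eq_diff] at this
  exact this.2

theorem lt_iff_carrier_subset_rim {σ τ : Face C} : σ < τ ↔ σ.carrier ⊆ rim τ := by
  constructor
  · intro h x hx
    have hx' : x ∈ τ.carrier := h.le hx
    rw [← rim_union_openFace] at hx'
    refine hx'.resolve_right fun hx'' => ?_
    exact h.not_ge (le_of_mem_openFace hx'' hx)
  · intro h
    refine lt_of_le_of_ne (h.trans (rim_subset τ) : σ.carrier ⊆ τ.carrier) ?_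
    rintro rfl
    exact center_notMem_rim σ (h (openFace_subset σ (center_mem σ)))

/-- The centre of `σ` lies in a lower-dimensional closed cell of the frontier of `τ`, and that cell
contains all of `σ`. -/
theorem dim_lt_of_lt {σ τ : Face C} (h : σ < τ) : σ.dim < τ.dim := by
  induction hn : τ.dim using Nat.strong_induction_on generalizing τ with
  | _ n ih =>
    have hx := lt_iff_carrier_subset_rim.mp h (openFace_subset σ (center_mem σ))
    obtain ⟨ρ, hρ, hx, -⟩ := exists_face_of_mem_rim hx
    obtain h' | h' := (le_of_mem_openFace (center_mem σ) hx).lt_or_eq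
    · exact (ih ρ.dim (hn ▸ hρ) h' rfl).trans (hn ▸ hρ)
    · rw [h']; exact hn ▸ hρ

variable (C) in
/-- A subspace which is a union of closed cells. -/
def IsUnionOfFaces (B : Set X) : Prop := ∀ x ∈ B, ∃ ρ : Face C, x ∈ ρ.carrier ∧ ρ.carrier ⊆ B

theorem isUnionOfFaces_carrier (σ : Face C) : IsUnionOfFaces C σ.carrier :=
  fun _ hx => ⟨σ, hx, le_rfl⟩

theorem isUnionOfFaces_rim (σ : Face C) : IsUnionOfFaces C (rim σ) := fun _ hx =>
  (exists_face_of_mem_rim hx).imp fun _ h => h.2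

theorem IsUnionOfFaces.union {A B : Set X} (hA : IsUnionOfFaces C A) (hB : IsUnionOfFaces C B) :
    IsUnionOfFaces C (A ∪ B) := by
  rintro x (hx | hx)
  · obtain ⟨ρ, h, h'⟩ := hA x hx
    exact ⟨ρ, h, h'.trans subset_union_left⟩
  · obtain ⟨ρ, h, h'⟩ := hB x hx
    exact ⟨ρ, h, h'.trans subset_union_right⟩

theorem IsUnionOfFaces.iUnion {ι : Sort*} {A : ι → Set X} (hA : ∀ i, IsUnionOfFaces C (A i)) :
    IsUnionOfFaces C (⋃ i, A i) := by
  intro x hx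
  obtain ⟨i, hi⟩ := mem_iUnion.mp hx
  obtain ⟨ρ, h, h'⟩ := hA i x hi
  exact ⟨ρ, h, h'.trans (subset_iUnion A i)⟩

theorem isUnionOfFaces_skel (n : ℕ) : IsUnionOfFaces C (skel C n) := by
  intro x hx
  obtain ⟨m, hm, i, hi⟩ := CWComplex.mem_skeletonLT_iff.mp hx
  refine ⟨⟨m, i⟩, openFace_subset ⟨m, i⟩ hi, (closedCell_subset_skel m i).trans ?_⟩
  exact CWComplex.skeletonLT_mono (by exact_mod_cast Order.add_one_le_of_lt hm)

theorem dim_lt_of_mem_skel {σ : Face C} {n : ℕ} {x : X} (hx : x ∈ openFace σ)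
    (h : x ∈ skel C n) : σ.dim < n := by
  obtain ⟨m, hm, i, hi⟩ := CWComplex.mem_skeletonLT_iff.mp h
  have := eq_of_mem_openFace (σ := σ) (τ := ⟨m, i⟩) hx hi
  subst this
  exact_mod_cast hm

theorem dim_lt_of_carrier_subset_skel {σ : Face C} {n : ℕ} (h : σ.carrier ⊆ skel C n) :
    σ.dim < n := dim_lt_of_mem_skel (center_mem σ) (h (openFace_subset σ (center_mem σ)))

/-- In a finite union of closed cells, the open cell of a maximal face is open. -/
theorem exists_isOpen_inter_eq_openFace [CWComplex.Finite C] {B : Set X} (hB : IsUnionOfFaces C B)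
    {σ : Face C} (hσ : σ.carrier ⊆ B) (hmax : ∀ ρ : Face C, ρ.carrier ⊆ B → ¬ σ < ρ) :
    ∃ W, IsOpen W ∧ B ∩ W = openFace σ := by
  -- The open set is the complement of all other closed cells in `B`, which form a closed set by
  -- finiteness.
  refine ⟨(⋃ ρ ∈ {ρ : Face C | ρ.carrier ⊆ B ∧ ρ ≠ σ}, ρ.carrier)ᶜ, ?_, ?_⟩
  · exact ((Set.toFinite _).isClosed_biUnion fun ρ _ => isClosed_carrier ρ).isOpen_compl
  · ext x
    simp only [mem_inter_iff, mem_compl_iff, mem_iUnion, mem_ofPred_eq, not_exists]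
    constructor
    · rintro ⟨hx, h⟩
      obtain ⟨ρ, hρ, hρB⟩ := hB x hx
      obtain rfl : ρ = σ := by_contra fun h' => h ρ ⟨hρB, h'⟩ hρ
      rw [openFace_eq_diff]
      refine ⟨hρ, fun hx' => ?_⟩
      obtain ⟨ρ', hdim, hx'', hρ'⟩ := exists_face_of_mem_rim hx'
      refine h ρ' ⟨hρ'.trans ((rim_subset ρ).trans hσ), ?_⟩ hx''
      rintro rfl
      exact hdim.false
    · intro hx
      refine ⟨hσ (openFace_subset σ hx), fun ρ hρ hx' => ?_⟩
      exact hmax ρ hρ.1 (lt_of_le_of_ne (le_of_mem_openFace hx hx') hρ.2.symm)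

theorem relIso_center [CWComplex.Finite C] {B : Set X} (hB : IsUnionOfFaces C B)
    {σ : Face C} (hσ : σ.carrier ⊆ B) (hmax : ∀ ρ : Face C, ρ.carrier ⊆ B → ¬ σ < ρ) :
    RelIso σ.carrier (rim σ) B (B \ {center σ}) := by
  obtain ⟨W, hW, hBW⟩ := exists_isOpen_inter_eq_openFace hB hσ hmax
  obtain ⟨f, hf, hi, h1, h2, h3, h0⟩ := exists_chart_center σ
  rw [← h3, ← h2, ← h0]
  exact relIso_ball hf hi (h3 ▸ hσ) hW (h1 ▸ hBW)

theorem isGen_center [CWComplex.Finite C] {B : Set X} (hB : IsUnionOfFaces C B)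
    {σ : Face C} (hσ : σ.carrier ⊆ B) (hmax : ∀ ρ : Face C, ρ.carrier ⊆ B → ¬ σ < ρ)
    {z : SChain X} (hz : IsGen z σ.carrier (rim σ)) : IsGen z B (B \ {center σ}) :=
  hz.of_relIso (relIso_center hB hσ hmax)
    (fun _ hx => ⟨hσ (rim_subset σ hx), fun h => center_notMem_rim σ (h ▸ hx)⟩) hσ

/-- The closed cell modulo its punctured boundary sphere is acyclic, so the connecting map carries
the generator to one of the local homology of the sphere at `x`. -/
theorem isGen_sd_rim {τ : Face C} {z : SChain X} (hz : IsGen z τ.carrier (rim τ)) {x : X}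
    (hx : x ∈ rim τ) : IsGen (sd z) (rim τ) (rim τ \ {x}) := by
  obtain ⟨f, hf, hi, h1, h2, h3, h0⟩ := exists_chart_center τ
  refine hz.sd_of_acyclic ?_ sdiff_subset (rim_subset τ)
  rw [← h3, ← h2]
  exact acyclic_ball_sphere_diff hf hi (h2 ▸ hx)

/-- The homology of `A ∪ σ` modulo the complement of the centre is computed twice: from `σ` by the
ball comparison, and from `A` because the punctured union deforms onto `A`. -/
theorem relIso_attach [CWComplex.Finite C] {A : Set X} (hA : IsUnionOfFaces C A)
    (hAc : IsClosed A) {σ : Face C} (hrim : rim σ ⊆ A) (hmax : ∀ ρ : Face C, ρ.carrier ⊆ A → ¬ σ ≤ ρ) :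
    RelIso σ.carrier (rim σ) (A ∪ σ.carrier) A := by
  have hdisj {x : X} (hx : x ∈ A) : x ∉ openFace σ := fun h => by
    obtain ⟨ρ, hρ, hρA⟩ := hA x hx
    exact hmax ρ hρA (le_of_mem_openFace h hρ)
  have hmax' (ρ : Face C) (hρ : ρ.carrier ⊆ A ∪ σ.carrier) : ¬ σ < ρ := fun h => by
    obtain h' | h' := hρ (openFace_subset ρ (center_mem ρ))
    · obtain ⟨ρ', hρ', hρA⟩ := hA _ h'
      exact hmax ρ' hρA (h.le.trans (le_of_mem_openFace (center_mem ρ) hρ'))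
    · exact h.not_ge (le_of_mem_openFace (center_mem ρ) h')
  have h := relIso_center (hA.union (isUnionOfFaces_carrier σ)) subset_union_right hmax'
  have h' : Acyclic ((A ∪ σ.carrier) \ {center σ}) A := by
    obtain ⟨f, hf, hi, h1, h2, h3, h0⟩ := exists_chart_center σ
    rw [← h3, ← h0]
    refine acyclic_union_ball_diff hf hi hAc (h2 ▸ hrim) ?_
    rw [h2, h3]
    rintro x ⟨hx, hx'⟩
    rw [← rim_union_openFace] at hx'
    exact hx'.resolve_right (hdisj hx)
  exact h.of_trans_right (h'.relIso sdiff_subset) hrim subset_union_right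
    (fun x hx => ⟨Or.inl hx, fun h => hdisj hx (h ▸ center_mem σ)⟩) le_rfl

end Faces

end Chains

end

noncomputable section

namespace Chains

open PairHomology RelCWComplex RegularCW

/-! ### Sums and equality of represented classes -/

section Sums

variable {X : Type u} [TopologicalSpace X] {A B : Set X} {n : ℕ}

theorem relRep_zero (h : A ⊆ B) : RelRep (0 : relHomology n h) 0 := by
  obtain ⟨ξ, hξ⟩ := exists_relRep_of_mem (n := n) h (zero_mem (relCycles B A)) (map_zero _)
  rwa [hξ.eq_zero_iff.mpr (zero_mem _)] at hξ

theorem RelRep.sum {ι : Type*} {h : A ⊆ B} {ξ : ι → relHomology n h} {z : ι → SChain X}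
    (hz : ∀ i, RelRep (ξ i) (z i)) (s : Finset ι) : RelRep (∑ i ∈ s, ξ i) (∑ i ∈ s, z i) := by
  classical
  induction s using Finset.induction_on with
  | empty => exact relRep_zero h
  | insert i s hi ih =>
    rw [Finset.sum_insert hi, Finset.sum_insert hi]
    exact (hz i).add ih

theorem RelRep.eq_iff {h : A ⊆ B} {ξ ξ' : relHomology n h} {z z' : SChain X} (hz : RelRep ξ z)
    (hz' : RelRep ξ' z') : ξ = ξ' ↔ z - z' ∈ relBoundaries B A := by
  rw [← (hz.sub hz').eq_zero_iff, sub_eq_zero]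

end Sums

/-! ### The cellular basis, incidence numbers and rank-one intervals -/

section Cells

variable {X : Type u} [TopologicalSpace X] [T2Space X] {C : Set X} [CWComplex C]
  (o : Orientation C) {n : ℕ}

/-- A relative cycle in the orientation class of a cell. -/
def cellRep (n : ℕ) (σ : cell C n) : SChain X := (exists_relRep (o.gen n σ)).choose

theorem relRep_gen (n : ℕ) (σ : cell C n) : RelRep (o.gen n σ) (cellRep o n σ) :=
  (exists_relRep (o.gen n σ)).choose_spec

theorem relRep_chain (n : ℕ) (σ : cell C n) : RelRep (o.chain n σ) (cellRep o n σ) :=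
  (relRep_gen o n σ).map _ _ _

theorem relRep_localClass (n : ℕ) (σ : cell C n) : RelRep (o.localClass n σ) (cellRep o n σ) :=
  (relRep_gen o n σ).map _ _ _

theorem relRep_localBoundary (n : ℕ) (τ : cell C (n + 1)) (σ : cell C n) :
    RelRep (o.localBoundary n τ σ) (sd (cellRep o (n + 1) τ)) :=
  (((relRep_gen o (n + 1) τ).connecting).map _).toRel _

theorem relRep_cellularBoundary {ξ : CellularChains C (n + 1)} {z : SChain X} (hz : RelRep ξ z) :
    RelRep (cellularBoundary C n ξ) (sd z) :=
  hz.connecting.toRel _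

theorem cellularBoundary_cellularBoundary (n : ℕ) :
    cellularBoundary C n ∘ₗ cellularBoundary C (n + 1) = 0 := by
  ext1 ξ
  obtain ⟨z, hz⟩ := exists_relRep ξ
  rw [LinearMap.comp_apply, LinearMap.zero_apply]
  refine (relRep_cellularBoundary (relRep_cellularBoundary hz)).eq_zero_iff.mpr ?_
  rw [sd_sd]
  exact zero_mem _

theorem isDegree_iff {τ : cell C (n + 1)} {σ : cell C n} {k : ℤ} : o.IsDegree n τ σ k ↔
    sd (cellRep o (n + 1) τ) - k • cellRep o n σ ∈
      relBoundaries (skel C (n + 1)) (skel C (n + 1) \ openCell n σ) :=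
  (relRep_localBoundary o n τ σ).eq_iff ((relRep_localClass o n σ).smul k)

theorem cellRep_mem (n : ℕ) (σ : cell C n) :
    cellRep o n σ ∈ relCycles (Face.mk n σ).carrier (rim ⟨n, σ⟩) := (relRep_gen o n σ).mem

theorem sd_cellRep_mem (n : ℕ) (σ : cell C n) : sd (cellRep o n σ) ∈ chainsIn (rim ⟨n, σ⟩) :=
  (mem_relCycles.mp (cellRep_mem o n σ)).2

variable [IsRegular C]

/-- The chart supplies some generator; it is a multiple of the orientation class, which must then be
a generator too. -/
theorem isGen_cellRep (n : ℕ) (σ : cell C n) :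
    IsGen (cellRep o n σ) (Face.mk n σ).carrier (rim ⟨n, σ⟩) := by
  obtain ⟨f, hf, hi, -, h2, h3⟩ := exists_chart (Face.mk n σ)
  obtain ⟨z, hzn, hz⟩ := exists_isGen_ball hf hi
  rw [h2, h3] at hz
  obtain ⟨ξ, hξ⟩ : ∃ ξ : relHomology n (CWComplex.cellFrontier_subset_closedCell n σ), RelRep ξ z :=
    exists_relRep_of_mem _ hz.mem hzn
  have hmem : ξ ∈ Submodule.span ℤ {o.gen n σ} := by
    rw [o.generates]; exact Submodule.mem_top
  obtain ⟨k, hk⟩ := Submodule.mem_span_singleton.mp hmem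
  -- The scalar action stored in the module object is replaced by the canonical integer action on
  -- its additive group.
  replace hk := (int_smul_eq_zsmul (ModuleCat.isModule _) k (o.gen n σ)).symm.trans hk
  refine hz.of_generates (cellRep_mem o n σ) ⟨k, ?_⟩
  exact (hξ.eq_iff ((relRep_gen o n σ).smul k)).mp hk.symm

variable [CWComplex.Finite C]

/-- An n-cell is maximal among the closed cells of X^(n), so its open cell is relatively open there.
-/
theorem isGen_skel (n : ℕ) (σ : cell C n) : IsGen (cellRep o n σ) (skel C (n + 1))
    (skel C (n + 1) \ {center (Face.mk n σ)}) :=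
  isGen_center (σ := ⟨n, σ⟩) (isUnionOfFaces_skel (n + 1)) (closedCell_subset_skel n σ)
    (fun _ hρ h => (dim_lt_of_lt h).not_ge (Nat.le_of_lt_succ (dim_lt_of_carrier_subset_skel hρ)))
    (isGen_cellRep o n σ)

/-- Degrees are defined modulo the complement of the open cell, while generators are known modulo
the complement of the centre. Passing to the latter suffices for uniqueness. -/
theorem relBoundaries_open_le_center (n : ℕ) (σ : cell C n) :
    relBoundaries (skel C (n + 1)) (skel C (n + 1) \ openCell n σ) ≤
      relBoundaries (skel C (n + 1)) (skel C (n + 1) \ {center (Face.mk n σ)}) :=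
  relBoundaries_mono (sdiff_subset_sdiff_right
    (singleton_subset_iff.mpr (center_mem (Face.mk n σ)))) le_rfl

theorem skel_subset_diff (n : ℕ) (σ : cell C n) : skel C n ⊆ skel C (n + 1) \ openCell n σ :=
  fun _ hx => ⟨skel_subset C n hx, fun h => (dim_lt_of_mem_skel (σ := ⟨n, σ⟩) h hx).false⟩

theorem closedCell_subset_diff {σ ρ : cell C n} (h : ρ ≠ σ) :
    (Face.mk n ρ).carrier ⊆ skel C (n + 1) \ openCell n σ := by
  refine fun x hx => ⟨closedCell_subset_skel n ρ hx, fun hx' => ?_⟩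
  obtain h' | h' := (le_of_mem_openFace (σ := ⟨n, σ⟩) hx' hx).lt_or_eq
  · exact (dim_lt_of_lt h').false
  · cases h'
    exact h rfl

/-- Other n-cells are disjoint from the open cell of `σ`, so localisation at `σ` isolates its
coefficient. -/
theorem sum_sub_mem {ι : Finset (cell C n)} (a : cell C n → ℤ) {σ : cell C n} (hσ : σ ∈ ι) :
    (∑ ρ ∈ ι, a ρ • cellRep o n ρ) - a σ • cellRep o n σ ∈
      relBoundaries (skel C (n + 1)) (skel C (n + 1) \ openCell n σ) := by
  classical
  rw [← Finset.sum_erase_eq_sub hσ]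
  refine Submodule.sum_mem _ fun ρ hρ => Submodule.smul_mem _ _ (mem_relBoundaries_of_mem ?_)
  exact chainsIn_mono (closedCell_subset_diff (Finset.ne_of_mem_erase hρ))
    (mem_relCycles.mp (cellRep_mem o n ρ)).1

/-- A relation localised at each cell becomes a multiple of a generator of ℤ, so its coefficient is
zero. -/
theorem linearIndependent_chain (n : ℕ) : LinearIndependent ℤ (o.chain n) := by
  rw [linearIndependent_iff']
  intro s a h σ hσ
  have hrep := RelRep.sum (fun ρ => (relRep_chain o n ρ).smul (a ρ)) s
  rw [show ∑ ρ ∈ s, a ρ • o.chain n ρ = 0 from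
    (Finset.sum_congr rfl fun ρ _ =>
      (int_smul_eq_zsmul (CellularChains C n).isModule _ _).symm).trans h] at hrep
  have h1 := relBoundaries_mono (skel_subset_diff n σ) le_rfl (hrep.eq_zero_iff.mp rfl)
  have h2 := sub_mem h1 (sum_sub_mem o a hσ)
  rw [sub_sub_cancel] at h2
  exact (isGen_skel o n σ).eq_zero _ (relBoundaries_open_le_center n σ h2)

/-- The union of the `(n-1)`-skeleton and of some `n`-cells. -/
def partialSkel (S : Finset (cell C n)) : Set X := skel C n ∪ ⋃ σ ∈ S, (Face.mk n σ).carrier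

theorem isUnionOfFaces_partialSkel (S : Finset (cell C n)) :
    IsUnionOfFaces C (partialSkel S) :=
  (isUnionOfFaces_skel n).union
    (.iUnion fun σ => .iUnion fun _ => isUnionOfFaces_carrier ⟨n, σ⟩)

theorem isClosed_partialSkel (S : Finset (cell C n)) : IsClosed (partialSkel S) :=
  (skeletonLT C (n : ℕ∞)).closed.union
    (S.finite_toSet.isClosed_biUnion fun σ _ => isClosed_carrier ⟨n, σ⟩)

theorem notMem_partialSkel {S : Finset (cell C n)} {σ : cell C n} (hσ : σ ∉ S) {ρ : Face C}
    (hρ : ρ.carrier ⊆ partialSkel S) : ¬ Face.mk n σ ≤ ρ := fun h => by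
  have hx := center_mem (Face.mk n σ)
  obtain h' | h' := hρ (h (openFace_subset _ hx))
  · exact (dim_lt_of_mem_skel hx h').false
  · obtain ⟨ρ', hρ', h'⟩ := mem_iUnion₂.mp h'
    exact (closedCell_subset_diff (by rintro rfl; exact hσ hρ') h').2 hx

/-- Cells are attached one at a time. Modulo the part already built, the homology is generated by
the new cell, and what remains is a cycle on that part. -/
theorem exists_sub_sum_mem (S : Finset (cell C n)) {w : SChain X}
    (hw : w ∈ relCycles (partialSkel S) (skel C n)) : ∃ a : cell C n → ℤ,
      w - ∑ σ ∈ S, a σ • cellRep o n σ ∈ relBoundaries (partialSkel S) (skel C n) := by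
  classical
  induction S using Finset.induction_on generalizing w with
  | empty =>
    refine ⟨0, mem_relBoundaries_of_mem ?_⟩
    have h := (mem_relCycles.mp hw).1
    simpa [partialSkel] using h
  | insert σ S hσ ih =>
    have hrim : rim (Face.mk n σ) ⊆ skel C n := cellFrontier_subset_skel n σ
    have hU : partialSkel (insert σ S) = partialSkel S ∪ (Face.mk n σ).carrier := by
      rw [partialSkel, partialSkel, Finset.set_biUnion_insert, union_assoc,
        union_comm (Face.mk n σ).carrier]
    have hsub : partialSkel S ⊆ partialSkel (insert σ S) := by rw [hU]; exact subset_union_left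
    have hiso := relIso_attach (isUnionOfFaces_partialSkel S) (isClosed_partialSkel S)
      (hrim.trans subset_union_left) (fun ρ hρ => notMem_partialSkel hσ hρ)
    rw [← hU] at hiso
    obtain ⟨k, hk⟩ := ((isGen_cellRep o n σ).of_relIso hiso (hrim.trans subset_union_left)
      (by rw [hU]; exact subset_union_right)).exists_smul w
        (relCycles_mono subset_union_left le_rfl hw)
    obtain ⟨b, hb, c, hc, e⟩ := mem_relBoundaries.mp hk
    -- The remainder is a cycle modulo the lower skeleton, not just modulo the earlier cells, since
    -- `w` and the new cell both have boundaries there.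
    have hsdc : sd c ∈ chainsIn (skel C n) := by
      have : sd c = sd w - k • sd (cellRep o n σ) := by
        rw [← map_smul, ← map_sub, ← e, map_add, sd_sd, zero_add]
      rw [this]
      exact sub_mem (mem_relCycles.mp hw).2
        (Submodule.smul_mem _ _ (chainsIn_mono hrim (sd_cellRep_mem o n σ)))
    obtain ⟨a, ha⟩ := ih (mem_relCycles.mpr ⟨hc, hsdc⟩)
    refine ⟨Function.update a σ k, ?_⟩
    have hsum : ∑ ρ ∈ S, Function.update a σ k ρ • cellRep o n ρ = ∑ ρ ∈ S, a ρ • cellRep o n ρ :=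
      Finset.sum_congr rfl fun ρ hρ => by
        rw [Function.update_of_ne (by rintro rfl; exact hσ hρ)]
    rw [Finset.sum_insert hσ, Function.update_self, hsum, ← sub_sub, ← e, add_sub_assoc]
    exact add_mem (sd_mem_relBoundaries hb) (relBoundaries_mono le_rfl hsub ha)

theorem exists_sub_sum_mem_skel [Fintype (cell C n)] {w : SChain X}
    (hw : w ∈ relCycles (skel C (n + 1)) (skel C n)) : ∃ a : cell C n → ℤ,
      w - ∑ σ, a σ • cellRep o n σ ∈ relBoundaries (skel C (n + 1)) (skel C n) := by
  have : skel C (n + 1) = partialSkel (Finset.univ : Finset (cell C n)) := by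
    have := CWComplex.skeletonLT_union_iUnion_closedCell_eq_skeletonLT_succ (C := C) n
    rw [partialSkel, skel, Nat.cast_add, Nat.cast_one, ← this]
    simp [Face.carrier]
  rw [this] at hw ⊢
  exact exists_sub_sum_mem o _ hw

theorem exists_eq_sum [Fintype (cell C n)] (ξ : CellularChains C n) :
    ∃ a : cell C n → ℤ, ξ = ∑ σ, a σ • o.chain n σ := by
  obtain ⟨w, hw⟩ := exists_relRep ξ
  obtain ⟨a, ha⟩ := exists_sub_sum_mem_skel o hw.mem
  exact ⟨a, (hw.eq_iff (RelRep.sum (fun σ => (relRep_chain o n σ).smul (a σ)) _)).mpr ha⟩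

theorem finite_cell (n : ℕ) : Finite (cell C n) := CWComplex.FiniteType.finite_cell n

theorem span_chain (n : ℕ) : Submodule.span ℤ (Set.range (o.chain n)) = ⊤ := by
  have := finite_cell (C := C) n
  have := Fintype.ofFinite (cell C n)
  refine eq_top_iff.mpr fun ξ _ => ?_
  obtain ⟨a, rfl⟩ := exists_eq_sum o ξ
  refine Submodule.sum_mem _ fun σ _ => ?_
  rw [← int_smul_eq_zsmul (CellularChains C n).isModule]
  exact Submodule.smul_mem _ _ (Submodule.subset_span ⟨σ, rfl⟩)

/-- The second hypothesis is only modulo the complement of the centre, so an integer found in the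
boundary sphere of `τ` can be recognised as the degree. -/
theorem isDegree_unique {τ : cell C (n + 1)} {σ : cell C n} {k l : ℤ} (hk : o.IsDegree n τ σ k)
    (hl : sd (cellRep o (n + 1) τ) - l • cellRep o n σ ∈
      relBoundaries (skel C (n + 1)) (skel C (n + 1) \ {center (Face.mk n σ)})) : k = l := by
  have h := sub_mem hl (relBoundaries_open_le_center n σ ((isDegree_iff o).mp hk))
  rw [sub_sub_sub_cancel_left, ← sub_smul] at h
  exact sub_eq_zero.mp ((isGen_skel o n σ).eq_zero _ h)

/-- The boundary is expanded in the oriented cells, and localisation of the expansion at each `σ`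
shows its coefficient to be a degree. -/
theorem exists_boundary_eq_sum [Fintype (cell C n)] (τ : cell C (n + 1)) :
    ∃ a : cell C n → ℤ, (∀ σ, o.IsDegree n τ σ (a σ)) ∧
      cellularBoundary C n (o.chain (n + 1) τ) = ∑ σ, a σ • o.chain n σ := by
  have hrep := relRep_cellularBoundary (relRep_chain o (n + 1) τ)
  obtain ⟨a, ha⟩ := exists_sub_sum_mem_skel o hrep.mem
  refine ⟨a, fun σ => (isDegree_iff o).mpr ?_,
    (hrep.eq_iff (RelRep.sum (fun σ => (relRep_chain o n σ).smul (a σ)) _)).mpr ha⟩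
  rw [← sub_add_sub_cancel]
  exact add_mem (relBoundaries_mono (skel_subset_diff n σ) le_rfl ha)
    (sum_sub_mem o a (Finset.mem_univ σ))

theorem isDegree_incidence (τ : cell C (n + 1)) (σ : cell C n) :
    o.IsDegree n τ σ (o.incidence n τ σ) := by
  have := finite_cell (C := C) n
  have := Fintype.ofFinite (cell C n)
  obtain ⟨a, ha, -⟩ := exists_boundary_eq_sum o τ
  exact Classical.epsilon_spec ⟨a σ, ha σ⟩

theorem isDegree_iff_eq_incidence {τ : cell C (n + 1)} {σ : cell C n} {k : ℤ} :
    o.IsDegree n τ σ k ↔ k = o.incidence n τ σ := by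
  refine ⟨fun h => isDegree_unique o h (relBoundaries_open_le_center n σ
    ((isDegree_iff o).mp (isDegree_incidence o τ σ))), ?_⟩
  rintro rfl
  exact isDegree_incidence o τ σ

theorem cellularBoundary_chain [Fintype (cell C n)] (τ : cell C (n + 1)) :
    cellularBoundary C n (o.chain (n + 1) τ) = ∑ σ, o.incidence n τ σ • o.chain n σ := by
  obtain ⟨a, ha, h⟩ := exists_boundary_eq_sum o τ
  rw [h]
  exact Finset.sum_congr rfl fun σ _ => by rw [(isDegree_iff_eq_incidence o).mp (ha σ)]

/-- Covering means precisely that `σ` is maximal among the closed cells in the boundary sphere of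
`τ`. -/
theorem isGen_rim {σ τ : Face C} (h : σ ⋖ τ) {z : SChain X} (hz : IsGen z σ.carrier (rim σ)) :
    IsGen z (rim τ) (rim τ \ {center σ}) :=
  isGen_center (isUnionOfFaces_rim τ) (lt_iff_carrier_subset_rim.mp h.lt)
    (fun _ hρ h' => h.2 h' (lt_iff_carrier_subset_rim.mpr hρ)) hz

/-- For a cover, the class of `σ` and the boundary of the class of `τ` generate the same local
homology of the sphere, so they have the same degree. The orientation merely supplies homogeneous
generators. -/
theorem isRankOne_iff_covBy (o : Orientation C) {σ τ : Face C} : IsRankOne σ τ ↔ σ ⋖ τ := by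
  constructor
  · rintro ⟨h, hdim⟩
    refine ⟨h, fun ρ h1 h2 => ?_⟩
    have := dim_lt_of_lt h1
    have := dim_lt_of_lt h2
    lia
  · intro h
    obtain ⟨n, σ⟩ := σ
    obtain ⟨m, τ⟩ := τ
    refine ⟨h.lt, ?_⟩
    have hmn := dim_lt_of_lt h.lt
    obtain _ | m := m
    · exact absurd hmn (Nat.not_lt_zero _)
    have hσ := isGen_rim h (isGen_cellRep o n σ)
    have hx := lt_iff_carrier_subset_rim.mp h.lt (openFace_subset _ (center_mem (Face.mk n σ)))
    have hτ := isGen_sd_rim (isGen_cellRep o (m + 1) τ) hx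
    by_contra hne
    have hne' : n ≠ m := fun e => hne (congrArg (· + 1) e.symm)
    obtain ⟨k, -, hk⟩ := hτ.sub_mem_or_add_mem hσ
    -- If the degrees differed, the part in degree `n` would kill the boundary of `τ` and leave the
    -- generator from `σ` as a relative boundary.
    have h1 := sdeg_mem_relBoundaries n hk
    rw [map_sub, map_smul, (relRep_gen o n σ).sdeg, ← (relRep_gen o (m + 1) τ).sdeg, ← sdeg_sd,
      sdeg, sdeg, degreePart_degreePart_of_ne hne', smul_zero, sub_zero] at h1
    have := hσ.eq_zero 1 (by rwa [one_smul])
    exact one_ne_zero this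

/-- Two generators of the local homology of the sphere differ by a sign, and inclusion into the
skeleton identifies this sign with the degree. -/
theorem incidence_of_isRankOne {σ : cell C n} {τ : cell C (n + 1)}
    (h : IsRankOne (C := C) ⟨n, σ⟩ ⟨n + 1, τ⟩) :
    o.incidence n τ σ = 1 ∨ o.incidence n τ σ = -1 := by
  have h' := (isRankOne_iff_covBy o).mp h
  have hx := lt_iff_carrier_subset_rim.mp h'.lt (openFace_subset _ (center_mem (Face.mk n σ)))
  obtain ⟨k, hk, hmem⟩ := (isGen_rim h' (isGen_cellRep o n σ)).sub_mem_or_add_mem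
    (isGen_sd_rim (isGen_cellRep o (n + 1) τ) hx)
  have hsub : rim (Face.mk (n + 1) τ) ⊆ skel C (n + 1) := cellFrontier_subset_skel (n + 1) τ
  rwa [← isDegree_unique o (isDegree_incidence o τ σ)
    (relBoundaries_mono (sdiff_subset_sdiff_left hsub) hsub hmem)] at hk

/-- If the frontier of `τ` met the open cell of `σ`, then `σ` would be a face of `τ`, of codimension
one; so the boundary chain avoids that cell. -/
theorem incidence_of_not_isRankOne {σ : cell C n} {τ : cell C (n + 1)}
    (h : ¬ IsRankOne (C := C) ⟨n, σ⟩ ⟨n + 1, τ⟩) : o.incidence n τ σ = 0 := by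
  refine ((isDegree_iff_eq_incidence o).mp ((isDegree_iff o).mpr ?_)).symm
  rw [zero_smul, sub_zero]
  refine mem_relBoundaries_of_mem (chainsIn_mono (fun x hx => ?_) (sd_cellRep_mem o (n + 1) τ))
  refine ⟨cellFrontier_subset_skel (n + 1) τ hx, fun hx' => h ⟨?_, rfl⟩⟩
  refine lt_of_le_of_ne (le_of_mem_openFace (σ := ⟨n, σ⟩) hx' (rim_subset _ hx)) fun e => ?_
  exact absurd (congrArg Face.dim e) (Nat.succ_ne_self n).symm

end Cells

end Chains

end

noncomputable section

namespace Chains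

open PairHomology RelCWComplex RegularCW

/-! ### Cellular bases and the comparison of two complexes -/

section Equivalence

variable {X : Type u} [TopologicalSpace X] [T2Space X] {C : Set X} [CWComplex C]
  [IsRegular C] [CWComplex.Finite C] (o : Orientation C) {n : ℕ}

open Classical in
theorem cellularBoundary_chain_eq_finsum (τ : cell C (n + 1)) :
    cellularBoundary C n (o.chain (n + 1) τ) =
      ∑ᶠ (σ : cell C n) (_ : IsRankOne (C := C) ⟨n, σ⟩ ⟨n + 1, τ⟩),
        o.incidence n τ σ • o.chain n σ := by
  have := finite_cell (C := C) n
  have := Fintype.ofFinite (cell C n)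
  rw [cellularBoundary_chain, finsum_eq_sum_of_fintype]
  refine Finset.sum_congr rfl fun σ _ => ?_
  rw [finsum_eq_if]
  split_ifs with h
  · rfl
  · rw [incidence_of_not_isRankOne o h, zero_zsmul]

theorem eq_of_sum_chain_eq [Fintype (cell C n)] {a b : cell C n → ℤ}
    (h : ∑ σ, a σ • o.chain n σ = ∑ σ, b σ • o.chain n σ) : a = b := by
  rw [← sub_eq_zero, ← Finset.sum_sub_distrib] at h
  funext σ
  refine sub_eq_zero.mp (Fintype.linearIndependent_iff.mp (linearIndependent_chain o n)
    (fun σ => a σ - b σ) ((Finset.sum_congr rfl fun ρ _ => ?_).trans h) σ)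
  exact (int_smul_eq_zsmul (CellularChains C n).isModule _ _).trans
    ((sub_zsmul _ _ _).trans (sub_eq_add_neg _ _).symm)

/-- The basis of oriented cells. -/
def chainBasis (n : ℕ) : Module.Basis (cell C n) ℤ (CellularChains C n) :=
  .mk (linearIndependent_chain o n) (span_chain o n).ge

theorem chainBasis_apply (σ : cell C n) : chainBasis o n σ = o.chain n σ := Module.Basis.mk_apply ..

variable {Y : Type v} [TopologicalSpace Y] [T2Space Y] {D : Set Y} [CWComplex D]
  [IsRegular D] [CWComplex.Finite D] (o' : Orientation D)

/-- The isomorphism of cellular chain groups induced by a bijection of cells. -/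
def chainEquiv (e : cell C n ≃ cell D n) : CellularChains C n ≃ₗ[ℤ] CellularChains D n :=
  (chainBasis o n).equiv (chainBasis o' n) e

theorem chainEquiv_chain (e : cell C n ≃ cell D n) (σ : cell C n) :
    chainEquiv o o' e (o.chain n σ) = o'.chain n (e σ) := by
  rw [← chainBasis_apply, chainEquiv, Module.Basis.equiv_apply, chainBasis_apply]

theorem boundary_chainEquiv_chain_iff (e : ∀ n, cell C n ≃ cell D n) (τ : cell C (n + 1)) :
    cellularBoundary D n (chainEquiv o o' (e (n + 1)) (o.chain (n + 1) τ)) =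
        chainEquiv o o' (e n) (cellularBoundary C n (o.chain (n + 1) τ)) ↔
      ∀ σ, o'.incidence n (e (n + 1) τ) (e n σ) = o.incidence n τ σ := by
  have := finite_cell (C := C) n
  have := Fintype.ofFinite (cell C n)
  have := Fintype.ofEquiv _ (e n)
  have h1 : chainEquiv o o' (e n) (cellularBoundary C n (o.chain (n + 1) τ)) =
      ∑ σ, o.incidence n τ ((e n).symm σ) • o'.chain n σ := by
    rw [cellularBoundary_chain, map_sum, ← (e n).sum_comp]
    exact Finset.sum_congr rfl fun σ _ => by
      rw [map_zsmul, chainEquiv_chain, Equiv.symm_apply_apply]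
  rw [h1, chainEquiv_chain, cellularBoundary_chain]
  constructor
  · intro h σ
    simpa using congrFun (eq_of_sum_chain_eq o' h) (e n σ)
  · intro h
    exact Finset.sum_congr rfl fun σ _ => by rw [← h, Equiv.apply_symm_apply]

theorem isRankOne_iff_incidence_ne_zero (τ : cell C (n + 1)) (σ : cell C n) :
    IsRankOne (C := C) ⟨n, σ⟩ ⟨n + 1, τ⟩ ↔ o.incidence n τ σ ≠ 0 := by
  refine ⟨fun h => ?_, fun h => by_contra fun h' => h (incidence_of_not_isRankOne o h')⟩
  rcases incidence_of_isRankOne o h with h | h <;> rw [h] <;> decide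

/-- Rank one is the nonvanishing of the incidence number, so the combined condition is equality of
the numbers, including the zeros. -/
theorem incidence_eq_iff (e : ∀ n, cell C n ≃ cell D n) (τ : cell C (n + 1)) (σ : cell C n) :
    ((IsRankOne (C := C) ⟨n, σ⟩ ⟨n + 1, τ⟩ ↔
        IsRankOne (C := D) ⟨n, e n σ⟩ ⟨n + 1, e (n + 1) τ⟩) ∧
      (IsRankOne (C := C) ⟨n, σ⟩ ⟨n + 1, τ⟩ →
        o'.incidence n (e (n + 1) τ) (e n σ) = o.incidence n τ σ)) ↔
      o'.incidence n (e (n + 1) τ) (e n σ) = o.incidence n τ σ := by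
  rw [isRankOne_iff_incidence_ne_zero o, isRankOne_iff_incidence_ne_zero o']
  grind

theorem commutes_iff (e : ∀ n, cell C n ≃ cell D n) :
    (∀ (n : ℕ) (τ : cell C (n + 1)) (σ : cell C n),
      (IsRankOne (C := C) ⟨n, σ⟩ ⟨n + 1, τ⟩ ↔
        IsRankOne (C := D) ⟨n, e n σ⟩ ⟨n + 1, e (n + 1) τ⟩) ∧
      (IsRankOne (C := C) ⟨n, σ⟩ ⟨n + 1, τ⟩ →
        o'.incidence n (e (n + 1) τ) (e n σ) = o.incidence n τ σ)) ↔
      ∀ (n : ℕ) (x : CellularChains C (n + 1)),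
        cellularBoundary D n (chainEquiv o o' (e (n + 1)) x) =
          chainEquiv o o' (e n) (cellularBoundary C n x) := by
  simp only [incidence_eq_iff]
  refine forall_congr' fun n => ⟨fun h x => ?_, fun h τ =>
    (boundary_chainEquiv_chain_iff o o' e τ).mp (h _)⟩
  refine LinearMap.congr_fun (f := cellularBoundary D n ∘ₗ
    (chainEquiv o o' (e (n + 1))).toLinearMap) (g := (chainEquiv o o' (e n)).toLinearMap ∘ₗ
      cellularBoundary C n) ((chainBasis o (n + 1)).ext fun τ => ?_) x
  rw [chainBasis_apply]
  exact (boundary_chainEquiv_chain_iff o o' e τ).mpr (h τ)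

end Equivalence

end Chains

end

noncomputable section

namespace IncidenceCoalgebra

/-! ### Tensors of chains and iterated coproducts in the incidence coalgebra -/

section Chains

variable {P : Type*} [PartialOrder P]

theorem interval_congr {a b a' b' : P} (h : a ≤ b) (h' : a' ≤ b') (ha : a = a') (hb : b = b') :
    interval h = interval h' := by
  subst ha hb
  rfl

/-- A chain is determined by its consecutive intervals, so these tensors are distinct members of the
tensor power basis. -/
theorem linearIndependent_chainTensor (r : ℕ) :
    LinearIndependent ℚ (chainTensor : (Fin (r + 2) →o P) → _) := by
  let p (c : Fin (r + 2) →o P) (i : Fin (r + 1)) : {p : P × P // p.1 ≤ p.2} :=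
    ⟨(c i.castSucc, c i.succ), c.monotone (Fin.castSucc_le_succ i)⟩
  have hp : Function.Injective p := fun c d h => by
    ext i
    refine Fin.cases ?_ (fun i => ?_) i
    · exact congrArg (fun q => q.1.1) (congrFun h 0)
    · exact congrArg (fun q => q.1.2) (congrFun h i)
  have e : chainTensor = (Basis.piTensorProduct fun _ : Fin (r + 1) => basis P) ∘ p := funext fun c =>
    (Basis.piTensorProduct_apply (fun _ : Fin (r + 1) => basis P) (p c)).symm
  rw [e]
  exact (Basis.piTensorProduct fun _ : Fin (r + 1) => basis P).linearIndependent.comp p hp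

variable [LocallyFiniteOrder P]

theorem strictMono_iff_counit_eq_zero {r : ℕ} (c : Fin (r + 2) →o P) :
    StrictMono c ↔ ∀ i : Fin (r + 1), CoalgebraStruct.counit (R := ℚ)
      (interval (c.monotone (Fin.castSucc_le_succ i))) = 0 := by
  classical
  rw [Fin.strictMono_iff_lt_succ]
  refine forall_congr' fun i => ?_
  rw [counit_interval, ite_eq_right_iff, (c.monotone (Fin.castSucc_le_succ i)).lt_iff_ne]
  simp

open Classical in
theorem repr_tmul_interval {a b c d : P} (h : a ≤ b) (h' : c ≤ d)
    (p q : {p : P × P // p.1 ≤ p.2}) :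
    ((basis P).tensorProduct (basis P)).repr (interval h ⊗ₜ[ℚ] interval h') (p, q) =
      if p.1 = (a, b) ∧ q.1 = (c, d) then 1 else 0 := by
  rw [Module.Basis.tensorProduct_repr_tmul_apply, interval, interval, Module.Basis.repr_self,
    Module.Basis.repr_self, Finsupp.single_apply, Finsupp.single_apply]
  simp only [Subtype.ext_iff, eq_comm (a := p.1), eq_comm (a := q.1)]
  split_ifs <;> simp_all

/-- Coefficients at `[a, c] ⊗ [c, b]` are compared: the coproduct has 1 for every `c` in the
interval, the right-hand side only counts whether `c` is an endpoint. -/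
theorem covBy_iff_comul_eq {a b : P} (h : a ≤ b) : a ⋖ b ↔
    CoalgebraStruct.comul (R := ℚ) (interval h) =
      interval (le_refl a) ⊗ₜ[ℚ] interval h + interval h ⊗ₜ[ℚ] interval (le_refl b) := by
  classical
  rw [comul_interval]
  constructor
  · intro hab
    have huniv : (Finset.univ : Finset (Set.Icc a b)) =
        {⟨a, le_rfl, h⟩, ⟨b, h, le_rfl⟩} := by
      refine Finset.ext fun c => ?_
      have := hab.eq_or_eq c.2.1 c.2.2
      simpa [Subtype.ext_iff] using this
    rw [huniv, Finset.sum_pair (fun e => hab.ne (congrArg Subtype.val e))]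
  · intro e
    have key (c : P) (hc : c ∈ Set.Icc a b) :
        (1 : ℚ) = (if c = a then 1 else 0) + if c = b then 1 else 0 := by
      have := congrArg (fun t => ((basis P).tensorProduct (basis P)).repr t
        (⟨(a, c), hc.1⟩, ⟨(c, b), hc.2⟩)) e
      simp only [map_sum, map_add, Finsupp.add_apply, Finsupp.finsetSum_apply,
        repr_tmul_interval, Prod.mk.injEq, true_and, and_true, and_self] at this
      rw [Finset.sum_eq_single ⟨c, hc⟩ (fun d _ hd => if_neg fun e => hd (Subtype.ext e.symm))
        (fun h => absurd (Finset.mem_univ _) h), if_pos rfl] at this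
      exact this
    -- For a degenerate interval the two terms on the right coincide and would have coefficient 2.
    have hne : a ≠ b := by
      rintro rfl
      have := key a ⟨le_rfl, le_rfl⟩
      simp at this
    refine ⟨lt_of_le_of_ne h hne, fun c hc hc' => ?_⟩
    have := key c ⟨hc.le, hc'.le⟩
    rw [if_neg hc.ne', if_neg hc'.ne] at this
    norm_num at this

/-- The chain obtained from `c` by adding a last element. -/
def snocChain {r : ℕ} (c : Fin (r + 2) →o P) {b : P} (h : c (Fin.last (r + 1)) ≤ b) :
    Fin (r + 3) →o P :=
  ⟨Fin.snoc (α := fun _ => P) c b, Fin.monotone_iff_le_succ.mpr fun i => by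
    refine Fin.lastCases ?_ (fun i => ?_) i
    · rw [Fin.snoc_castSucc, Fin.succ_last, Fin.snoc_last]
      exact h
    · rw [Fin.snoc_castSucc, Fin.succ_castSucc, Fin.snoc_castSucc]
      exact c.monotone (Fin.castSucc_le_succ i)⟩

theorem snocChain_castSucc {r : ℕ} (c : Fin (r + 2) →o P) {b : P}
    (h : c (Fin.last (r + 1)) ≤ b) (i : Fin (r + 2)) : snocChain c h i.castSucc = c i :=
  Fin.snoc_castSucc (α := fun _ => P) b c i

theorem snocChain_last {r : ℕ} (c : Fin (r + 2) →o P) {b : P} (h : c (Fin.last (r + 1)) ≤ b) :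
    snocChain c h (Fin.last (r + 2)) = b :=
  Fin.snoc_last (α := fun _ => P) b c

theorem chainTensor_snocChain {r : ℕ} (c : Fin (r + 2) →o P) {b : P}
    (h : c (Fin.last (r + 1)) ≤ b) : chainTensor (snocChain c h) =
      TensorPower.mulEquiv (chainTensor c ⊗ₜ[ℚ]
        (PiTensorProduct.tprod ℚ fun _ : Fin 1 => interval h)) := by
  rw [← TensorPower.gMul_def, chainTensor, chainTensor, TensorPower.tprod_mul_tprod,
    Fin.append_right_eq_snoc]
  congr 1
  funext i
  refine Fin.lastCases ?_ (fun i => ?_) i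
  · rw [Fin.snoc_last]
    exact interval_congr _ _ (snocChain_castSucc c h _) (snocChain_last c h)
  · rw [Fin.snoc_castSucc]
    exact interval_congr _ _ (snocChain_castSucc c h _) (snocChain_castSucc c h i.succ)

/-- The intermediate point is the last element of the chain, so equality of chains settles the
dependent equality. -/
theorem sigma_chain_ext {r : ℕ} {a b : P}
    {x y : Σ d : Set.Icc a b, {c : Fin (r + 2) →o P // c 0 = a ∧ c (Fin.last (r + 1)) = d}}
    (h : x.2.1 = y.2.1) : x = y := by
  obtain ⟨⟨d, hd⟩, ⟨c, hc⟩⟩ := x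
  obtain ⟨⟨d', hd'⟩, ⟨c', hc'⟩⟩ := y
  obtain rfl : c = c' := h
  obtain rfl : d = d' := hc.2.symm.trans hc'.2
  rfl

theorem finite_chain [Finite P] (r : ℕ) : Finite (Fin r →o P) :=
  Finite.of_injective _ (DFunLike.coe_injective (F := Fin r →o P))

/-- The outer coproduct chooses the penultimate element, the inductive expansion chooses a chain up
to it, and concatenation with the last interval is a bijection onto the longer chains. -/
theorem iteratedComul_interval_eq_sum [Finite P] (r : ℕ) {a b : P} (h : a ≤ b)
    [Fintype {c : Fin (r + 2) →o P // c 0 = a ∧ c (Fin.last (r + 1)) = b}] :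
    iteratedComul r (interval h) =
      ∑ c : {c : Fin (r + 2) →o P // c 0 = a ∧ c (Fin.last (r + 1)) = b}, chainTensor c.1 := by
  induction r generalizing a b with
  | zero =>
    let c₀ : {c : Fin 2 →o P // c 0 = a ∧ c (Fin.last 1) = b} :=
      ⟨⟨![a, b], Fin.monotone_iff_le_succ.mpr fun i => by
        obtain rfl := Subsingleton.elim i 0
        exact h⟩, rfl, rfl⟩
    have huniq (c : {c : Fin 2 →o P // c 0 = a ∧ c (Fin.last 1) = b}) : c = c₀ := by
      refine Subtype.ext (OrderHom.ext _ _ (funext fun i => ?_))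
      fin_cases i
      · exact c.2.1
      · exact c.2.2
    rw [Fintype.sum_eq_single c₀ fun c hc => absurd (huniq c) hc]
    change (PiTensorProduct.subsingletonEquiv (R := ℚ) (s := fun _ => _) 0).symm _ = _
    rw [PiTensorProduct.subsingletonEquiv_symm_apply', chainTensor]
    congr 1
    funext i
    obtain rfl := Subsingleton.elim i 0
    rfl
  | succ r ih =>
    have := finite_chain (P := P) (r + 2)
    have (d : P) := Fintype.ofFinite {c : Fin (r + 2) →o P // c 0 = a ∧ c (Fin.last (r + 1)) = d}
    rw [iteratedComul, LinearMap.comp_apply, LinearMap.comp_apply, comul_interval]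
    simp only [map_sum, TensorProduct.map_tmul, LinearEquiv.coe_coe,
      PiTensorProduct.subsingletonEquiv_symm_apply', ih, TensorProduct.sum_tmul]
    rw [Finset.sum_sigma']
    refine Finset.sum_bij'
      (fun x _ => ⟨snocChain x.2.1 (x.2.2.2.trans_le x.1.2.2),
        (snocChain_castSucc x.2.1 _ 0).trans x.2.2.1, snocChain_last _ _⟩)
      (fun c _ => ⟨⟨c.1 (Fin.last (r + 1)).castSucc,
        c.2.1.symm.trans_le (c.1.monotone (Fin.zero_le _)),
        (c.1.monotone (Fin.le_last _)).trans_eq c.2.2⟩,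
        ⟨c.1.comp Fin.castSuccOrderEmb.toOrderHom, c.2.1, rfl⟩⟩)
      (fun _ _ => Finset.mem_univ _) (fun _ _ => Finset.mem_univ _) ?_ ?_ ?_
    · exact fun x _ => sigma_chain_ext (OrderHom.ext _ _ (funext fun i =>
        snocChain_castSucc x.2.1 (x.2.2.2.trans_le x.1.2.2) i))
    · rintro ⟨c, hc, rfl⟩ -
      refine Subtype.ext (OrderHom.ext _ _ (funext fun i => ?_))
      refine Fin.lastCases ?_ (fun i => ?_) i
      · exact snocChain_last (c.comp Fin.castSuccOrderEmb.toOrderHom) (c.monotone (Fin.le_last _))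
      · exact snocChain_castSucc (c.comp Fin.castSuccOrderEmb.toOrderHom)
          (c.monotone (Fin.le_last _)) i
    · intro x _
      rw [chainTensor_snocChain, interval_congr _ x.1.2.2 x.2.2.2 rfl]

theorem iteratedComul_interval [Finite P] (r : ℕ) {a b : P} (h : a ≤ b) :
    iteratedComul r (interval h) =
      ∑ᶠ (c : Fin (r + 2) →o P) (_ : c 0 = a ∧ c (Fin.last (r + 1)) = b), chainTensor c := by
  have := finite_chain (P := P) (r + 2)
  have := Fintype.ofFinite {c : Fin (r + 2) →o P // c 0 = a ∧ c (Fin.last (r + 1)) = b}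
  rw [iteratedComul_interval_eq_sum, ← finsum_subtype_eq_finsum_cond, finsum_eq_sum_of_fintype]

end Chains

end IncidenceCoalgebra

end

theorem mainTheorem6 {X : Type u} [TopologicalSpace X] [T2Space X] (C : Set X) [CWComplex C]
    [CWComplex.Finite C] [RegularCW.IsRegular C] (o : RegularCW.Orientation C) :
    -- the incidence numbers are well defined; `[τ : σ] = ±1` on rank-one intervals, `0` otherwise
    (∀ (n : ℕ) (τ : RelCWComplex.cell C (n + 1)) (σ : RelCWComplex.cell C n),
      (∀ k : ℤ, o.IsDegree n τ σ k ↔ k = o.incidence n τ σ) ∧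
      (RegularCW.IsRankOne (C := C) ⟨n, σ⟩ ⟨n + 1, τ⟩ →
        o.incidence n τ σ = 1 ∨ o.incidence n τ σ = -1) ∧
      (¬ RegularCW.IsRankOne (C := C) ⟨n, σ⟩ ⟨n + 1, τ⟩ → o.incidence n τ σ = 0)) ∧
    -- the oriented `n`-cells form a basis of the `n`-th cellular chain group
    (∀ n : ℕ, LinearIndependent ℤ (o.chain n) ∧
      Submodule.span ℤ (Set.range (o.chain n)) = ⊤) ∧
    -- the boundary operator is given by the rank-one intervals and their incidence numbers
    (∀ (n : ℕ) (τ : RelCWComplex.cell C (n + 1)),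
      RegularCW.cellularBoundary C n (o.chain (n + 1) τ) =
        ∑ᶠ (σ : RelCWComplex.cell C n)
          (_ : RegularCW.IsRankOne (C := C) ⟨n, σ⟩ ⟨n + 1, τ⟩),
          o.incidence n τ σ • o.chain n σ) ∧
    (∀ n : ℕ, RegularCW.cellularBoundary C n ∘ₗ RegularCW.cellularBoundary C (n + 1) = 0) ∧
    -- rank-one intervals decorated by incidence numbers are equivalent to the boundary operator
    (∀ {Y : Type v} [TopologicalSpace Y] [T2Space Y] (D : Set Y) [CWComplex D]
      [CWComplex.Finite D] [RegularCW.IsRegular D] (o' : RegularCW.Orientation D)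
      (e : ∀ n : ℕ, RelCWComplex.cell C n ≃ RelCWComplex.cell D n),
      ∃ Φ : ∀ n : ℕ, RegularCW.CellularChains C n ≃ₗ[ℤ] RegularCW.CellularChains D n,
        (∀ (n : ℕ) (σ : RelCWComplex.cell C n), Φ n (o.chain n σ) = o'.chain n (e n σ)) ∧
        ((∀ (n : ℕ) (τ : RelCWComplex.cell C (n + 1)) (σ : RelCWComplex.cell C n),
            (RegularCW.IsRankOne (C := C) ⟨n, σ⟩ ⟨n + 1, τ⟩ ↔
              RegularCW.IsRankOne (C := D) ⟨n, e n σ⟩ ⟨n + 1, e (n + 1) τ⟩) ∧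
            (RegularCW.IsRankOne (C := C) ⟨n, σ⟩ ⟨n + 1, τ⟩ →
              o'.incidence n (e (n + 1) τ) (e n σ) = o.incidence n τ σ)) ↔
          ∀ (n : ℕ) (x : RegularCW.CellularChains C (n + 1)),
            RegularCW.cellularBoundary D n (Φ (n + 1) x) =
              Φ n (RegularCW.cellularBoundary C n x))) ∧
    -- the face poset and its incidence coalgebra detect the rank-one intervals
    (∀ σ τ : RegularCW.Face C, RegularCW.IsRankOne σ τ ↔ σ ⋖ τ) ∧
    (∀ (σ τ : RegularCW.Face C) (h : σ ≤ τ), RegularCW.IsRankOne σ τ ↔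
      CoalgebraStruct.comul (R := ℚ) (IncidenceCoalgebra.interval h) =
        IncidenceCoalgebra.interval (le_refl σ) ⊗ₜ[ℚ] IncidenceCoalgebra.interval h +
          IncidenceCoalgebra.interval h ⊗ₜ[ℚ] IncidenceCoalgebra.interval (le_refl τ)) ∧
    -- the iterated coproducts record all flags, and the counit singles out the strict ones
    (∀ (r : ℕ) (σ τ : RegularCW.Face C) (h : σ ≤ τ),
      IncidenceCoalgebra.iteratedComul r (IncidenceCoalgebra.interval h) =
        ∑ᶠ (c : Fin (r + 2) →o RegularCW.Face C) (_ : c 0 = σ ∧ c (Fin.last (r + 1)) = τ),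
          IncidenceCoalgebra.chainTensor c) ∧
    (∀ r : ℕ, LinearIndependent ℚ
      (IncidenceCoalgebra.chainTensor : (Fin (r + 2) →o RegularCW.Face C) → _)) ∧
    (∀ (r : ℕ) (c : Fin (r + 2) →o RegularCW.Face C), StrictMono c ↔
      ∀ i : Fin (r + 1), CoalgebraStruct.counit (R := ℚ)
        (IncidenceCoalgebra.interval (c.monotone (Fin.castSucc_le_succ i))) = 0) := by
  refine ⟨fun n τ σ => ⟨fun k => Chains.isDegree_iff_eq_incidence o,
      Chains.incidence_of_isRankOne o, Chains.incidence_of_not_isRankOne o⟩,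
    fun n => ⟨Chains.linearIndependent_chain o n, Chains.span_chain o n⟩,
    fun n τ => Chains.cellularBoundary_chain_eq_finsum o τ,
    Chains.cellularBoundary_cellularBoundary,
    fun D _ _ _ o' e => ⟨fun n => Chains.chainEquiv o o' (e n),
      fun n σ => Chains.chainEquiv_chain o o' (e n) σ, Chains.commutes_iff o o' e⟩,
    fun σ τ => Chains.isRankOne_iff_covBy o,
    fun σ τ h => (Chains.isRankOne_iff_covBy o).trans (IncidenceCoalgebra.covBy_iff_comul_eq h),
    fun r σ τ h => IncidenceCoalgebra.iteratedComul_interval r h,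
    IncidenceCoalgebra.linearIndependent_chainTensor,
    fun r c => IncidenceCoalgebra.strictMono_iff_counit_eq_zero c⟩
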